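/- Let $f_0(\rho)=2\arctan\rho$ be the ground state self-similar co-rotational wave map, and on $(0,1)$ put $w(\rho)=\frac{\rho^2}{(1-\rho^2)^2}$, $p(\rho)=\rho^2$, $q_0(\rho)=\frac{2(1-\rho^2)\cos(2f_0(\rho))-\rho^2}{(1-\rho^2)^2}$. Let $H=L^2_w(0,1)$ be the complex Hilbert space with inner product $(u|v)_H=\int_0^1u\overline{v}\,w\,d\rho$, and let $A_0u=\frac1w\left(-(pu')'+q_0u\right)$ with domain $$\mathcal D(A_0)=\{u\in H:\ u,\,pu'\in AC_{\mathrm{loc}}(0,1),\ A_0u\in H\}.$$ Derivatives of $H$-valued functions on $[0,\infty)$, written $\dot{}=\frac{d}{d\sigma}$, are taken in the norm of $H$ (one-sided at $\sigma=0$). Then there is exactly one nonnegative self-adjoint operator $A_0^{1/2}$ in $H$ with $A_0^{1/2}A_0^{1/2}=A_0$ (including domains), and the following hold. (1) For all $u_0,u_1\in\mathcal D(A_0)$ the Cauchy problem $$\ddot u(\sigma)+A_0u(\sigma)=0\ \ (\sigma>0),\qquad u(0)=u_0,\quad \dot u(0)=u_1$$ has a unique solution $u:[0,\infty)\to\mathcal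 D(A_0)\subset H$, and $\sigma\mapsto\|A_0^{1/2}u(\sigma)\|_H^2+\|\dot u(\sigma)\|_H^2$ is constant on $[0,\infty)$. (2) On $\mathcal D(A_0^{1/2})\times H$ the expression $\|(x,v)\|_E:=\left(\|A_0^{1/2}x\|_H^2+\|v\|_H^2\right)^{1/2}$ is a norm, i.e. it vanishes only at $(0,0)$. (3) No linear perturbation of $f_0$ grows faster than the gauge instability, in the following sense. The gauge instability $\phi^G(\sigma,\rho)=e^\sigma\rho\sqrt{1-\rho^2}\,f_0'(\rho)$ solves the linearized equation $$\phi_{\sigma\sigma}-2\phi_\sigma-(1-\rho^2)^2\phi_{\rho\rho}-\frac{2(1-\rho^2)^2}{\rho}\phi_\rho+\frac{2(1-\rho^2)\cos(2f_0)}{\rho^2}\phi=0$$ on $\mathbb R\times(0,1)$, is positive there, and satisfies $\phi^G(\sigma,\rho)=e^\sigma\phi^G(0,\rho)$. If $\phi:[0,\infty)\to\mathcal D(A_0)$ is a solution of this equation in its operator form $\ddot\phi-2\dot\phi+(A_0+1)\phi=0$ for $\sigma>0$, with $\phi(0),\dot\phi(0)\in\mathcal D(A_0)$, then for all $\sigma\ge0$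 $$\|(\phi(\sigma),\dot\phi(\sigma)-\phi(\sigma))\|_E=e^{\sigma}\,\|(\phi(0),\dot\phi(0)-\phi(0))\|_E .$$ (With $\tilde\phi=e^{-\sigma}\phi$ the left side is $e^\sigma\|(\tilde\phi(\sigma),\dot{\tilde\phi}(\sigma))\|_E$.) -/

import Mathlib

open MeasureTheory Set Filter
open scoped InnerProductSpace Topology

noncomputable section

namespace WaveMap

/-! ### The self-similar wave map `f₀` and the coefficients of the linearized problem -/

/-- The ground state self-similar wave map `f₀(ρ) = 2 arctan ρ`. -/
def f₀ (ρ : ℝ) : ℝ := 2 * Real.arctan ρ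

/-- The weight `w(ρ) = ρ² / (1 - ρ²)²`. -/
def weight (ρ : ℝ) : ℝ := ρ ^ 2 / (1 - ρ ^ 2) ^ 2

/-- The coefficient `p(ρ) = ρ²`. -/
def coeffP (ρ : ℝ) : ℝ := ρ ^ 2

/-- The coefficient `q₀(ρ) = (2 (1 - ρ²) cos (2 f₀(ρ)) - ρ²) / (1 - ρ²)²`. -/
def coeffQ (ρ : ℝ) : ℝ :=
  (2 * (1 - ρ ^ 2) * Real.cos (2 * f₀ ρ) - ρ ^ 2) / (1 - ρ ^ 2) ^ 2

/-! ### The weighted Hilbert space -/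

/-- The measure `w(ρ) dρ` on the interval `(0, 1)`. -/
def wMeasure : Measure ℝ :=
  (volume.restrict (Ioo (0 : ℝ) 1)).withDensity fun ρ => ENNReal.ofReal (weight ρ)

/-- The complex Hilbert space `H = L²_w(0, 1)`. -/
abbrev H : Type := Lp ℂ 2 wMeasure

/-! ### The operator `A₀` -/

/-- `f ∈ AC_loc(0, 1)`: `f` is absolutely continuous on every compact subinterval of `(0, 1)`. -/
def ACloc (f : ℝ → ℂ) : Prop :=
  ∀ a b : ℝ, 0 < a → a ≤ b → b < 1 → AbsolutelyContinuousOnInterval f a b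

/-- `u ∈ H` lies in the domain of the maximal operator of
`a₀ u = (1 / w) (-(p u')' + q₀ u)`, and `a₀ u = h` with `h ∈ H`. Here `f` is the locally absolutely
continuous representative of the class `u`, and `g` that of `p u'`. -/
def MaximalRel (u h : H) : Prop :=
  ∃ f g : ℝ → ℂ, ACloc f ∧ ACloc g ∧ u =ᵐ[wMeasure] f ∧
    (∀ᵐ ρ ∂(volume.restrict (Ioo (0 : ℝ) 1)), g ρ = (coeffP ρ : ℂ) * deriv f ρ) ∧
    h =ᵐ[wMeasure] fun ρ => (1 / (weight ρ : ℂ)) * (-deriv g ρ + (coeffQ ρ : ℂ) * f ρ)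

theorem weight_pos {ρ : ℝ} (h : ρ ∈ Ioo (0 : ℝ) 1) : 0 < weight ρ := by
  have h1 : 0 < 1 - ρ ^ 2 := by nlinarith [h.1, h.2]
  have h0 := h.1
  unfold weight
  positivity

theorem measurable_weight : Measurable weight := by
  unfold weight
  fun_prop

/-- The weighted measure and Lebesgue measure on `(0, 1)` have the same null sets. -/
theorem ae_wMeasure : ae wMeasure = ae (volume.restrict (Ioo (0 : ℝ) 1)) := by
  apply le_antisymm
  · exact (withDensity_absolutelyContinuous _ _).ae_le
  · refine Measure.AbsolutelyContinuous.ae_le (withDensity_absolutelyContinuous' ?_ ?_)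
    · exact (measurable_weight.ennreal_ofReal).aemeasurable
    · filter_upwards [ae_restrict_mem measurableSet_Ioo] with ρ hρ
      simpa using weight_pos hρ

theorem ACloc.add {f g : ℝ → ℂ} (hf : ACloc f) (hg : ACloc g) : ACloc (f + g) :=
  fun a b ha hab hb => (hf a b ha hab hb).add (hg a b ha hab hb)

theorem ACloc.smul (c : ℂ) {f : ℝ → ℂ} (hf : ACloc f) : ACloc (c • f) :=
  fun a b ha hab hb => (hf a b ha hab hb).const_smul c

theorem ACloc.zero : ACloc 0 := fun a b _ _ _ =>
  ((LipschitzWith.const (0 : ℂ)).lipschitzOnWith (s := uIcc a b)).absolutelyContinuousOnInterval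

theorem ACloc.continuousOn {f : ℝ → ℂ} (hf : ACloc f) : ContinuousOn f (Ioo 0 1) := by
  intro x hx
  have hab : x / 2 ≤ (x + 1) / 2 := by linarith
  have h := (hf (x / 2) ((x + 1) / 2) (by linarith [hx.1]) hab (by linarith [hx.2])).continuousOn
  rw [uIcc_of_le hab] at h
  exact (h.continuousAt (Icc_mem_nhds (by linarith [hx.1]) (by linarith [hx.2]))).continuousWithinAt

theorem ACloc.ae_differentiableAt {f : ℝ → ℂ} (hf : ACloc f) :
    ∀ᵐ ρ ∂(volume.restrict (Ioo (0 : ℝ) 1)), DifferentiableAt ℝ f ρ := by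
  rw [ae_restrict_iff' measurableSet_Ioo]
  have key : ∀ n : ℕ, ∀ᵐ ρ : ℝ, ρ ∈ uIcc (1 / ((n : ℝ) + 2)) (1 - 1 / ((n : ℝ) + 2)) →
      DifferentiableAt ℝ f ρ := by
    intro n
    have h2 : (1 : ℝ) / ((n : ℝ) + 2) ≤ 1 / 2 := by gcongr; linarith [n.cast_nonneg (α := ℝ)]
    have h0 : (0 : ℝ) < 1 / ((n : ℝ) + 2) := by positivity
    exact (hf _ _ h0 (by linarith) (by linarith)).boundedVariationOn.ae_differentiableAt_of_mem_uIcc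
  filter_upwards [ae_all_iff.2 key] with ρ hρ hmem
  obtain ⟨n, hn⟩ := exists_nat_one_div_lt (lt_min hmem.1 (sub_pos.2 hmem.2))
  have h3 : (1 : ℝ) / ((n : ℝ) + 2) ≤ 1 / ((n : ℝ) + 1) := by gcongr; linarith
  have h4 := lt_of_le_of_lt h3 hn
  refine hρ n ⟨?_, ?_⟩
  · exact le_trans (min_le_left _ _) (le_trans h4.le (min_le_left _ _))
  · refine le_trans ?_ (le_max_right _ _)
    linarith [h4.le.trans (min_le_right _ _)]

theorem ACloc.eqOn_zero {f : ℝ → ℂ} (hf : ACloc f)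
    (h : ∀ᵐ ρ ∂(volume.restrict (Ioo (0 : ℝ) 1)), f ρ = 0) : EqOn f 0 (Ioo 0 1) :=
  Measure.eqOn_open_of_ae_eq h isOpen_Ioo hf.continuousOn continuousOn_const

theorem deriv_eq_zero_of_eqOn {f : ℝ → ℂ} (h : EqOn f 0 (Ioo 0 1)) {ρ : ℝ}
    (hρ : ρ ∈ Ioo (0 : ℝ) 1) : deriv f ρ = 0 := by
  have : f =ᶠ[𝓝 ρ] fun _ => (0 : ℂ) := h.eventuallyEq_of_mem (isOpen_Ioo.mem_nhds hρ)
  rw [this.deriv_eq, deriv_const]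

/-- The graph of the maximal operator. -/
def maximalGraph : Submodule ℂ (H × H) where
  carrier := {x | MaximalRel x.1 x.2}
  zero_mem' := by
    refine ⟨0, 0, ACloc.zero, ACloc.zero, Lp.coeFn_zero _ _ _, ?_, ?_⟩
    · refine Eventually.of_forall fun ρ => ?_
      simp
    · refine (Lp.coeFn_zero _ _ _).trans (Eventually.of_forall fun ρ => ?_)
      simp
  add_mem' := by
    rintro ⟨u, h⟩ ⟨u', h'⟩ ⟨f, g, hf, hg, e1, e2, e3⟩ ⟨f', g', hf', hg', e1', e2', e3'⟩
    refine ⟨f + f', g + g', hf.add hf', hg.add hg', ?_, ?_, ?_⟩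
    · exact (Lp.coeFn_add _ _).trans (e1.add e1')
    · filter_upwards [e2, e2', hf.ae_differentiableAt, hf'.ae_differentiableAt] with ρ a b c d
      simp only [Pi.add_apply, a, b, deriv_add c d]
      ring
    · have d := hg.ae_differentiableAt
      have d' := hg'.ae_differentiableAt
      rw [← ae_wMeasure] at d d'
      refine (Lp.coeFn_add _ _).trans ?_
      filter_upwards [e3, e3', d, d'] with ρ a b c d
      simp only [Pi.add_apply, a, b, deriv_add c d]
      ring
  smul_mem' := by
    rintro c ⟨u, h⟩ ⟨f, g, hf, hg, e1, e2, e3⟩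
    refine ⟨c • f, c • g, hf.smul c, hg.smul c, ?_, ?_, ?_⟩
    · exact (Lp.coeFn_smul _ _).trans (e1.const_smul c)
    · filter_upwards [e2, hf.ae_differentiableAt] with ρ a b
      simp only [Pi.smul_apply, a, deriv_const_smul c b, smul_eq_mul]
      ring
    · have d := hg.ae_differentiableAt
      rw [← ae_wMeasure] at d
      refine (Lp.coeFn_smul _ _).trans ?_
      filter_upwards [e3, d] with ρ a b
      simp only [Pi.smul_apply, a, deriv_const_smul c b, smul_eq_mul]
      ring

/-- The maximal relation is single valued. -/
theorem maximalGraph_snd_eq_zero (x : H × H) (hx : x ∈ maximalGraph) (h0 : x.1 = 0) : x.2 = 0 := by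
  obtain ⟨f, g, hf, hg, e1, e2, e3⟩ := hx
  have hf0 : EqOn f 0 (Ioo 0 1) := by
    refine hf.eqOn_zero ?_
    rw [← ae_wMeasure]
    have hz : (x.1 : ℝ → ℂ) =ᵐ[wMeasure] 0 := by rw [h0]; exact Lp.coeFn_zero _ _ _
    filter_upwards [e1, hz] with ρ a b
    rw [← a, b]; rfl
  have hg0 : EqOn g 0 (Ioo 0 1) := by
    refine hg.eqOn_zero ?_
    filter_upwards [e2, ae_restrict_mem measurableSet_Ioo] with ρ a b
    rw [a, deriv_eq_zero_of_eqOn hf0 b, mul_zero]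
  have hm : ∀ᵐ ρ ∂wMeasure, ρ ∈ Ioo (0 : ℝ) 1 := by
    rw [ae_wMeasure]; exact ae_restrict_mem measurableSet_Ioo
  refine (Lp.eq_zero_iff_ae_eq_zero).2 ?_
  filter_upwards [e3, hm] with ρ a b
  rw [a, deriv_eq_zero_of_eqOn hg0 b, hf0 b]
  simp

/-- The operator `A₀` with domain
`D(A₀) = {u ∈ H : u, p u' ∈ AC_loc(0, 1), a₀ u ∈ H}` and `A₀ u = a₀ u`. -/
def A₀ : H →ₗ.[ℂ] H := maximalGraph.toLinearPMap

theorem A₀_graph : A₀.graph = maximalGraph :=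
  Submodule.toLinearPMap_graph_eq _ maximalGraph_snd_eq_zero

theorem mem_A₀_domain_iff (u : H) : u ∈ A₀.domain ↔ ∃ h, MaximalRel u h := by
  rw [LinearPMap.mem_domain_iff, A₀_graph]
  rfl

theorem maximalRel_A₀ (u : A₀.domain) : MaximalRel u (A₀ u) := by
  have h := A₀.mem_graph u
  rw [A₀_graph] at h
  exact h

/-! ### The square root of an operator and the energy -/

/-- `S` is a nonnegative self-adjoint operator with `S ∘ S = A` (equality of unbounded operators,
including domains), that is, `S = A^{1/2}`. -/
structure IsNonnegSqrt (S A : H →ₗ.[ℂ] H) : Prop where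
  selfAdjoint : IsSelfAdjoint S
  nonneg : ∀ x : S.domain, 0 ≤ RCLike.re (inner ℂ (S x) (x : H))
  comp_eq : ∀ x y : H, (x, y) ∈ A.graph ↔ ∃ z : H, (x, z) ∈ S.graph ∧ (z, y) ∈ S.graph

/-- The energy `‖S x‖² + ‖v‖²` of a pair `(x, v) ∈ D(S) × H`; used with `S = A₀^{1/2}`. -/
def energy (S : H →ₗ.[ℂ] H) (x : S.domain) (v : H) : ℝ := ‖S x‖ ^ 2 + ‖v‖ ^ 2

/-! ### The Cauchy problem -/

/-- The strong derivative of an `H`-valued function on `[0, ∞)`, one-sided at `0`. -/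
def dot (u : ℝ → H) (σ : ℝ) : H := derivWithin u (Ici 0) σ

/-- `u : [0, ∞) → D(A)` solves `ü(σ) + A u(σ) = 0` for `σ > 0`, `u(0) = u₀`, `u̇(0) = u₁`, with
derivatives in the norm of `H`. Values of `u` at negative arguments are irrelevant. -/
structure IsCauchySolution (A : H →ₗ.[ℂ] H) (u₀ u₁ : H) (u : ℝ → H) : Prop where
  mem_domain : ∀ σ : ℝ, 0 ≤ σ → u σ ∈ A.domain
  differentiableOn : DifferentiableOn ℝ u (Ici 0)
  equation : ∀ (σ : ℝ) (hσ : 0 < σ),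
    HasDerivAt (dot u) (-A ⟨u σ, mem_domain σ hσ.le⟩) σ
  init : u 0 = u₀
  init_dot : dot u 0 = u₁

/-! ### Linear perturbations of `f₀` and the gauge instability -/

/-- The linear evolution equation at `f₀` for a scalar perturbation `φ(σ, ρ)`:
`φ_σσ - 2 φ_σ - (1-ρ²)² φ_ρρ - (2(1-ρ²)²/ρ) φ_ρ + (2(1-ρ²) cos(2 f₀)/ρ²) φ = 0` on
`ℝ × (0, 1)`. -/
def SolvesLinearizedWaveMap (φ : ℝ → ℝ → ℝ) : Prop :=
  ∀ σ : ℝ, ∀ ρ ∈ Ioo (0 : ℝ) 1,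
    deriv (deriv fun s => φ s ρ) σ - 2 * deriv (fun s => φ s ρ) σ
      - (1 - ρ ^ 2) ^ 2 * deriv (deriv (φ σ)) ρ
      - 2 * (1 - ρ ^ 2) ^ 2 / ρ * deriv (φ σ) ρ
      + 2 * (1 - ρ ^ 2) * Real.cos (2 * f₀ ρ) / ρ ^ 2 * φ σ ρ = 0

/-- The gauge instability `φ^G(σ, ρ) = e^σ ρ √(1 - ρ²) f₀'(ρ)`. -/
def gaugeMode (σ ρ : ℝ) : ℝ := Real.exp σ * ρ * √(1 - ρ ^ 2) * deriv f₀ ρ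

/-- `φ : [0, ∞) → D(A₀)` is a linear perturbation of `f₀` with initial data in `D(A₀)`. The spatial
part `-(1-ρ²)² φ'' - (2(1-ρ²)²/ρ) φ' + (2(1-ρ²) cos(2 f₀)/ρ²) φ` of the evolution equation equals
`a₀ φ + φ`, so that its operator form is `φ̈ - 2 φ̇ + (A₀ + 1) φ = 0`. -/
structure IsLinearPerturbation (φ : ℝ → H) : Prop where
  mem_domain : ∀ σ : ℝ, 0 ≤ σ → φ σ ∈ A₀.domain
  differentiableOn : DifferentiableOn ℝ φ (Ici 0)
  equation : ∀ (σ : ℝ) (hσ : 0 < σ),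
    HasDerivAt (dot φ) ((2 : ℝ) • dot φ σ - (A₀ ⟨φ σ, mem_domain σ hσ.le⟩ + φ σ)) σ
  init_dot_mem : dot φ 0 ∈ A₀.domain

end WaveMap

end

open WaveMap

/-! ### Bounded operators between `0` and `1` -/

section UnitInterval

variable {E : Type*} [NormedAddCommGroup E] [InnerProductSpace ℂ E] [CompleteSpace E]
  {B : E →L[ℂ] E}

/-! All unbounded operator theory is pushed into one bounded operator, the resolvent `B = (1 +
A₀)⁻¹` with `0 ≤ B ≤ 1` (`IsNonnegResolvent`), to which the continuous functional calculus applies.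

Existence of `B` comes from the gauge mode. Its profile `θ = 2ρ√(1-ρ²)/(1+ρ²)` is positive on `(0,
1)` and solves `a₀ θ = 0`, so formally `A₀ = T* T` with `T u = ρ θ (u/θ)'`. The graph of `T` is
defined weakly as an orthogonal complement, hence is closed; compressing its orthogonal projection
to the first summand gives `(1 + T* T)⁻¹` (`cornerOp`). The lemma of du Bois-Reymond yields `T* T ⊆
A₀` (`maximalRel_of_factor`). Equality holds because `-1` is not an eigenvalue of the maximal
operator (`eq_zero_of_maximalRel_neg`): for `f = θ v` the eigenvalue equation is `(P v')' = W v`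
with `P = pθ²` and `W = wθ²`, so `v · P v'` is nondecreasing, and square integrability at `1` and at
`0` forces it to be `≤ 0` and `≥ 0`. Thus no boundary conditions are needed.

With `R = √B` and `K = √(1 - B)`, the root `A^{1/2}` has graph `{(R m, K m)}`. Any other nonnegative
self-adjoint root `S` commutes with `B`; `S B` and `R K` are then two positive square roots of `B (1
- B)`, hence equal, and `S` is recovered (`sqrtOp_unique`).

The solution of the Cauchy problem is `cos (t A^{1/2}) u₀ + A^{-1/2} sin (t A^{1/2}) u₁`, built from
symbols in `x = 1/(1+λ)` that carry a factor `x` to stay continuous at `x = 0`. The energy is `Re ⟨Y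
- BY, BY⟩ + ‖V‖²` for the solution `B Y` with velocity `V`. It is differentiated for smooth data and
extended by density. Uniqueness (`wave_unique`) applies the same conservation law after smoothing by
`B`.

The energy norm is definite since `A₀ x = 0` forces `x` to be a multiple of `θ`, and `θ` is not in
`H`. The growth identity is conservation of energy for `e^{-σ} φ`, which solves the wave equation.
-/

theorem spectrum_subset_Icc (h0 : 0 ≤ B) (h1 : B ≤ 1) : spectrum ℝ B ⊆ Icc 0 1 := by
  intro x hx
  refine ⟨spectrum_nonneg_of_nonneg h0 hx, ?_⟩
  have hB : IsSelfAdjoint B := h0.isSelfAdjoint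
  have : B ≤ algebraMap ℝ (E →L[ℂ] E) 1 := by simpa using h1
  exact (le_algebraMap_iff_spectrum_le (a := B) (r := (1 : ℝ))).1 this x hx

theorem cfc_apply_inner_comm (f : ℝ → ℝ) (x y : E) :
    inner ℂ (cfc f B x) y = inner ℂ x (cfc f B y) := by
  have h : IsSelfAdjoint (cfc f B) := cfc_predicate _ _
  rw [← ContinuousLinearMap.adjoint_inner_right, ← ContinuousLinearMap.star_eq_adjoint, h.star_eq]

theorem inner_apply_comm_of_isSelfAdjoint {T : E →L[ℂ] E} (h : IsSelfAdjoint T) (x y : E) :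
    inner ℂ (T x) y = inner ℂ x (T y) := by
  rw [← ContinuousLinearMap.adjoint_inner_right, ← ContinuousLinearMap.star_eq_adjoint, h.star_eq]

/-- Pointwise domination of the symbols gives domination of the operators. -/
theorem norm_cfc_apply_le (_ : IsSelfAdjoint B) {f g : ℝ → ℝ} {M : ℝ} (hM : 0 ≤ M)
    (hf : ContinuousOn f (spectrum ℝ B)) (hg : ContinuousOn g (spectrum ℝ B))
    (h : ∀ x ∈ spectrum ℝ B, |f x| ≤ M * |g x|) (y : E) :
    ‖cfc f B y‖ ≤ M * ‖cfc g B y‖ := by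
  -- For real `k` the operator `k(B)` is self-adjoint, so squared norms are quadratic forms of
  -- `k²(B)` and the operator inequality `f² ≤ M² g²` suffices.
  have key : ∀ k : ℝ → ℝ, ContinuousOn k (spectrum ℝ B) →
      ‖cfc k B y‖ ^ 2 = RCLike.re (inner ℂ (cfc (fun x => k x * k x) B y) y) := by
    intro k hk
    rw [cfc_mul k k B hk hk, mul_apply_eq_comp, cfc_apply_inner_comm,
      inner_self_eq_norm_sq_to_K]
    norm_cast
  have hle : cfc (fun x => f x * f x) B ≤ cfc (fun x => (M ^ 2) • (g x * g x)) B := by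
    refine cfc_mono (fun x hx => ?_) (hf.mul hf)
      (show ContinuousOn (fun x => M ^ 2 • (g x * g x)) _ from (hg.mul hg).const_smul (M ^ 2))
    have := h x hx
    have h2 := mul_self_le_mul_self (abs_nonneg _) this
    rw [abs_mul_abs_self] at h2
    calc f x * f x ≤ _ := h2
      _ = M ^ 2 * (|g x| * |g x|) := by ring
      _ = M ^ 2 • (g x * g x) := by rw [abs_mul_abs_self, smul_eq_mul]
  rw [cfc_smul (M ^ 2) (fun x => g x * g x) B (hg.mul hg)] at hle
  have h3 := ((ContinuousLinearMap.le_def _ _).1 hle).re_inner_nonneg_left y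
  rw [sub_apply, inner_sub_left, map_sub, smul_apply,
    ← key f hf, inner_smul_left_eq_smul, RCLike.smul_re, ← key g hg] at h3
  refine le_of_sq_le_sq ?_ (by positivity)
  rw [mul_pow]; linarith

/-- Norm differentiability of the functional calculus in a parameter. -/
theorem hasDerivAt_cfc (_ : IsSelfAdjoint B) {f f' : ℝ → ℝ → ℝ}
    (hf : ∀ t, ContinuousOn (f t) (spectrum ℝ B)) (hf' : ∀ t, ContinuousOn (f' t) (spectrum ℝ B))
    (hd : ∀ x ∈ spectrum ℝ B, ∀ t, HasDerivAt (fun t => f t x) (f' t x) t)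
    (hl : ∀ x ∈ spectrum ℝ B, ∀ s t, |f' s x - f' t x| ≤ |s - t|) (t : ℝ) :
    HasDerivAt (fun t => cfc (f t) B) (cfc (f' t) B) t := by
  rw [hasDerivAt_iff_isLittleO]
  have hO : (fun s => cfc (f s) B - cfc (f t) B - (s - t) • cfc (f' t) B) =O[𝓝 t]
      fun s => |s - t| * |s - t| := by
    refine Asymptotics.IsBigO.of_bound 1 (Eventually.of_forall fun s => ?_)
    rw [← cfc_sub _ _ B (hf s) (hf t), ← cfc_smul _ _ B (hf' t),
      ← cfc_sub (fun x => f s x - f t x) (fun x => (s - t) • f' t x) B ((hf s).sub (hf t))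
        ((hf' t).const_smul (s - t))]
    refine norm_cfc_le (by positivity) fun x hx => ?_
    -- Mean value inequality for `r ↦ f r x - r f' t x`, whose derivative is at most `|s - t|`
    -- between `t` and `s`. The remainder is quadratic uniformly over the spectrum, which is what
    -- operator norm convergence needs.
    have := (convex_uIcc t s).norm_image_sub_le_of_norm_hasDerivWithin_le
      (f := fun r => f r x - r * f' t x) (f' := fun r => f' r x - f' t x) (C := |s - t|)
      (x := t) (y := s)
      (fun r _ => ((hd x hx r).sub (hasDerivAt_mul_const _)).hasDerivWithinAt)
      (fun r hr => (hl x hx r t).trans (abs_sub_left_of_mem_uIcc hr)) left_mem_uIcc right_mem_uIcc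
    simp only [Real.norm_eq_abs, smul_eq_mul, one_mul, abs_mul, abs_abs] at this ⊢
    calc _ = |f s x - s * f' t x - (f t x - t * f' t x)| := by congr 1; ring
      _ ≤ _ := this
  refine hO.trans_isLittleO ?_
  have h1 : (fun s : ℝ => |s - t|) =o[𝓝 t] fun _ => (1 : ℝ) := by
    rw [Asymptotics.isLittleO_one_iff]
    have : Continuous fun s : ℝ => |s - t| := by fun_prop
    simpa using this.tendsto t
  have h2 : (fun s : ℝ => |s - t|) =O[𝓝 t] fun s => s - t :=
    (Asymptotics.isBigO_refl (fun s : ℝ => s - t) (𝓝 t)).norm_left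
  simpa using h1.mul_isBigO h2

end UnitInterval

/-! ### The square root of a nonnegative operator with bounded resolvent at `-1` -/

/-- `B = (1 + A)⁻¹` for a nonnegative self-adjoint operator `A`. -/
structure IsNonnegResolvent {E : Type*} [NormedAddCommGroup E] [InnerProductSpace ℂ E]
    [CompleteSpace E] (A : E →ₗ.[ℂ] E) (B : E →L[ℂ] E) : Prop where
  nonneg : 0 ≤ B
  le_one : B ≤ 1
  mem_graph_iff : ∀ x y : E, (x, y) ∈ A.graph ↔ B (x + y) = x

namespace IsNonnegResolvent

variable {E : Type*} [NormedAddCommGroup E] [InnerProductSpace ℂ E] [CompleteSpace E]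
  {A : E →ₗ.[ℂ] E} {B : E →L[ℂ] E}

theorem isSelfAdjoint (h : IsNonnegResolvent A B) : IsSelfAdjoint B := h.nonneg.isSelfAdjoint

theorem spectrum_subset (h : IsNonnegResolvent A B) : spectrum ℝ B ⊆ Icc 0 1 :=
  spectrum_subset_Icc h.nonneg h.le_one

theorem inner_comm (h : IsNonnegResolvent A B) (x y : E) : inner ℂ (B x) y = inner ℂ x (B y) :=
  inner_apply_comm_of_isSelfAdjoint h.isSelfAdjoint x y

theorem mem_graph (h : IsNonnegResolvent A B) (v : E) : (B v, v - B v) ∈ A.graph := by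
  rw [h.mem_graph_iff]; congr 1; abel

theorem injective (h : IsNonnegResolvent A B) : Function.Injective B := by
  refine (injective_iff_map_eq_zero B).2 fun v hv => ?_
  refine A.graph_fst_eq_zero_snd (x := (0 : E)) (x' := v) ?_ rfl
  simpa [hv] using h.mem_graph v

/-- The orthogonal complement of the range of a self-adjoint operator is its kernel. -/
theorem denseRange_of_injective {T : E →L[ℂ] E} (h : IsSelfAdjoint T)
    (hi : Function.Injective T) : DenseRange T := by
  have : (LinearMap.range (T : E →ₗ[ℂ] E)).topologicalClosure = ⊤ := by
    rw [Submodule.topologicalClosure_eq_top_iff, Submodule.eq_bot_iff]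
    intro x hx
    apply hi
    rw [map_zero, ← inner_self_eq_zero (𝕜 := ℂ), inner_apply_comm_of_isSelfAdjoint h,
      ← inner_apply_comm_of_isSelfAdjoint h, inner_apply_comm_of_isSelfAdjoint h]
    rw [Submodule.mem_orthogonal'] at hx
    exact hx _ ⟨T x, rfl⟩
  rw [DenseRange, dense_iff_closure_eq]
  exact congrArg (fun s : Submodule ℂ E => (s : Set E)) this

theorem denseRange (h : IsNonnegResolvent A B) : DenseRange B :=
  denseRange_of_injective h.isSelfAdjoint h.injective

variable (B) in
/-- `(1 + A)^{-1/2}`. -/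
noncomputable def sqrtB : E →L[ℂ] E := cfc Real.sqrt B

variable (B) in
/-- `A^{1/2} (1 + A)^{-1/2}`. -/
noncomputable def sqrtC : E →L[ℂ] E := cfc (fun x => √(1 - x)) B

theorem sqrtB_isSelfAdjoint : IsSelfAdjoint (sqrtB B) := cfc_predicate _ _

theorem sqrtC_isSelfAdjoint : IsSelfAdjoint (sqrtC B) := cfc_predicate _ _

theorem sqrtB_sq (h : IsNonnegResolvent A B) (x : E) : sqrtB B (sqrtB B x) = B x := by
  have hB := h.isSelfAdjoint
  have : sqrtB B * sqrtB B = B := by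
    rw [sqrtB, ← cfc_mul .., cfc_congr (g := id), cfc_id ℝ B]
    exact fun x hx => Real.mul_self_sqrt (h.spectrum_subset hx).1
  exact congrArg (fun T : E →L[ℂ] E => T x) this

theorem sqrtC_sq (h : IsNonnegResolvent A B) (x : E) : sqrtC B (sqrtC B x) = x - B x := by
  have hB := h.isSelfAdjoint
  have : sqrtC B * sqrtC B = 1 - B := by
    rw [sqrtC, ← cfc_mul .., cfc_congr (g := fun x => 1 - x), cfc_sub .., cfc_id' ℝ B,
      cfc_const_one ..]
    exact fun x hx => Real.mul_self_sqrt (sub_nonneg.2 (h.spectrum_subset hx).2)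
  exact congrArg (fun T : E →L[ℂ] E => T x) this

theorem sqrt_comm (x : E) : sqrtB B (sqrtC B x) = sqrtC B (sqrtB B x) :=
  congrArg (fun T : E →L[ℂ] E => T x) (cfc_commute_cfc Real.sqrt (fun x => √(1 - x)) B).eq

theorem sqrtB_injective (h : IsNonnegResolvent A B) : Function.Injective (sqrtB B) := by
  refine (injective_iff_map_eq_zero _).2 fun v hv => h.injective ?_
  rw [← h.sqrtB_sq, hv, map_zero, map_zero]

variable (B) in
/-- The graph of `A^{1/2}`. -/
noncomputable def sqrtGraph : Submodule ℂ (E × E) :=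
  LinearMap.range ((sqrtB B).prod (sqrtC B) : E →ₗ[ℂ] E × E)

theorem mem_sqrtGraph (x z : E) :
    (x, z) ∈ sqrtGraph B ↔ ∃ m, sqrtB B m = x ∧ sqrtC B m = z := by
  simp [sqrtGraph]

/-- The commuting operators `R = sqrtB B` and `K = sqrtC B` satisfy `R² + K² = 1`, so the range of
`(R, K)` is cut out by the single equation `R z = K x`. In this form the graph is visibly closed and
easy to compare with adjoints. -/
theorem mem_sqrtGraph_iff (h : IsNonnegResolvent A B) (x z : E) :
    (x, z) ∈ sqrtGraph B ↔ sqrtB B z = sqrtC B x := by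
  rw [mem_sqrtGraph]
  constructor
  · rintro ⟨m, rfl, rfl⟩
    exact sqrt_comm m
  · intro hz
    -- If `x = R m` and `z = K m`, then `m = (R² + K²) m = R x + K z`.
    refine ⟨sqrtB B x + sqrtC B z, ?_, ?_⟩
    · rw [map_add, sqrt_comm, hz, h.sqrtB_sq, h.sqrtC_sq]; abel
    · rw [map_add, ← sqrt_comm, ← hz, h.sqrtB_sq, h.sqrtC_sq]; abel

variable (B) in
/-- `A^{1/2}`. -/
noncomputable def sqrtOp : E →ₗ.[ℂ] E := (sqrtGraph B).toLinearPMap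

theorem sqrtOp_graph (h : IsNonnegResolvent A B) : (sqrtOp B).graph = sqrtGraph B := by
  refine Submodule.toLinearPMap_graph_eq _ ?_
  rintro ⟨x, z⟩ hx (rfl : x = 0)
  obtain ⟨m, hm, rfl⟩ := (mem_sqrtGraph _ _).1 hx
  have : m = 0 := h.sqrtB_injective (by rw [hm, map_zero])
  simp [this]

theorem mem_graph_sqrtOp_iff (h : IsNonnegResolvent A B) (x z : E) :
    (x, z) ∈ (sqrtOp B).graph ↔ sqrtB B z = sqrtC B x := by
  rw [h.sqrtOp_graph, h.mem_sqrtGraph_iff]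

theorem mem_graph_sqrtOp (h : IsNonnegResolvent A B) (m : E) :
    (sqrtB B m, sqrtC B m) ∈ (sqrtOp B).graph := by
  rw [h.sqrtOp_graph, mem_sqrtGraph]; exact ⟨m, rfl, rfl⟩

theorem sqrtOp_dense (h : IsNonnegResolvent A B) : Dense ((sqrtOp B).domain : Set E) := by
  refine (denseRange_of_injective sqrtB_isSelfAdjoint h.sqrtB_injective).mono ?_
  rintro _ ⟨m, rfl⟩
  exact LinearPMap.mem_domain_of_mem_graph (h.mem_graph_sqrtOp m)

/-- A pair `(x, z)` lies in the adjoint graph iff `⟨K v, x⟩ = ⟨R v, z⟩` for all `v`, that is `K x =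
R z`, and this is the equation of the graph itself. -/
theorem sqrtOp_isSelfAdjoint (h : IsNonnegResolvent A B) : IsSelfAdjoint (sqrtOp B) := by
  rw [LinearPMap.isSelfAdjoint_def]
  apply LinearPMap.eq_of_eq_graph
  rw [LinearPMap.adjoint_graph_eq_graph_adjoint h.sqrtOp_dense]
  ext ⟨x, z⟩
  rw [Submodule.mem_adjoint_iff, h.mem_graph_sqrtOp_iff]
  have hR := inner_apply_comm_of_isSelfAdjoint (sqrtB_isSelfAdjoint (B := B))
  have hK := inner_apply_comm_of_isSelfAdjoint (sqrtC_isSelfAdjoint (B := B))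
  constructor
  · intro H
    refine ext_inner_left ℂ fun v => ?_
    have := H _ _ (h.mem_graph_sqrtOp v)
    rw [sub_eq_zero, hR, hK] at this
    exact this.symm
  · intro H a b hab
    rw [h.sqrtOp_graph, mem_sqrtGraph] at hab
    obtain ⟨m, rfl, rfl⟩ := hab
    rw [hR, hK, H, sub_self]

/-- On the graph the form is `⟨K m, R m⟩ = ⟨m, R K m⟩`, and `R K` has the nonnegative symbol `√x √(1
- x)`. -/
theorem sqrtOp_nonneg (h : IsNonnegResolvent A B) (x : (sqrtOp B).domain) :
    0 ≤ RCLike.re (inner ℂ (sqrtOp B x) (x : E)) := by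
  have hx := (sqrtOp B).mem_graph x
  rw [h.sqrtOp_graph, mem_sqrtGraph] at hx
  obtain ⟨m, h1, h2⟩ := hx
  rw [← h1, ← h2, ← inner_apply_comm_of_isSelfAdjoint sqrtB_isSelfAdjoint]
  have hp : (0 : E →L[ℂ] E) ≤ sqrtB B * sqrtC B := by
    have hB := h.isSelfAdjoint
    rw [sqrtB, sqrtC, ← cfc_mul ..]
    exact cfc_nonneg fun x _ => by positivity
  exact ((ContinuousLinearMap.nonneg_iff_isPositive _).1 hp).re_inner_nonneg_left m

/-- With `v = x + y`, the graph of `A` consists of `x = R² v`, `y = K² v`; the intermediate vector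
is `R K v`. -/
theorem graph_iff_sqrtOp (h : IsNonnegResolvent A B) (x y : E) :
    (x, y) ∈ A.graph ↔ ∃ z, (x, z) ∈ (sqrtOp B).graph ∧ (z, y) ∈ (sqrtOp B).graph := by
  rw [h.mem_graph_iff]
  constructor
  · intro hxy
    refine ⟨sqrtB B (sqrtC B (x + y)), ?_, ?_⟩
    · have := h.mem_graph_sqrtOp (sqrtB B (x + y))
      rwa [h.sqrtB_sq, hxy, ← sqrt_comm] at this
    · have := h.mem_graph_sqrtOp (sqrtC B (x + y))
      rwa [h.sqrtC_sq, hxy, add_sub_cancel_left] at this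
  · rintro ⟨z, h1, h2⟩
    rw [h.mem_graph_sqrtOp_iff] at h1 h2
    rw [map_add, ← h.sqrtB_sq y, h2, sqrt_comm, h1, h.sqrtC_sq]
    abel

end IsNonnegResolvent

/-! ### Uniqueness of the nonnegative square root -/

namespace IsNonnegResolvent

variable {E : Type*} [NormedAddCommGroup E] [InnerProductSpace ℂ E] [CompleteSpace E]
  {A : E →ₗ.[ℂ] E} {B : E →L[ℂ] E}

theorem graph_inner_comm {S : E →ₗ.[ℂ] E} (hS : IsSelfAdjoint S) {x z y w : E}
    (h1 : (x, z) ∈ S.graph) (h2 : (y, w) ∈ S.graph) : inner ℂ z y = inner ℂ x w := by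
  have := LinearPMap.adjoint_graph_eq_graph_adjoint hS.dense_domain
  rw [LinearPMap.isSelfAdjoint_def.1 hS] at this
  rw [this, Submodule.mem_adjoint_iff] at h2
  exact sub_eq_zero.1 (h2 _ _ h1)

/-- A self-adjoint operator has no proper symmetric extension: passing to adjoints reverses the
inclusion. -/
theorem le_of_isSelfAdjoint {S T : E →ₗ.[ℂ] E} (hS : IsSelfAdjoint S) (hT : IsSelfAdjoint T)
    (h : S.graph ≤ T.graph) : S = T := by
  refine LinearPMap.eq_of_eq_graph (le_antisymm h ?_)
  rintro ⟨x, z⟩ hx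
  have := LinearPMap.adjoint_graph_eq_graph_adjoint hS.dense_domain
  rw [LinearPMap.isSelfAdjoint_def.1 hS] at this
  rw [this, Submodule.mem_adjoint_iff]
  intro a b hab
  rw [graph_inner_comm hT (h hab) hx, sub_self]

section Unique

variable {S : E →ₗ.[ℂ] E}

/-- A square root of `A` commutes with the resolvent. -/
theorem graph_resolvent (h : IsNonnegResolvent A B)
    (hA : ∀ x y : E, (x, y) ∈ A.graph ↔ ∃ z : E, (x, z) ∈ S.graph ∧ (z, y) ∈ S.graph)
    {x z : E} (hx : (x, z) ∈ S.graph) : (B x, B z) ∈ S.graph := by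
  obtain ⟨m, h1, h2⟩ := (hA _ _).1 (h.mem_graph x)
  obtain ⟨m', h3, h4⟩ := (hA _ _).1 (h.mem_graph (B x))
  -- Here `m = S B x`. Since `S m = x - B x` and `S (x - B x) = z - m`, the pair `(m, z - m)` lies
  -- in the graph of `A = S S`, so `m = B z`.
  have h5 : (x - B x, z - m) ∈ S.graph := S.graph.sub_mem hx h1
  have h6 : (m, z - m) ∈ A.graph := (hA _ _).2 ⟨_, h2, h5⟩
  rw [h.mem_graph_iff, add_sub_cancel] at h6
  rwa [h6]

/-- The bounded operator `S (1 + A)⁻¹` for a square root `S` of `A` is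
`A^{1/2} (1 + A)⁻¹`. -/
theorem graph_resolvent_eq (h : IsNonnegResolvent A B) (hS : IsSelfAdjoint S)
    (hn : ∀ x : S.domain, 0 ≤ RCLike.re (inner ℂ (S x) (x : E)))
    (hA : ∀ x y : E, (x, y) ∈ A.graph ↔ ∃ z : E, (x, z) ∈ S.graph ∧ (z, y) ∈ S.graph) (v : E) :
    (B v, sqrtB B (sqrtC B v)) ∈ S.graph := by
  have hn' : ∀ x z : E, (x, z) ∈ S.graph → 0 ≤ RCLike.re (inner ℂ z x) := by
    intro x z hx
    obtain ⟨y, rfl, rfl⟩ := (LinearPMap.mem_graph_iff S).1 hx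
    exact hn y
  have hex : ∀ v, ∃ m, (B v, m) ∈ S.graph ∧ (m, v - B v) ∈ S.graph :=
    fun v => (hA _ _).1 (h.mem_graph v)
  choose T hT1 hT2 using hex
  have hTu : ∀ v m, (B v, m) ∈ S.graph → m = T v := fun v m hm =>
    LinearPMap.mem_graph_snd_inj S hm (hT1 v) rfl
  let L : E →ₗ[ℂ] E :=
    { toFun := T
      map_add' := fun x y => (hTu _ _ (by
        rw [map_add]; exact S.graph.add_mem (hT1 x) (hT1 y))).symm
      map_smul' := fun c x => (hTu _ _ (by
        rw [map_smul]; exact S.graph.smul_mem c (hT1 x))).symm }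
  -- `T = S B` is tested on `y = B y + (y - B y)`. Symmetry of `S` handles each summand, because `S`
  -- maps `B y` to `T y` and `T y` to `y - B y`. An everywhere defined symmetric operator is bounded
  -- (Hellinger-Toeplitz), which gives `L'`.
  have hsymm : L.IsSymmetric := by
    intro x y
    change inner ℂ (T x) y = inner ℂ x (T y)
    have e1 : inner ℂ (T x) (B y) = inner ℂ (B x) (T y) := graph_inner_comm hS (hT1 x) (hT1 y)
    have e2 : inner ℂ (T x) (y - B y) = inner ℂ (x - B x) (T y) :=
      (graph_inner_comm hS (hT2 x) (hT2 y)).symm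
    rw [inner_sub_right, inner_sub_left, e1] at e2
    exact sub_left_injective e2
  let L' : E →L[ℂ] E := ⟨L, hsymm.continuous⟩
  -- `⟨T x, x⟩ = ⟨T x, B x⟩ + ⟨T x, x - B x⟩`; the summands have the real parts of the form of `S`
  -- at `B x` and at `T x`.
  have hL0 : 0 ≤ L' := by
    rw [ContinuousLinearMap.nonneg_iff_isPositive]
    refine ⟨hsymm, fun x => ?_⟩
    change 0 ≤ RCLike.re (inner ℂ (T x) x)
    have e1 := hn' _ _ (hT1 x)
    have e2 := hn' _ _ (hT2 x)
    rw [← inner_conj_symm, RCLike.conj_re, inner_sub_right, map_sub] at e2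
    linarith
  -- Both sides are `B (1 - B)`. On the left, `graph_resolvent` applied to `S T x = x - B x` gives
  -- `S B T x = B x - B² x`.
  have hsq : L' * L' = sqrtB B * sqrtC B * (sqrtB B * sqrtC B) := by
    ext x
    change T (T x) = sqrtB B (sqrtC B (sqrtB B (sqrtC B x)))
    rw [sqrt_comm x, h.sqrtC_sq, map_sub, ← h.sqrtB_sq (sqrtB B x)]
    simp only [h.sqrtB_sq]
    refine (hTu _ _ ?_).symm
    have := h.graph_resolvent hA (hT2 x)
    rwa [map_sub] at this
  have hp : (0 : E →L[ℂ] E) ≤ sqrtB B * sqrtC B := by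
    have hB := h.isSelfAdjoint
    rw [sqrtB, sqrtC, ← cfc_mul ..]
    exact cfc_nonneg fun x _ => by positivity
  have : L' = sqrtB B * sqrtC B := by
    rw [← CFC.sqrt_unique hsq hL0, CFC.sqrt_unique rfl hp]
  have hv : T v = sqrtB B (sqrtC B v) := congrArg (fun T : E →L[ℂ] E => T v) this
  rw [← hv]
  exact hT1 v

/-- For `(x, z)` in the graph of `S`, the vector `S B x` is both `B z` and `R K x`. Cancelling the
injective `R` in `R (R z) = R (K x)` puts `(x, z)` in the graph of `sqrtOp B`, and inclusion of
self-adjoint operators is equality. -/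
theorem sqrtOp_unique (h : IsNonnegResolvent A B) (hS : IsSelfAdjoint S)
    (hn : ∀ x : S.domain, 0 ≤ RCLike.re (inner ℂ (S x) (x : E)))
    (hA : ∀ x y : E, (x, y) ∈ A.graph ↔ ∃ z : E, (x, z) ∈ S.graph ∧ (z, y) ∈ S.graph) :
    S = sqrtOp B := by
  refine le_of_isSelfAdjoint hS h.sqrtOp_isSelfAdjoint ?_
  rintro ⟨x, z⟩ hx
  rw [h.mem_graph_sqrtOp_iff]
  apply h.sqrtB_injective
  rw [h.sqrtB_sq]
  exact LinearPMap.mem_graph_snd_inj S (h.graph_resolvent hA hx)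
    (h.graph_resolvent_eq hS hn hA x) rfl

end Unique

/-- The square root is injective if the operator is. -/
theorem eq_zero_of_sqrtOp_eq_zero (h : IsNonnegResolvent A B)
    (hker : ∀ x, (x, (0 : E)) ∈ A.graph → x = 0) (x : (sqrtOp B).domain) (hx : sqrtOp B x = 0) :
    x = 0 := by
  have h1 := (sqrtOp B).mem_graph x
  rw [hx] at h1
  exact Subtype.ext (hker _ ((h.graph_iff_sqrtOp _ _).2 ⟨0, h1, Submodule.zero_mem _⟩))

theorem domain_le_sqrtOp (h : IsNonnegResolvent A B) {x : E} (hx : x ∈ A.domain) :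
    x ∈ (sqrtOp B).domain := by
  obtain ⟨y, hy⟩ := LinearPMap.mem_domain_iff.1 hx
  obtain ⟨z, hz, -⟩ := (h.graph_iff_sqrtOp _ _).1 hy
  exact LinearPMap.mem_domain_of_mem_graph hz

/-- The potential energy `⟨A B v, B v⟩` written with bounded operators only, so that it is
continuous in `v` and can be differentiated without reference to the root. -/
theorem norm_sqrtOp_sq (h : IsNonnegResolvent A B) (v : E) (hv : B v ∈ (sqrtOp B).domain) :
    ‖sqrtOp B ⟨B v, hv⟩‖ ^ 2 = RCLike.re (inner ℂ (v - B v) (B v)) := by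
  have h1 : sqrtOp B ⟨B v, hv⟩ = sqrtC B (sqrtB B v) := by
    refine LinearPMap.mem_graph_snd_inj _ ((sqrtOp B).mem_graph ⟨B v, hv⟩)
      (h.mem_graph_sqrtOp (sqrtB B v)) ?_
    simp [h.sqrtB_sq]
  rw [h1, ← h.sqrtC_sq, ← h.sqrtB_sq, ← inner_apply_comm_of_isSelfAdjoint sqrtB_isSelfAdjoint,
    sqrt_comm, inner_apply_comm_of_isSelfAdjoint sqrtC_isSelfAdjoint, sqrt_comm,
    inner_self_eq_norm_sq]

end IsNonnegResolvent

/-! ### Cosine and sine families -/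

/-- `t sinc (t s)` is `sin (t s) / s`, extended to frequency `s = 0` by its limit `t`. -/
theorem hasDerivAt_mul_sinc (s t : ℝ) :
    HasDerivAt (fun t => t * Real.sinc (t * s)) (Real.cos (t * s)) t := by
  by_cases hs : s = 0
  · subst hs
    simpa using hasDerivAt_id' t
  · have h : (fun t => t * Real.sinc (t * s)) = fun t => Real.sin (t * s) / s := by
      funext t
      by_cases ht : t = 0
      · simp [ht]
      · rw [Real.sinc_of_ne_zero (mul_ne_zero ht hs)]; field_simp
    rw [h]
    have h1 : HasDerivAt (fun t => t * s) s t := by simpa using (hasDerivAt_id t).mul_const s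
    simpa [hs] using h1.sin.div_const s

theorem mul_mul_sinc (s t : ℝ) : s * (t * Real.sinc (t * s)) = Real.sin (t * s) := by
  by_cases h : t * s = 0
  · rcases mul_eq_zero.1 h with h | h <;> simp [h]
  · rw [Real.sinc_of_ne_zero h]
    have := left_ne_zero_of_mul h
    have := right_ne_zero_of_mul h
    field_simp

theorem abs_mul_sinc_sub_le (s a b : ℝ) :
    |a * Real.sinc (a * s) - b * Real.sinc (b * s)| ≤ |a - b| := by
  have := convex_univ.norm_image_sub_le_of_norm_hasDerivWithin_le (C := 1) (x := b) (y := a)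
    (fun t _ => (hasDerivAt_mul_sinc s t).hasDerivWithinAt)
    (fun t _ => by simpa using Real.abs_cos_le_one _) (mem_univ _) (mem_univ _)
  simpa using this

theorem abs_cos_mul_sub_le (s a b : ℝ) : |Real.cos (a * s) - Real.cos (b * s)| ≤ |s| * |a - b| := by
  have := Real.lipschitzWith_cos.dist_le_mul (a * s) (b * s)
  rwa [Real.dist_eq, Real.dist_eq, ← sub_mul, abs_mul, mul_comm |a - b|, NNReal.coe_one,
    one_mul] at this

theorem abs_sin_mul_sub_le (s a b : ℝ) : |Real.sin (a * s) - Real.sin (b * s)| ≤ |s| * |a - b| := by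
  have := Real.lipschitzWith_sin.dist_le_mul (a * s) (b * s)
  rwa [Real.dist_eq, Real.dist_eq, ← sub_mul, abs_mul, mul_comm |a - b|, NNReal.coe_one,
    one_mul] at this

/-! ### Scalar symbols of the propagators -/

namespace WaveSymbol

/-- The spectral parameter of `A^{1/2}` in terms of that of `(1 + A)⁻¹`. -/
noncomputable def freq (x : ℝ) : ℝ := √(1 - x) / √x

/-- The symbol of `cos (t A^{1/2}) (1 + A)⁻¹`. -/
noncomputable def symC (t x : ℝ) : ℝ := x * Real.cos (t * freq x)

/-- The symbol of `A^{-1/2} sin (t A^{1/2}) (1 + A)⁻¹`. -/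
noncomputable def symD (t x : ℝ) : ℝ := x * (t * Real.sinc (t * freq x))

/-- The symbol of `A^{1/2} sin (t A^{1/2}) (1 + A)⁻¹`. -/
noncomputable def symE (t x : ℝ) : ℝ := √x * √(1 - x) * Real.sin (t * freq x)

theorem freq_nonneg (x : ℝ) : 0 ≤ freq x := by unfold freq; positivity

/-- For `x = 1/(1+λ)` the frequency `√(1 - x)/√x` is `√λ`. At `x = 0`, which stands for `λ = ∞`,
division by zero makes it `0`, and both sides vanish. -/
theorem mul_freq {x : ℝ} (hx : x ∈ Icc (0 : ℝ) 1) : x * freq x = √x * √(1 - x) := by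
  unfold freq
  rcases hx.1.eq_or_lt with rfl | h
  · simp
  · have : √x ≠ 0 := (Real.sqrt_pos.2 h).ne'
    nth_rewrite 1 [← Real.mul_self_sqrt hx.1]
    field_simp

theorem sqrt_mul_freq {x : ℝ} (hx : x ∈ Icc (0 : ℝ) 1) (h : 0 < x) :
    √x * √(1 - x) * freq x = 1 - x := by
  unfold freq
  have : √x ≠ 0 := (Real.sqrt_pos.2 h).ne'
  have h2 := Real.mul_self_sqrt (sub_nonneg.2 hx.2)
  field_simp
  linarith

theorem sqrt_mul_freq_le {x : ℝ} (hx : x ∈ Icc (0 : ℝ) 1) :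
    √x * √(1 - x) * freq x ≤ 1 := by
  rcases hx.1.eq_or_lt with rfl | h
  · simp
  · rw [sqrt_mul_freq hx h]; linarith

theorem mul_freq_le {x : ℝ} (hx : x ∈ Icc (0 : ℝ) 1) : x * freq x ≤ 1 := by
  rw [mul_freq hx]
  exact mul_le_one₀ (Real.sqrt_le_one.2 hx.2) (Real.sqrt_nonneg _)
    (Real.sqrt_le_one.2 (by linarith [hx.1]))

/-- The frequency blows up at `x = 0` and its cosine and sine oscillate there. A prefactor vanishing
at `0` restores continuity, which is why every symbol carries one. -/
theorem continuousOn_mul_bounded {a g : ℝ → ℝ} {M : ℝ} (ha : Continuous a) (h0 : a 0 = 0)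
    (hg : ContinuousOn g (Ioi 0)) (hM : ∀ x, |g x| ≤ M) :
    ContinuousOn (fun x => a x * g x) (Icc 0 1) := by
  intro x hx
  rcases hx.1.eq_or_lt with rfl | h
  · have h1 : Tendsto a (𝓝[Icc 0 1] 0) (𝓝 0) := by
      have := ha.continuousWithinAt (s := Icc 0 1) (x := 0)
      rwa [ContinuousWithinAt, h0] at this
    have := h1.zero_mul_isBoundedUnder_le (g := g)
      (isBoundedUnder_of ⟨M, fun x => by simpa using hM x⟩)
    simpa [ContinuousWithinAt, h0] using this
  · exact (ha.continuousAt.mul (hg.continuousAt (Ioi_mem_nhds h))).continuousWithinAt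

theorem continuousOn_freq : ContinuousOn freq (Ioi 0) := by
  unfold freq
  refine ContinuousOn.div (by fun_prop) (by fun_prop) fun x hx => (Real.sqrt_pos.2 hx).ne'

theorem continuousOn_symC (t : ℝ) : ContinuousOn (symC t) (Icc 0 1) :=
  continuousOn_mul_bounded continuous_id rfl
    (Real.continuous_cos.comp_continuousOn (continuousOn_const.mul continuousOn_freq))
    fun _ => Real.abs_cos_le_one _

theorem continuousOn_symD (t : ℝ) : ContinuousOn (symD t) (Icc 0 1) := by
  refine continuousOn_mul_bounded (M := |t|) continuous_id rfl
    (continuousOn_const.mul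
      (Real.continuous_sinc.comp_continuousOn (continuousOn_const.mul continuousOn_freq)))
    fun x => ?_
  rw [abs_mul]
  exact mul_le_of_le_one_right (abs_nonneg _) (Real.abs_sinc_le_one _)

theorem continuousOn_symE (t : ℝ) : ContinuousOn (symE t) (Icc 0 1) :=
  continuousOn_mul_bounded (by fun_prop) (by simp)
    (Real.continuous_sin.comp_continuousOn (continuousOn_const.mul continuousOn_freq))
    fun _ => Real.abs_sin_le_one _

/-- Domination by the symbol of `B` itself; it allows the factor `(1 + A)⁻¹` to be divided out
later. -/
theorem abs_symC_le {x : ℝ} (t : ℝ) : |symC t x| ≤ 1 * |x| := by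
  rw [symC, abs_mul, one_mul]
  exact mul_le_of_le_one_right (abs_nonneg _) (Real.abs_cos_le_one _)

theorem abs_symD_le {x : ℝ} (t : ℝ) : |symD t x| ≤ |t| * |x| := by
  rw [symD, abs_mul, abs_mul, mul_comm |t| |x|]
  exact mul_le_mul_of_nonneg_left (mul_le_of_le_one_right (abs_nonneg _) (Real.abs_sinc_le_one _))
    (abs_nonneg _)

theorem hasDerivAt_cos_freq (t x : ℝ) :
    HasDerivAt (fun t => Real.cos (t * freq x)) (-(freq x * Real.sin (t * freq x))) t := by
  have h1 : HasDerivAt (fun t => t * freq x) (freq x) t := by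
    simpa using (hasDerivAt_id t).mul_const (freq x)
  simpa [mul_comm] using h1.cos

theorem hasDerivAt_sin_freq (t x : ℝ) :
    HasDerivAt (fun t => Real.sin (t * freq x)) (freq x * Real.cos (t * freq x)) t := by
  have h1 : HasDerivAt (fun t => t * freq x) (freq x) t := by
    simpa using (hasDerivAt_id t).mul_const (freq x)
  simpa [mul_comm] using h1.sin

theorem hasDerivAt_symC {x : ℝ} (hx : x ∈ Icc (0 : ℝ) 1) (t : ℝ) :
    HasDerivAt (fun t => symC t x) (-symE t x) t := by
  refine ((hasDerivAt_cos_freq t x).const_mul x).congr_deriv ?_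
  rw [symE, ← mul_freq hx]; ring

theorem hasDerivAt_symD {x : ℝ} (t : ℝ) : HasDerivAt (fun t => symD t x) (symC t x) t :=
  (hasDerivAt_mul_sinc (freq x) t).const_mul x

/-- For `x ≠ 0` the derivative of `symE` is `(1 - x) cos (t freq x)`, with no factor that vanishes
at `x = 0`. The extra `x` makes the derivative a continuous symbol again. -/
theorem hasDerivAt_mul_symE {x : ℝ} (hx : x ∈ Icc (0 : ℝ) 1) (t : ℝ) :
    HasDerivAt (fun t => x * symE t x) ((1 - x) * symC t x) t := by
  refine (((hasDerivAt_sin_freq t x).const_mul (√x * √(1 - x))).const_mul x).congr_deriv ?_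
  rcases hx.1.eq_or_lt with rfl | h
  · simp [symC]
  · calc _ = x * (√x * √(1 - x) * freq x) * Real.cos (t * freq x) := by ring
      _ = _ := by rw [sqrt_mul_freq hx h, symC]; ring

theorem hasDerivAt_mul_symC {x : ℝ} (hx : x ∈ Icc (0 : ℝ) 1) (t : ℝ) :
    HasDerivAt (fun t => x * symC t x) (-((1 - x) * symD t x)) t := by
  refine ((hasDerivAt_symC hx t).const_mul x).congr_deriv ?_
  rcases hx.1.eq_or_lt with rfl | h
  · simp [symD]
  · rw [symE, ← mul_mul_sinc]
    calc _ = -(x * (√x * √(1 - x) * freq x) * (t * Real.sinc (t * freq x))) := by ring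
      _ = _ := by rw [sqrt_mul_freq hx h, symD]; ring

/-- The Lipschitz constant in time is uniform in `x` because amplitude times frequency is at most
`1`. These Lipschitz bounds feed `hasDerivAt_cfc`. -/
theorem abs_symE_sub_le {x : ℝ} (hx : x ∈ Icc (0 : ℝ) 1) (s t : ℝ) :
    |symE s x - symE t x| ≤ |s - t| := by
  rw [symE, symE, ← mul_sub, abs_mul, abs_of_nonneg (by positivity)]
  calc _ ≤ √x * √(1 - x) * (|freq x| * |s - t|) := by
        gcongr; exact abs_sin_mul_sub_le _ _ _
    _ = √x * √(1 - x) * freq x * |s - t| := by rw [abs_of_nonneg (freq_nonneg x)]; ring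
    _ ≤ 1 * |s - t| := by gcongr; exact sqrt_mul_freq_le hx
    _ = _ := one_mul _

theorem abs_symC_sub_le {x : ℝ} (hx : x ∈ Icc (0 : ℝ) 1) (s t : ℝ) :
    |symC s x - symC t x| ≤ |s - t| := by
  rw [symC, symC, ← mul_sub, abs_mul, abs_of_nonneg hx.1]
  calc _ ≤ x * (|freq x| * |s - t|) := by
        gcongr
        · exact hx.1
        · exact abs_cos_mul_sub_le _ _ _
    _ = x * freq x * |s - t| := by rw [abs_of_nonneg (freq_nonneg x)]; ring
    _ ≤ 1 * |s - t| := by gcongr; exact mul_freq_le hx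
    _ = _ := one_mul _

theorem abs_symD_sub_le {x : ℝ} (hx : x ∈ Icc (0 : ℝ) 1) (s t : ℝ) :
    |symD s x - symD t x| ≤ |s - t| := by
  rw [symD, symD, ← mul_sub, abs_mul, abs_of_nonneg hx.1]
  exact (mul_le_of_le_one_left (abs_nonneg _) hx.2).trans (abs_mul_sinc_sub_le _ _ _)

theorem abs_one_sub_mul_sub_le {x a b c : ℝ} (hx : x ∈ Icc (0 : ℝ) 1) (h : |a - b| ≤ c) :
    |(1 - x) * a - (1 - x) * b| ≤ c := by
  rw [← mul_sub, abs_mul, abs_of_nonneg (sub_nonneg.2 hx.2)]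
  exact (mul_le_of_le_one_left (abs_nonneg _) (by linarith [hx.1])).trans h

end WaveSymbol

section
variable {E : Type*} [NormedAddCommGroup E] [NormedSpace ℂ E]

theorem hasDerivAt_clm_apply {F : ℝ → E →L[ℂ] E} {F' : E →L[ℂ] E} {t : ℝ}
    (hF : HasDerivAt F F' t) (y : E) : HasDerivAt (fun t => F t y) (F' y) t :=
  ((ContinuousLinearMap.apply ℂ E y).restrictScalars ℝ).hasFDerivAt.comp_hasDerivAt t hF

theorem hasDerivAt_clm_comp (T : E →L[ℂ] E) {u : ℝ → E} {u' : E} {t : ℝ}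
    (hu : HasDerivAt u u' t) : HasDerivAt (fun t => T (u t)) (T u') t :=
  (T.restrictScalars ℝ).hasFDerivAt.comp_hasDerivAt t hu

end

/-! ### Propagators and the explicit solution -/

namespace IsNonnegResolvent
open WaveSymbol

variable {E : Type*} [NormedAddCommGroup E] [InnerProductSpace ℂ E] [CompleteSpace E]
  {A : E →ₗ.[ℂ] E} {B : E →L[ℂ] E}

theorem commute_cfc (h : IsNonnegResolvent A B) (f : ℝ → ℝ) (x : E) :
    B (cfc f B x) = cfc f B (B x) := by
  have hB := h.isSelfAdjoint
  have : Commute (cfc id B) (cfc f B) := cfc_commute_cfc _ _ _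
  rw [cfc_id ℝ B] at this
  exact congrArg (fun T : E →L[ℂ] E => T x) this.eq

theorem cfc_mul_left (h : IsNonnegResolvent A B) {f : ℝ → ℝ} (hf : ContinuousOn f (Icc 0 1)) :
    cfc (fun x => x * f x) B = B * cfc f B := by
  have hB := h.isSelfAdjoint
  have hc := hf.mono h.spectrum_subset
  rw [cfc_mul (fun x => x) f B, cfc_id' ℝ B]

theorem cfc_one_sub_mul (h : IsNonnegResolvent A B) {f : ℝ → ℝ} (hf : ContinuousOn f (Icc 0 1)) :
    cfc (fun x => (1 - x) * f x) B = (1 - B) * cfc f B := by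
  have hB := h.isSelfAdjoint
  have hc := hf.mono h.spectrum_subset
  rw [cfc_mul (fun x => 1 - x) f B, cfc_sub .., cfc_id' ℝ B, cfc_const_one ..]

theorem hasDerivAt_opC (h : IsNonnegResolvent A B) (t : ℝ) :
    HasDerivAt (fun t => cfc (symC t) B) (-cfc (symE t) B) t := by
  rw [← cfc_neg]
  refine hasDerivAt_cfc h.isSelfAdjoint (f' := fun t x => -symE t x)
    (fun t => (continuousOn_symC t).mono h.spectrum_subset)
    (fun t => ((continuousOn_symE t).mono h.spectrum_subset).neg)
    (fun x hx t => hasDerivAt_symC (h.spectrum_subset hx) t) (fun x hx s t => ?_) t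
  rw [neg_sub_neg, abs_sub_comm]
  exact abs_symE_sub_le (h.spectrum_subset hx) s t

theorem hasDerivAt_opD (h : IsNonnegResolvent A B) (t : ℝ) :
    HasDerivAt (fun t => cfc (symD t) B) (cfc (symC t) B) t :=
  hasDerivAt_cfc h.isSelfAdjoint
    (fun t => (continuousOn_symD t).mono h.spectrum_subset)
    (fun t => (continuousOn_symC t).mono h.spectrum_subset)
    (fun _ _ t => hasDerivAt_symD t) (fun _ hx => abs_symC_sub_le (h.spectrum_subset hx)) t

theorem hasDerivAt_mul_opE (h : IsNonnegResolvent A B) (t : ℝ) :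
    HasDerivAt (fun t => B * cfc (symE t) B) ((1 - B) * cfc (symC t) B) t := by
  have := hasDerivAt_cfc h.isSelfAdjoint (f := fun t x => x * symE t x)
    (f' := fun t x => (1 - x) * symC t x)
    (fun t => (continuousOn_id.mul (continuousOn_symE t)).mono h.spectrum_subset)
    (fun t => ((continuousOn_const.sub continuousOn_id).mul (continuousOn_symC t)).mono
      h.spectrum_subset)
    (fun x hx t => hasDerivAt_mul_symE (h.spectrum_subset hx) t)
    (fun x hx s t => abs_one_sub_mul_sub_le (h.spectrum_subset hx)
      (abs_symC_sub_le (h.spectrum_subset hx) s t)) t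
  simpa only [h.cfc_mul_left (continuousOn_symE _), h.cfc_one_sub_mul (continuousOn_symC _)]
    using this

theorem hasDerivAt_mul_opC (h : IsNonnegResolvent A B) (t : ℝ) :
    HasDerivAt (fun t => B * cfc (symC t) B) (-((1 - B) * cfc (symD t) B)) t := by
  have := hasDerivAt_cfc h.isSelfAdjoint (f := fun t x => x * symC t x)
    (f' := fun t x => -((1 - x) * symD t x))
    (fun t => (continuousOn_id.mul (continuousOn_symC t)).mono h.spectrum_subset)
    (fun t => ((continuousOn_const.sub continuousOn_id).mul (continuousOn_symD t)).neg.mono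
      h.spectrum_subset)
    (fun x hx t => hasDerivAt_mul_symC (h.spectrum_subset hx) t)
    (fun x hx s t => by
      rw [neg_sub_neg, abs_sub_comm]
      exact abs_one_sub_mul_sub_le (h.spectrum_subset hx)
        (abs_symD_sub_le (h.spectrum_subset hx) s t)) t
  simpa only [cfc_neg, h.cfc_mul_left (continuousOn_symC _),
    h.cfc_one_sub_mul (continuousOn_symD _)] using this

variable (B) in
/-- `cos (t A^{1/2})`. -/
noncomputable def opCos (t : ℝ) : E →L[ℂ] E :=
  LinearMap.extendOfNorm ((cfc (symC t) B : E →L[ℂ] E) : E →ₗ[ℂ] E) (B : E →ₗ[ℂ] E)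

variable (B) in
/-- `A^{-1/2} sin (t A^{1/2})`. -/
noncomputable def opSin (t : ℝ) : E →L[ℂ] E :=
  LinearMap.extendOfNorm ((cfc (symD t) B : E →L[ℂ] E) : E →ₗ[ℂ] E) (B : E →ₗ[ℂ] E)

/-- This bound makes `B y ↦ cfc (symC t) B y` well defined and bounded on the dense range of `B`,
hence extendable to `opCos`. -/
theorem norm_opC_le (h : IsNonnegResolvent A B) (t : ℝ) (y : E) :
    ‖cfc (symC t) B y‖ ≤ 1 * ‖B y‖ := by
  have hB := h.isSelfAdjoint
  have := norm_cfc_apply_le hB (g := id) zero_le_one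
    ((continuousOn_symC t).mono h.spectrum_subset) continuousOn_id (fun x _ => abs_symC_le t) y
  rwa [cfc_id ℝ B] at this

theorem norm_opD_le (h : IsNonnegResolvent A B) (t : ℝ) (y : E) :
    ‖cfc (symD t) B y‖ ≤ |t| * ‖B y‖ := by
  have hB := h.isSelfAdjoint
  have := norm_cfc_apply_le hB (g := id) (abs_nonneg t)
    ((continuousOn_symD t).mono h.spectrum_subset) continuousOn_id (fun x _ => abs_symD_le t) y
  rwa [cfc_id ℝ B] at this

theorem opCos_apply (h : IsNonnegResolvent A B) (t : ℝ) (y : E) :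
    opCos B t (B y) = cfc (symC t) B y :=
  LinearMap.extendOfNorm_eq h.denseRange ⟨1, h.norm_opC_le t⟩ y

theorem opSin_apply (h : IsNonnegResolvent A B) (t : ℝ) (y : E) :
    opSin B t (B y) = cfc (symD t) B y :=
  LinearMap.extendOfNorm_eq h.denseRange ⟨|t|, h.norm_opD_le t⟩ y

theorem norm_opCos_le (h : IsNonnegResolvent A B) (t : ℝ) (y : E) : ‖opCos B t y‖ ≤ 1 * ‖y‖ :=
  LinearMap.norm_extendOfNorm_apply_le h.denseRange 1 (h.norm_opC_le t) y

theorem norm_opSin_le (h : IsNonnegResolvent A B) (t : ℝ) (y : E) : ‖opSin B t y‖ ≤ |t| * ‖y‖ :=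
  LinearMap.norm_extendOfNorm_apply_le h.denseRange |t| (h.norm_opD_le t) y

theorem apply_opCos (h : IsNonnegResolvent A B) (t : ℝ) (y : E) :
    B (opCos B t y) = cfc (symC t) B y := by
  refine h.denseRange.induction_on y (isClosed_eq (by fun_prop) (by fun_prop)) fun z => ?_
  rw [h.opCos_apply, h.commute_cfc]

theorem apply_opSin (h : IsNonnegResolvent A B) (t : ℝ) (y : E) :
    B (opSin B t y) = cfc (symD t) B y := by
  refine h.denseRange.induction_on y (isClosed_eq (by fun_prop) (by fun_prop)) fun z => ?_
  rw [h.opSin_apply, h.commute_cfc]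

variable (B) in
/-- `(1 + A) u(t)`, where `u` solves the wave equation with `u(0) = B y₀`, `u'(0) = B y₁`. -/
noncomputable def waveY (y₀ y₁ : E) (t : ℝ) : E := opCos B t y₀ + opSin B t y₁

variable (B) in
/-- The velocity of the solution with data `B y₀`, `B y₁`. -/
noncomputable def waveV (y₀ y₁ : E) (t : ℝ) : E := cfc (symC t) B y₁ - cfc (symE t) B y₀

theorem hasDerivAt_opC_add_opD (h : IsNonnegResolvent A B) (y₀ y₁ : E) (t : ℝ) :
    HasDerivAt (fun t => cfc (symC t) B y₀ + cfc (symD t) B y₁) (waveV B y₀ y₁ t) t := by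
  refine ((hasDerivAt_clm_apply (h.hasDerivAt_opC t) y₀).add
    (hasDerivAt_clm_apply (h.hasDerivAt_opD t) y₁)).congr_deriv ?_
  rw [waveV, neg_apply]; abel

theorem apply_waveY (h : IsNonnegResolvent A B) (y₀ y₁ : E) (t : ℝ) :
    B (waveY B y₀ y₁ t) = cfc (symC t) B y₀ + cfc (symD t) B y₁ := by
  rw [waveY, map_add, h.apply_opCos, h.apply_opSin]

theorem hasDerivAt_apply_waveY (h : IsNonnegResolvent A B) (y₀ y₁ : E) (t : ℝ) :
    HasDerivAt (fun t => B (waveY B y₀ y₁ t)) (waveV B y₀ y₁ t) t := by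
  simp only [h.apply_waveY]
  exact h.hasDerivAt_opC_add_opD y₀ y₁ t

theorem waveY_apply (h : IsNonnegResolvent A B) (z₀ z₁ : E) (t : ℝ) :
    waveY B (B z₀) (B z₁) t = cfc (symC t) B z₀ + cfc (symD t) B z₁ := by
  rw [waveY, h.opCos_apply, h.opSin_apply]

theorem waveV_apply (h : IsNonnegResolvent A B) (z₀ z₁ : E) (t : ℝ) :
    waveV B (B z₀) (B z₁) t = B (waveV B z₀ z₁ t) := by
  rw [waveV, waveV, map_sub, h.commute_cfc, h.commute_cfc]

/-- For data with a second factor `B` the velocity is given by `B symC(B)` and `B symE(B)`, which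
are differentiable in operator norm. -/
theorem hasDerivAt_waveV_apply (h : IsNonnegResolvent A B) (z₀ z₁ : E) (t : ℝ) :
    HasDerivAt (waveV B (B z₀) (B z₁))
      (-(waveY B (B z₀) (B z₁) t - B (waveY B (B z₀) (B z₁) t))) t := by
  have : waveV B (B z₀) (B z₁) =
      fun t => (B * cfc (symC t) B) z₁ - (B * cfc (symE t) B) z₀ := by
    funext t; rw [h.waveV_apply, waveV, map_sub]; rfl
  rw [this]
  refine ((hasDerivAt_clm_apply (h.hasDerivAt_mul_opC t) z₁).sub
    (hasDerivAt_clm_apply (h.hasDerivAt_mul_opE t) z₀)).congr_deriv ?_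
  rw [h.waveY_apply]
  change -(cfc (symD t) B z₁ - B (cfc (symD t) B z₁)) -
    (cfc (symC t) B z₀ - B (cfc (symC t) B z₀)) = _
  rw [map_add]
  abel

theorem continuous_waveY (t : ℝ) : Continuous fun y : E × E => waveY B y.1 y.2 t := by
  unfold waveY; fun_prop

theorem continuous_waveV (t : ℝ) : Continuous fun y : E × E => waveV B y.1 y.2 t := by
  unfold waveV; fun_prop

theorem waveY_sub (y₀ y₁ z₀ z₁ : E) (t : ℝ) :
    waveY B y₀ y₁ t - waveY B z₀ z₁ t = waveY B (y₀ - z₀) (y₁ - z₁) t := by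
  simp only [waveY, map_sub]; abel

theorem norm_waveY_le (h : IsNonnegResolvent A B) (y₀ y₁ : E) (t : ℝ) :
    ‖waveY B y₀ y₁ t‖ ≤ ‖y₀‖ + |t| * ‖y₁‖ :=
  (norm_add_le _ _).trans (add_le_add (by simpa using h.norm_opCos_le t y₀) (h.norm_opSin_le t y₁))

theorem norm_sub_apply_le (h : IsNonnegResolvent A B) (y : E) : ‖y - B y‖ ≤ ‖y‖ := by
  rw [← h.sqrtC_sq]
  have h1 : ∀ x, ‖sqrtC B x‖ ≤ 1 * ‖x‖ := fun x =>
    ContinuousLinearMap.le_of_opNorm_le _ (norm_cfc_le zero_le_one fun a ha => by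
      rw [Real.norm_of_nonneg (Real.sqrt_nonneg _)]
      exact Real.sqrt_le_one.2 (by linarith [(h.spectrum_subset ha).1])) x
  simp only [one_mul] at h1
  exact (h1 _).trans (h1 _)

/-- General `y₀, y₁` are limits of vectors in the range of `B`. The bound `‖Y - B Y‖ ≤ ‖Y‖ ≤ ‖y₀‖ +
|t| ‖y₁‖` makes the derivatives converge locally uniformly in time, so the limit may be
differentiated. -/
theorem hasDerivAt_waveV (h : IsNonnegResolvent A B) (y₀ y₁ : E) (t : ℝ) :
    HasDerivAt (waveV B y₀ y₁) (-(waveY B y₀ y₁ t - B (waveY B y₀ y₁ t))) t := by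
  obtain ⟨a, ha, ha'⟩ := mem_closure_iff_seq_limit.1 (h.denseRange y₀)
  obtain ⟨b, hb, hb'⟩ := mem_closure_iff_seq_limit.1 (h.denseRange y₁)
  choose z₀ hz₀ using ha
  choose z₁ hz₁ using hb
  have hlim : Tendsto (fun n => (a n, b n)) atTop (𝓝 (y₀, y₁)) := ha'.prodMk_nhds hb'
  refine hasDerivAt_of_tendstoUniformlyOn (l := atTop) (s := Ioo (t - 1) (t + 1)) isOpen_Ioo
    (f := fun n => waveV B (a n) (b n)) (g := waveV B y₀ y₁)
    (f' := fun n t => -(waveY B (a n) (b n) t - B (waveY B (a n) (b n) t)))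
    (g' := fun t => -(waveY B y₀ y₁ t - B (waveY B y₀ y₁ t))) ?_ ?_ ?_ ?_
  · rw [Metric.tendstoUniformlyOn_iff]
    intro ε hε
    have h1 : Tendsto (fun n => ‖y₀ - a n‖ + (|t| + 1) * ‖y₁ - b n‖) atTop (𝓝 0) := by
      have e0 := (tendsto_const_nhds (x := y₀)).sub ha'
      have e1 := (tendsto_const_nhds (x := y₁)).sub hb'
      simpa using e0.norm.add (e1.norm.const_mul (|t| + 1))
    filter_upwards [h1.eventually (gt_mem_nhds hε)] with n hn s hs
    rw [dist_eq_norm, neg_sub_neg, ← norm_neg]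
    have e : -(waveY B (a n) (b n) s - B (waveY B (a n) (b n) s) -
        (waveY B y₀ y₁ s - B (waveY B y₀ y₁ s))) =
        waveY B (y₀ - a n) (y₁ - b n) s - B (waveY B (y₀ - a n) (y₁ - b n) s) := by
      rw [← waveY_sub, map_sub]; abel
    rw [e]
    refine lt_of_le_of_lt ((h.norm_sub_apply_le _).trans (h.norm_waveY_le _ _ _)) (lt_of_le_of_lt ?_ hn)
    gcongr
    have : |s - t| ≤ 1 := abs_le.2 ⟨by linarith [hs.1], by linarith [hs.2]⟩
    have h3 := abs_add_le (s - t) t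
    rw [sub_add_cancel] at h3
    linarith
  · refine Eventually.of_forall fun n s _ => ?_
    rw [← hz₀ n, ← hz₁ n]
    exact h.hasDerivAt_waveV_apply _ _ s
  · intro s _
    exact ((continuous_waveV s).tendsto _).comp hlim
  · exact ⟨by linarith, by linarith⟩

theorem symC_zero : symC 0 = id := by funext x; simp [symC]

theorem symD_zero : symD 0 = fun _ => 0 := by funext x; simp [symD]

theorem symE_zero : symE 0 = fun _ => 0 := by funext x; simp [symE]

theorem apply_waveY_zero (h : IsNonnegResolvent A B) (y₀ y₁ : E) :
    B (waveY B y₀ y₁ 0) = B y₀ := by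
  have hB := h.isSelfAdjoint
  rw [h.apply_waveY, symC_zero, symD_zero, cfc_id ℝ B, cfc_const_zero]
  simp

theorem waveV_zero (h : IsNonnegResolvent A B) (y₀ y₁ : E) : waveV B y₀ y₁ 0 = B y₁ := by
  have hB := h.isSelfAdjoint
  rw [waveV, symC_zero, symE_zero, cfc_id ℝ B, cfc_const_zero]
  simp

/-- Conservation of energy for the smoothed solution. -/
theorem hasDerivAt_energy (h : IsNonnegResolvent A B) {Z W V : ℝ → E} {t : ℝ}
    (hZ : HasDerivAt Z (W t) t) (hV : V t = B (W t))
    (hW : HasDerivAt V (-(Z t - B (Z t))) t) :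
    HasDerivAt (fun t => RCLike.re (inner ℂ (Z t - B (Z t)) (B (Z t))) + ‖V t‖ ^ 2) 0 t := by
  have hBZ := hasDerivAt_clm_comp B hZ
  have h1 := (hZ.fun_sub hBZ).inner ℂ hBZ
  have h2 := hW.inner ℂ hW
  have h3 := (h1.add h2)
  have h4 := (RCLike.reCLM (K := ℂ)).hasFDerivAt.comp_hasDerivAt t h3
  have e : (fun t => RCLike.re (inner ℂ (Z t - B (Z t)) (B (Z t))) + ‖V t‖ ^ 2) =
      fun t => RCLike.re (inner ℂ (Z t - B (Z t)) (B (Z t)) + inner ℂ (V t) (V t)) := by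
    funext s
    rw [map_add, inner_self_eq_norm_sq]
  rw [e]
  refine h4.congr_deriv ?_
  -- The cross terms cancel after moving `B` across `⟨B W, Z⟩ = ⟨W, B Z⟩`. Only `V = B W` is used,
  -- not that `W` is differentiable.
  rw [hV, RCLike.reCLM_apply, inner_neg_left, inner_neg_right, inner_sub_left (W t),
    inner_sub_right (B (W t)), h.inner_comm (W t) (Z t), ← map_zero (RCLike.re : ℂ →+ ℝ)]
  congr 1
  ring

end IsNonnegResolvent

/-! ### Conservation of energy and uniqueness for the abstract wave equation -/

namespace IsNonnegResolvent
open WaveSymbol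

variable {E : Type*} [NormedAddCommGroup E] [InnerProductSpace ℂ E] [CompleteSpace E]
  {A : E →ₗ.[ℂ] E} {B : E →L[ℂ] E}

/-- For `yᵢ = B zᵢ` the function `Y` is itself differentiable with `Y' = W` and `V = B W`, so the
energy has zero derivative. Both sides are continuous in the data, and such data are dense. -/
theorem energy_wave_eq (h : IsNonnegResolvent A B) (y₀ y₁ : E) (t : ℝ) :
    RCLike.re (inner ℂ (waveY B y₀ y₁ t - B (waveY B y₀ y₁ t)) (B (waveY B y₀ y₁ t))) +
        ‖waveV B y₀ y₁ t‖ ^ 2 =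
      RCLike.re (inner ℂ (waveY B y₀ y₁ 0 - B (waveY B y₀ y₁ 0)) (B (waveY B y₀ y₁ 0))) +
        ‖waveV B y₀ y₁ 0‖ ^ 2 := by
  have hd : DenseRange (Prod.map B B) := h.denseRange.prodMap h.denseRange
  have hY := fun s => continuous_waveY (B := B) s
  have hV := fun s => continuous_waveV (B := B) s
  refine hd.induction_on (p := fun y : E × E =>
    RCLike.re (inner ℂ (waveY B y.1 y.2 t - B (waveY B y.1 y.2 t)) (B (waveY B y.1 y.2 t))) +
        ‖waveV B y.1 y.2 t‖ ^ 2 =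
      RCLike.re (inner ℂ (waveY B y.1 y.2 0 - B (waveY B y.1 y.2 0)) (B (waveY B y.1 y.2 0))) +
        ‖waveV B y.1 y.2 0‖ ^ 2) (y₀, y₁) ?_ ?_
  · have hE : ∀ s, Continuous fun y : E × E =>
        RCLike.re (inner ℂ (waveY B y.1 y.2 s - B (waveY B y.1 y.2 s)) (B (waveY B y.1 y.2 s))) +
        ‖waveV B y.1 y.2 s‖ ^ 2 := fun s =>
      (RCLike.continuous_re.comp (((hY s).sub (B.continuous.comp (hY s))).inner
        (B.continuous.comp (hY s)))).add ((hV s).norm.pow 2)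
    exact isClosed_eq (hE t) (hE 0)
  · rintro ⟨z₀, z₁⟩
    have key : ∀ s, HasDerivAt (fun s =>
        RCLike.re (inner ℂ (waveY B (B z₀) (B z₁) s - B (waveY B (B z₀) (B z₁) s))
          (B (waveY B (B z₀) (B z₁) s))) + ‖waveV B (B z₀) (B z₁) s‖ ^ 2) 0 s := by
      intro s
      refine h.hasDerivAt_energy (W := waveV B z₀ z₁) ?_ (h.waveV_apply z₀ z₁ s)
        (h.hasDerivAt_waveV _ _ s)
      have : waveY B (B z₀) (B z₁) = fun t => cfc (symC t) B z₀ + cfc (symD t) B z₁ :=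
        funext fun t => h.waveY_apply z₀ z₁ t
      rw [this]
      exact h.hasDerivAt_opC_add_opD z₀ z₁ s
    exact is_const_of_deriv_eq_zero (fun s => (key s).differentiableAt) (fun s => (key s).deriv) t 0

theorem re_inner_sub_nonneg (h : IsNonnegResolvent A B) (v : E) :
    0 ≤ RCLike.re (inner ℂ (v - B v) (B v)) := by
  rw [← h.norm_sqrtOp_sq v
    (h.domain_le_sqrtOp (LinearPMap.mem_domain_of_mem_graph (h.mem_graph v)))]
  positivity

/-- A solution of the wave equation on `(0, ∞)` that is differentiable on `[0, ∞)` with vanishing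
data vanishes; its velocity is not assumed to be continuous at `0`. -/
theorem wave_unique (h : IsNonnegResolvent A B) {z w : ℝ → E} (hz0 : z 0 = 0)
    (hd0 : HasDerivWithinAt z 0 (Ici 0) 0) (hz : ∀ t, 0 < t → HasDerivAt z (w t) t)
    (hw : ∀ t, 0 < t → HasDerivAt (fun t => B (w t)) (-(z t - B (z t))) t) (t : ℝ) (ht : 0 ≤ t) :
    z t = 0 := by
  have hzc : ContinuousOn z (Ici 0) := by
    intro s hs
    rcases (mem_Ici.1 hs).eq_or_lt with rfl | hs
    · exact hd0.continuousWithinAt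
    · exact (hz s hs).continuousAt.continuousWithinAt
  have hwd : ∀ t, 0 < t → HasDerivAt (fun t => B (z t)) (B (w t)) t := fun t ht =>
    hasDerivAt_clm_comp B (hz t ht)
  have hzlim : Tendsto z (𝓝[>] 0) (𝓝 0) := by
    have := (hzc 0 (mem_Ici.2 le_rfl)).mono Ioi_subset_Ici_self
    rwa [ContinuousWithinAt, hz0] at this
  have hp0 : Tendsto (fun t => B (z t)) (𝓝[>] 0) (𝓝 0) := by
    have := (B.continuous.tendsto 0).comp hzlim
    rwa [map_zero] at this
  -- the smoothed velocity tends to zero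
  have hlim : Tendsto (fun t => B (w t)) (𝓝[>] 0) (𝓝 0) := by
    obtain ⟨M, hM⟩ := (isCompact_Icc (a := (0 : ℝ)) (b := 1)).exists_bound_of_continuousOn
      (hzc.mono Icc_subset_Ici_self)
    have hM0 : 0 ≤ M := (norm_nonneg _).trans (hM 0 ⟨le_rfl, zero_le_one⟩)
    -- The equation bounds the derivative of `B w` by `M`, so `B w` varies by at most `M t` on `(0,
    -- t]`; integrating from `τ` to `t` and letting `τ → 0` bounds the error by `M t²`. Division by
    -- `t` and `z(t)/t → 0` then give `B w → 0`, although `w` is not assumed to have a limit at `0`.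
    have h1 : ∀ t ∈ Ioc (0 : ℝ) 1, ‖B (z t) - t • B (w t)‖ ≤ M * t * t := by
      intro t ht
      have h2 : ∀ τ ∈ Ioc 0 t, ‖B (w τ) - B (w t)‖ ≤ M * t := by
        intro τ hτ
        have := (convex_Ioc 0 t).norm_image_sub_le_of_norm_hasDerivWithin_le (C := M)
          (fun r hr => (hw r hr.1).hasDerivWithinAt)
          (fun r hr => by
            rw [norm_neg]
            exact (h.norm_sub_apply_le _).trans (hM r ⟨hr.1.le, hr.2.trans ht.2⟩))
          (right_mem_Ioc.2 ht.1) hτ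
        refine this.trans ?_
        gcongr
        rw [Real.norm_eq_abs, abs_le]
        constructor <;> linarith [hτ.1, hτ.2, ht.1]
      have h3 : ∀ τ ∈ Ioc 0 t,
          ‖(B (z t) - t • B (w t)) - (B (z τ) - τ • B (w t))‖ ≤ M * t * t := by
        intro τ hτ
        have := (convex_Ioc 0 t).norm_image_sub_le_of_norm_hasDerivWithin_le (C := M * t)
          (f := fun r => B (z r) - r • B (w t)) (f' := fun r => B (w r) - B (w t))
          (fun r hr => ((hwd r hr.1).sub (by
            simpa using (hasDerivAt_id r).smul_const (B (w t)))).hasDerivWithinAt)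
          h2 hτ (right_mem_Ioc.2 ht.1)
        refine this.trans ?_
        have := ht.1.le
        gcongr
        rw [Real.norm_eq_abs, abs_le]
        constructor <;> linarith [hτ.1, hτ.2, ht.1]
      have h4 : Tendsto (fun τ : ℝ => ‖(B (z t) - t • B (w t)) - (B (z τ) - τ • B (w t))‖)
          (𝓝[>] 0) (𝓝 ‖(B (z t) - t • B (w t)) - (0 - (0 : ℝ) • B (w t))‖) := by
        refine (tendsto_const_nhds.sub (hp0.sub ?_)).norm
        exact (tendsto_nhdsWithin_of_tendsto_nhds tendsto_id).smul_const _
      have h5 := le_of_tendsto h4 (by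
        filter_upwards [Ioc_mem_nhdsGT ht.1] with τ hτ using h3 τ hτ)
      simpa using h5
    have hslope : Tendsto (fun t : ℝ => ‖t⁻¹ • z t‖) (𝓝[>] 0) (𝓝 0) := by
      have := ((hasDerivWithinAt_iff_tendsto_slope' self_notMem_Ioi).1 hd0.Ioi_of_Ici).norm
      simpa [slope, hz0] using this
    refine squeeze_zero_norm' (a := fun t => ‖B‖ * ‖t⁻¹ • z t‖ + M * t) ?_ ?_
    · filter_upwards [Ioc_mem_nhdsGT (zero_lt_one' ℝ)] with t ht
      have h2 : B (w t) = t⁻¹ • B (z t) - t⁻¹ • (B (z t) - t • B (w t)) := by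
        rw [← smul_sub, sub_sub_cancel, smul_smul, inv_mul_cancel₀ ht.1.ne', one_smul]
      rw [h2]
      refine (norm_sub_le _ _).trans (add_le_add ?_ ?_)
      · rw [norm_smul, norm_smul, mul_left_comm]
        gcongr
        exact B.le_opNorm _
      · rw [norm_smul, norm_inv, Real.norm_of_nonneg ht.1.le, inv_mul_le_iff₀ ht.1]
        linarith [h1 t ht]
    · have e2 : Tendsto (fun t : ℝ => M * t) (𝓝[>] 0) (𝓝 (M * 0)) :=
        (tendsto_nhdsWithin_of_tendsto_nhds tendsto_id).const_mul M
      simpa using (hslope.const_mul ‖B‖).add e2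
  -- conservation of energy
  have hen : ∀ t, 0 < t → HasDerivAt (fun t => RCLike.re (inner ℂ (z t - B (z t)) (B (z t))) +
      ‖B (w t)‖ ^ 2) 0 t := fun t ht =>
    h.hasDerivAt_energy (V := fun t => B (w t)) (hz t ht) rfl (hw t ht)
  have helim : Tendsto (fun t => RCLike.re (inner ℂ (z t - B (z t)) (B (z t))) +
      ‖B (w t)‖ ^ 2) (𝓝[>] 0) (𝓝 0) := by
    have := ((RCLike.continuous_re (K := ℂ)).tendsto _).comp
      ((hzlim.sub hp0).inner (𝕜 := ℂ) hp0)
    have h0 : Tendsto (fun t => RCLike.re (inner ℂ (z t - B (z t)) (B (z t))) + ‖B (w t)‖ ^ 2)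
      (𝓝[>] 0) (𝓝 (RCLike.re (inner ℂ ((0 : E) - 0) (0 : E)) + ‖(0 : E)‖ ^ 2)) :=
      this.add (hlim.norm.pow 2)
    rwa [sub_zero, inner_zero_left, map_zero, norm_zero, zero_pow two_ne_zero, add_zero] at h0
  -- The energy is constant on `(0, ∞)` with limit `0`, and both summands are nonnegative.
  -- Injectivity of `B` turns `B w = 0` into `w = 0`.
  have hw0 : ∀ t, 0 < t → w t = 0 := by
    intro t ht
    have hconst : ∀ s ∈ Ioi (0 : ℝ), RCLike.re (inner ℂ (z s - B (z s)) (B (z s))) +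
        ‖B (w s)‖ ^ 2 = RCLike.re (inner ℂ (z t - B (z t)) (B (z t))) + ‖B (w t)‖ ^ 2 :=
      fun s hs => isOpen_Ioi.is_const_of_deriv_eq_zero isPreconnected_Ioi
        (fun r hr => (hen r hr).differentiableAt.differentiableWithinAt)
        (fun r hr => (hen r hr).deriv) hs ht
    have h0 := tendsto_nhds_unique (tendsto_const_nhds.congr' (by
      filter_upwards [self_mem_nhdsWithin] with s hs using (hconst s hs).symm)) helim
    have h1 := h.re_inner_sub_nonneg (z t)
    have h2 : ‖B (w t)‖ ^ 2 = 0 := le_antisymm (by linarith) (sq_nonneg _)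
    exact h.injective (by rw [map_zero]; simpa using h2)
  rw [← hz0]
  refine constant_of_has_deriv_right_zero (hzc.mono Icc_subset_Ici_self) (fun s hs => ?_) t
    ⟨ht, le_rfl⟩
  rcases hs.1.eq_or_lt with rfl | hs0
  · exact hd0
  · have := hz s hs0
    rw [hw0 s hs0] at this
    exact this.hasDerivWithinAt

end IsNonnegResolvent

/-! ### The Cauchy problem in `H` and linear perturbations -/

namespace WaveMap

open IsNonnegResolvent

theorem hasDerivAt_dot {u : ℝ → H} (hu : DifferentiableOn ℝ u (Ici 0)) {σ : ℝ} (hσ : 0 < σ) :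
    HasDerivAt u (dot u σ) σ := by
  have hn := Ici_mem_nhds hσ
  rw [dot, derivWithin_of_mem_nhds hn]
  exact ((hu σ hσ.le).differentiableAt hn).hasDerivAt

theorem hasDerivWithinAt_dot {u : ℝ → H} (hu : DifferentiableOn ℝ u (Ici 0)) {σ : ℝ}
    (hσ : 0 ≤ σ) : HasDerivWithinAt u (dot u σ) (Ici 0) σ :=
  (hu σ hσ).hasDerivWithinAt

theorem dot_eq {u : ℝ → H} {u' : H} {σ : ℝ} (hσ : 0 ≤ σ) (h : HasDerivWithinAt u u' (Ici 0) σ) :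
    dot u σ = u' :=
  h.derivWithin (uniqueDiffOn_Ici 0 σ hσ)

variable {A : H →ₗ.[ℂ] H} {B : H →L[ℂ] H}

theorem resolvent_apply_add (h : IsNonnegResolvent A B) (x : A.domain) :
    B (x + A x) = x :=
  (h.mem_graph_iff _ _).1 (A.mem_graph x)

theorem exists_resolvent_eq (h : IsNonnegResolvent A B) {x : H} (hx : x ∈ A.domain) :
    ∃ y, B y = x :=
  ⟨_, resolvent_apply_add h ⟨x, hx⟩⟩

theorem resolvent_mem_domain (h : IsNonnegResolvent A B) (v : H) : B v ∈ A.domain :=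
  LinearPMap.mem_domain_of_mem_graph (h.mem_graph v)

theorem apply_resolvent (h : IsNonnegResolvent A B) (v : H) (hv : B v ∈ A.domain) :
    A ⟨B v, hv⟩ = v - B v :=
  LinearPMap.mem_graph_snd_inj _ (A.mem_graph ⟨B v, hv⟩) (h.mem_graph v) rfl

theorem dot_wave (h : IsNonnegResolvent A B) (y₀ y₁ : H) {σ : ℝ} (hσ : 0 ≤ σ) :
    dot (fun t => B (waveY B y₀ y₁ t)) σ = waveV B y₀ y₁ σ :=
  dot_eq hσ (h.hasDerivAt_apply_waveY y₀ y₁ σ).hasDerivWithinAt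

theorem isCauchySolution_wave (h : IsNonnegResolvent A B) (y₀ y₁ : H) :
    IsCauchySolution A (B y₀) (B y₁) (fun t => B (waveY B y₀ y₁ t)) where
  mem_domain σ _ := resolvent_mem_domain h _
  differentiableOn σ _ := (h.hasDerivAt_apply_waveY y₀ y₁ σ).differentiableAt.differentiableWithinAt
  equation σ hσ := by
    rw [apply_resolvent h]
    refine (h.hasDerivAt_waveV y₀ y₁ σ).congr_of_eventuallyEq ?_
    filter_upwards [Ioi_mem_nhds hσ] with s hs using dot_wave h y₀ y₁ (mem_Ioi.1 hs).le
  init := h.apply_waveY_zero y₀ y₁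
  init_dot := by rw [dot_wave h y₀ y₁ le_rfl, h.waveV_zero]

/-- Applying `B` to the equation removes the unbounded operator, since `B A u = u - B u`; the
difference of two solutions then falls under `wave_unique`. -/
theorem IsCauchySolution.eqOn (h : IsNonnegResolvent A B) {u₀ u₁ : H} {u v : ℝ → H}
    (hu : IsCauchySolution A u₀ u₁ u) (hv : IsCauchySolution A u₀ u₁ v) : EqOn v u (Ici 0) := by
  intro t ht
  rw [← sub_eq_zero]
  refine h.wave_unique (z := fun t => v t - u t) (w := fun t => dot v t - dot u t) ?_ ?_ ?_ ?_ t ht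
  · simp [hu.init, hv.init]
  · have := (hasDerivWithinAt_dot hv.differentiableOn le_rfl).fun_sub
      (hasDerivWithinAt_dot hu.differentiableOn le_rfl)
    rwa [hv.init_dot, hu.init_dot, sub_self] at this
  · exact fun t ht => (hasDerivAt_dot hv.differentiableOn ht).fun_sub
      (hasDerivAt_dot hu.differentiableOn ht)
  · intro t ht
    refine (hasDerivAt_clm_comp B ((hv.equation t ht).fun_sub (hu.equation t ht))).congr_deriv ?_
    have e1 := resolvent_apply_add h ⟨v t, hv.mem_domain t ht.le⟩
    have e2 := resolvent_apply_add h ⟨u t, hu.mem_domain t ht.le⟩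
    simp only [map_add] at e1 e2
    rw [← eq_sub_iff_add_eq'] at e1 e2
    rw [map_sub, map_neg, map_neg, e1, e2, map_sub]
    abel

theorem energy_wave (h : IsNonnegResolvent A B) (y₀ y₁ : H) {σ : ℝ} (hσ : 0 ≤ σ)
    (hd : B (waveY B y₀ y₁ σ) ∈ (sqrtOp B).domain) :
    energy (sqrtOp B) ⟨B (waveY B y₀ y₁ σ), hd⟩ (dot (fun t => B (waveY B y₀ y₁ t)) σ) =
      RCLike.re (inner ℂ (waveY B y₀ y₁ 0 - B (waveY B y₀ y₁ 0)) (B (waveY B y₀ y₁ 0))) +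
        ‖waveV B y₀ y₁ 0‖ ^ 2 := by
  rw [energy, h.norm_sqrtOp_sq, dot_wave h y₀ y₁ hσ]
  exact h.energy_wave_eq y₀ y₁ σ

theorem energy_congr {S : H →ₗ.[ℂ] H} {x y : S.domain} {v w : H} (hx : (x : H) = y) (hv : v = w) :
    energy S x v = energy S y w := by
  rw [Subtype.ext hx, hv]

/-- Conservation of energy for every solution of the Cauchy problem with data in the domain. -/
theorem IsCauchySolution.energy_eq (h : IsNonnegResolvent A B) {u₀ u₁ : H} {u : ℝ → H}
    (hu : IsCauchySolution A u₀ u₁ u) (h₀ : u₀ ∈ A.domain) (h₁ : u₁ ∈ A.domain)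
    (hd : ∀ σ : ℝ, 0 ≤ σ → u σ ∈ (sqrtOp B).domain) (σ : ℝ) (hσ : 0 ≤ σ) :
    energy (sqrtOp B) ⟨u σ, hd σ hσ⟩ (dot u σ) =
      energy (sqrtOp B) ⟨u 0, hd 0 le_rfl⟩ (dot u 0) := by
  obtain ⟨y₀, rfl⟩ := exists_resolvent_eq h h₀
  obtain ⟨y₁, rfl⟩ := exists_resolvent_eq h h₁
  have heq := (isCauchySolution_wave h y₀ y₁).eqOn h hu
  have hdot : ∀ τ, 0 ≤ τ → dot u τ = dot (fun t => B (waveY B y₀ y₁ t)) τ := fun τ hτ =>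
    derivWithin_congr heq (heq hτ)
  have key : ∀ τ (hτ : 0 ≤ τ), energy (sqrtOp B) ⟨u τ, hd τ hτ⟩ (dot u τ) = _ := fun τ hτ =>
    (energy_congr (y := ⟨B (waveY B y₀ y₁ τ), h.domain_le_sqrtOp (resolvent_mem_domain h _)⟩)
      (heq hτ) (hdot τ hτ)).trans (energy_wave h y₀ y₁ hτ _)
  rw [key σ hσ, key 0 le_rfl]

theorem coe_real_smul (c : ℝ) (x : H) : (c : ℂ) • x = c • x := by
  refine Lp.ext ?_
  filter_upwards [Lp.coeFn_smul (c : ℂ) x, Lp.coeFn_smul c x] with ρ h1 h2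
  rw [h1, h2, Pi.smul_apply, Pi.smul_apply, Complex.coe_smul]

theorem smul_mem_domain {S : H →ₗ.[ℂ] H} (c : ℝ) {x : H} (hx : x ∈ S.domain) :
    c • x ∈ S.domain := by
  rw [← coe_real_smul]
  exact S.domain.smul_mem _ hx

theorem apply_real_smul {S : H →ₗ.[ℂ] H} (c : ℝ) (x : S.domain)
    (hx : c • (x : H) ∈ S.domain) : S ⟨c • (x : H), hx⟩ = c • S x := by
  rw [← coe_real_smul c (S x), ← S.map_smul]
  congr 1

theorem energy_real_smul {S : H →ₗ.[ℂ] H} (c : ℝ) (x : S.domain) (v : H)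
    (hx : c • (x : H) ∈ S.domain) : energy S ⟨c • (x : H), hx⟩ (c • v) = c ^ 2 * energy S x v := by
  rw [energy, apply_real_smul, norm_smul, norm_smul, mul_pow, mul_pow, Real.norm_eq_abs, sq_abs,
    energy]
  ring

theorem IsLinearPerturbation.hasDerivWithinAt {φ : ℝ → H} (hφ : IsLinearPerturbation φ) {σ : ℝ}
    (hσ : 0 ≤ σ) : HasDerivWithinAt (fun s => Real.exp (-s) • φ s)
      (Real.exp (-σ) • (dot φ σ - φ σ)) (Ici 0) σ := by
  have h1 : HasDerivAt (fun s : ℝ => Real.exp (-s)) (-Real.exp (-σ)) σ := by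
    simpa using (hasDerivAt_neg σ).exp
  refine (h1.hasDerivWithinAt.fun_smul
    (hasDerivWithinAt_dot hφ.differentiableOn hσ)).congr_deriv ?_
  rw [smul_sub, neg_smul]; abel

/-- For `ψ = e^{-σ} φ` one has `ψ̈ = e^{-σ} (φ̈ - 2 φ̇ + φ)`, so the first order term and the `+ 1`
are absorbed together. -/
theorem IsLinearPerturbation.isCauchySolution {φ : ℝ → H} (hφ : IsLinearPerturbation φ) :
    IsCauchySolution A₀ (φ 0) (dot φ 0 - φ 0) (fun s => Real.exp (-s) • φ s) where
  mem_domain σ hσ := smul_mem_domain _ (hφ.mem_domain σ hσ)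
  differentiableOn σ hσ := (hφ.hasDerivWithinAt hσ).differentiableWithinAt
  equation σ hσ := by
    have h1 : HasDerivAt (fun s : ℝ => Real.exp (-s)) (-Real.exp (-σ)) σ := by
      simpa using (hasDerivAt_neg σ).exp
    rw [apply_real_smul (S := A₀) _ ⟨φ σ, hφ.mem_domain σ hσ.le⟩]
    have h2 := h1.fun_smul ((hφ.equation σ hσ).fun_sub (hasDerivAt_dot hφ.differentiableOn hσ))
    have h3 : dot (fun s => Real.exp (-s) • φ s) =ᶠ[𝓝 σ]
        fun s => Real.exp (-s) • (dot φ s - φ s) := by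
      filter_upwards [Ioi_mem_nhds hσ] with s hs
      exact dot_eq (mem_Ioi.1 hs).le (hφ.hasDerivWithinAt (mem_Ioi.1 hs).le)
    refine (h2.congr_of_eventuallyEq h3).congr_deriv ?_
    module
  init := by simp
  init_dot := by
    rw [dot_eq le_rfl (hφ.hasDerivWithinAt le_rfl)]
    simp

/-- The energy of `e^{-σ} φ` is `e^{-2σ}` times that of `(φ, φ̇ - φ)` and is conserved. -/
theorem IsLinearPerturbation.energy_eq (h : IsNonnegResolvent A₀ B) {φ : ℝ → H}
    (hφ : IsLinearPerturbation φ) (hd : ∀ σ : ℝ, 0 ≤ σ → φ σ ∈ (sqrtOp B).domain) (σ : ℝ)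
    (hσ : 0 ≤ σ) :
    √(energy (sqrtOp B) ⟨φ σ, hd σ hσ⟩ (dot φ σ - φ σ)) =
      Real.exp σ * √(energy (sqrtOp B) ⟨φ 0, hd 0 le_rfl⟩ (dot φ 0 - φ 0)) := by
  have h0 := hφ.mem_domain 0 le_rfl
  have h1 := hφ.isCauchySolution.energy_eq h h0 (A₀.domain.sub_mem hφ.init_dot_mem h0)
    (fun τ hτ => smul_mem_domain _ (hd τ hτ))
  have key : ∀ τ (hτ : 0 ≤ τ), energy (sqrtOp B)
      ⟨Real.exp (-τ) • φ τ, smul_mem_domain _ (hd τ hτ)⟩ (dot (fun s => Real.exp (-s) • φ s) τ) =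
      Real.exp (-τ) ^ 2 * energy (sqrtOp B) ⟨φ τ, hd τ hτ⟩ (dot φ τ - φ τ) := by
    intro τ hτ
    rw [dot_eq hτ (hφ.hasDerivWithinAt hτ)]
    exact energy_real_smul _ ⟨φ τ, hd τ hτ⟩ _ _
  have h2 := h1 σ hσ
  rw [key σ hσ, key 0 le_rfl, neg_zero, Real.exp_zero, one_pow, one_mul] at h2
  rw [← h2, Real.sqrt_mul (sq_nonneg _), Real.sqrt_sq (Real.exp_nonneg _), ← mul_assoc,
    ← Real.exp_add, add_neg_cancel, Real.exp_zero, one_mul]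

theorem isNonnegSqrt_sqrtOp (h : IsNonnegResolvent A B) : IsNonnegSqrt (sqrtOp B) A where
  selfAdjoint := h.sqrtOp_isSelfAdjoint
  nonneg := h.sqrtOp_nonneg
  comp_eq := h.graph_iff_sqrtOp

theorem energy_eq_zero (h : IsNonnegResolvent A B) (hker : ∀ x, (x, (0 : H)) ∈ A.graph → x = 0)
    (x : (sqrtOp B).domain) (v : H) (hx : energy (sqrtOp B) x v = 0) : x = 0 ∧ v = 0 := by
  have h1 := sq_nonneg ‖sqrtOp B x‖
  have h2 := sq_nonneg ‖v‖
  rw [energy] at hx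
  have h3 : ‖sqrtOp B x‖ ^ 2 = 0 := by linarith
  have h4 : ‖v‖ ^ 2 = 0 := by linarith
  exact ⟨h.eq_zero_of_sqrtOp_eq_zero hker x (by simpa using h3), by simpa using h4⟩

end WaveMap

namespace WaveMap

/-! ### The gauge mode -/

/-- The profile `2 ρ √(1 - ρ²) / (1 + ρ²)` of the gauge mode. -/
noncomputable def profile (ρ : ℝ) : ℝ := √(1 - ρ ^ 2) * (2 * ρ / (1 + ρ ^ 2))

/-- The derivative of the profile on `(0, 1)`. -/
noncomputable def profileDeriv (ρ : ℝ) : ℝ :=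
  √(1 - ρ ^ 2) * (2 * (1 - 3 * ρ ^ 2) / ((1 - ρ ^ 2) * (1 + ρ ^ 2) ^ 2))

theorem one_sub_sq_pos {ρ : ℝ} (h : ρ ∈ Ioo (0 : ℝ) 1) : 0 < 1 - ρ ^ 2 := by
  nlinarith [h.1, h.2]

theorem profile_pos {ρ : ℝ} (h : ρ ∈ Ioo (0 : ℝ) 1) : 0 < profile ρ := by
  have h1 := Real.sqrt_pos.2 (one_sub_sq_pos h)
  have h2 := h.1
  unfold profile
  positivity

theorem hasDerivAt_sqrt_one_sub_sq {ρ : ℝ} (h : ρ ∈ Ioo (0 : ℝ) 1) :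
    HasDerivAt (fun x : ℝ => √(1 - x ^ 2)) (√(1 - ρ ^ 2) * (-ρ / (1 - ρ ^ 2))) ρ := by
  have h1 := one_sub_sq_pos h
  have h2 : HasDerivAt (fun x : ℝ => 1 - x ^ 2) (-(2 * ρ)) ρ := by
    simpa using (hasDerivAt_pow 2 ρ).const_sub 1
  refine (h2.sqrt h1.ne').congr_deriv ?_
  have h3 := (Real.sqrt_pos.2 h1).ne'
  have h4 := Real.sq_sqrt h1.le
  field_simp
  rw [h4]

/-- The class of functions `√(1 - ρ²)` times a rational function is closed under differentiation;
pulling the root out leaves rational identities. -/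
theorem hasDerivAt_sqrt_mul {g : ℝ → ℝ} {g' ρ : ℝ} (h : ρ ∈ Ioo (0 : ℝ) 1)
    (hg : HasDerivAt g g' ρ) : HasDerivAt (fun x => √(1 - x ^ 2) * g x)
      (√(1 - ρ ^ 2) * (g' - ρ / (1 - ρ ^ 2) * g ρ)) ρ := by
  refine ((hasDerivAt_sqrt_one_sub_sq h).mul hg).congr_deriv ?_
  ring

theorem hasDerivAt_profile {ρ : ℝ} (h : ρ ∈ Ioo (0 : ℝ) 1) :
    HasDerivAt profile (profileDeriv ρ) ρ := by
  have h1 := (one_sub_sq_pos h).ne'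
  have h2 : (1 + ρ ^ 2) ≠ 0 := by positivity
  have e1 : HasDerivAt (fun x : ℝ => 2 * x) 2 ρ := by
    simpa using (hasDerivAt_id ρ).const_mul 2
  have e2 : HasDerivAt (fun x : ℝ => 1 + x ^ 2) (2 * ρ) ρ := by
    simpa using (hasDerivAt_pow 2 ρ).const_add 1
  refine (hasDerivAt_sqrt_mul h (e1.fun_div e2 h2)).congr_deriv ?_
  rw [profileDeriv]
  congr 1
  field_simp
  ring

theorem cos_two_f₀ (ρ : ℝ) : Real.cos (2 * f₀ ρ) = 2 * (2 / (1 + ρ ^ 2) - 1) ^ 2 - 1 := by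
  rw [Real.cos_two_mul, f₀, Real.cos_two_mul, Real.cos_sq_arctan]
  ring

theorem hasDerivAt_profileDeriv {ρ : ℝ} (h : ρ ∈ Ioo (0 : ℝ) 1) :
    HasDerivAt profileDeriv ((coeffQ ρ * profile ρ - 2 * ρ * profileDeriv ρ) / ρ ^ 2) ρ := by
  have h0 := h.1.ne'
  have h1 := (one_sub_sq_pos h).ne'
  have h2 : (1 + ρ ^ 2) ≠ 0 := by positivity
  have e1 : HasDerivAt (fun x : ℝ => 2 * (1 - 3 * x ^ 2)) (2 * -(3 * (2 * ρ))) ρ := by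
    simpa using (((hasDerivAt_pow 2 ρ).const_mul 3).const_sub 1).const_mul 2
  have e2 : HasDerivAt (fun x : ℝ => 1 + x ^ 2) (2 * ρ) ρ := by
    simpa using (hasDerivAt_pow 2 ρ).const_add 1
  have e3 : HasDerivAt (fun x : ℝ => 1 - x ^ 2) (-(2 * ρ)) ρ := by
    simpa using (hasDerivAt_pow 2 ρ).const_sub 1
  have e4 := e3.fun_mul (e2.fun_pow 2)
  refine (hasDerivAt_sqrt_mul h (e1.fun_div e4 (mul_ne_zero h1 (pow_ne_zero 2 h2)))).congr_deriv ?_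
  rw [profileDeriv, profile, coeffQ, cos_two_f₀]
  field_simp
  ring

/-- This is `(p θ')' = q₀ θ`: the gauge profile is a formal zero mode of `A₀`, the source of the
factorization `T* T`. -/
theorem hasDerivAt_coeffP_mul_profileDeriv {ρ : ℝ} (h : ρ ∈ Ioo (0 : ℝ) 1) :
    HasDerivAt (fun x => coeffP x * profileDeriv x) (coeffQ ρ * profile ρ) ρ := by
  have h0 := h.1.ne'
  have e : HasDerivAt coeffP (2 * ρ) ρ := by simpa [coeffP] using! hasDerivAt_pow 2 ρ
  refine (e.fun_mul (hasDerivAt_profileDeriv h)).congr_deriv ?_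
  rw [coeffP]
  field_simp
  ring

theorem deriv_f₀ (ρ : ℝ) : deriv f₀ ρ = 2 / (1 + ρ ^ 2) := by
  have : HasDerivAt f₀ (2 * (1 / (1 + ρ ^ 2))) ρ := (Real.hasDerivAt_arctan ρ).const_mul 2
  rw [this.deriv]; ring

theorem gaugeMode_eq (σ ρ : ℝ) : gaugeMode σ ρ = Real.exp σ * profile ρ := by
  rw [gaugeMode, profile, deriv_f₀]; ring

theorem gaugeMode_zero (ρ : ℝ) : gaugeMode 0 ρ = profile ρ := by
  rw [gaugeMode_eq, Real.exp_zero, one_mul]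

theorem solvesLinearizedWaveMap_gaugeMode : SolvesLinearizedWaveMap gaugeMode := by
  intro σ ρ hρ
  have hs : (fun s => gaugeMode s ρ) = fun s => Real.exp s * profile ρ :=
    funext fun s => gaugeMode_eq s ρ
  have hd : deriv (fun s => Real.exp s * profile ρ) = fun s => Real.exp s * profile ρ :=
    funext fun s => ((Real.hasDerivAt_exp s).mul_const _).deriv
  have hr : gaugeMode σ = fun x => Real.exp σ * profile x := funext fun x => gaugeMode_eq σ x
  have h1 : deriv (fun x => Real.exp σ * profile x) =ᶠ[𝓝 ρ]
      fun x => Real.exp σ * profileDeriv x := by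
    filter_upwards [isOpen_Ioo.mem_nhds hρ] with x hx
      using ((hasDerivAt_profile hx).const_mul _).deriv
  rw [hs, hd, hd, hr, h1.deriv_eq, h1.eq_of_nhds, ((hasDerivAt_profileDeriv hρ).const_mul _).deriv]
  have h0 := hρ.1.ne'
  have h1 := (one_sub_sq_pos hρ).ne'
  rw [coeffQ]
  field_simp
  ring

end WaveMap

/-! ### The resolvent of `T* T` from the graph of `T` -/

section Corner

variable {E F : Type*} [NormedAddCommGroup E] [InnerProductSpace ℂ E]
  [NormedAddCommGroup F] [InnerProductSpace ℂ F]

variable (F) in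
/-- The isometric embedding of the first summand of a Hilbert sum. -/
noncomputable def inlL2 : E →L[ℂ] WithLp 2 (E × F) :=
  ((WithLp.prodContinuousLinearEquiv 2 ℂ E F).symm : E × F →L[ℂ] WithLp 2 (E × F)) ∘L
    ContinuousLinearMap.inl ℂ E F

/-- For the graph `G` of a closed operator `T`, the operator `(1 + T* T)⁻¹`. -/
noncomputable def cornerOp (G : Submodule ℂ (WithLp 2 (E × F))) [G.HasOrthogonalProjection] :
    E →L[ℂ] E :=
  ContinuousLinearMap.fst ℂ E F ∘L
    (WithLp.prodContinuousLinearEquiv 2 ℂ E F : WithLp 2 (E × F) →L[ℂ] E × F) ∘L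
      G.starProjection ∘L inlL2 F

variable {G : Submodule ℂ (WithLp 2 (E × F))} [G.HasOrthogonalProjection]

theorem inner_cornerOp (h h' : E) : inner ℂ (cornerOp G h) h' =
    inner ℂ (G.starProjection (WithLp.toLp 2 (h, (0 : F)))) (WithLp.toLp 2 (h', (0 : F))) := by
  rw [WithLp.prod_inner_apply, inner_zero_right, add_zero]; rfl

theorem cornerOp_isSymmetric : (cornerOp G : E →ₗ[ℂ] E).IsSymmetric := by
  intro x y
  change inner ℂ (cornerOp G x) y = inner ℂ x (cornerOp G y)
  rw [inner_cornerOp, ← inner_conj_symm x, inner_cornerOp, inner_conj_symm,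
    Submodule.inner_starProjection_left_eq_right]

theorem re_inner_cornerOp (h : E) : RCLike.re (inner ℂ (cornerOp G h) h) =
    ‖G.starProjection (WithLp.toLp 2 (h, (0 : F)))‖ ^ 2 := by
  rw [inner_cornerOp, ← inner_self_eq_norm_sq (𝕜 := ℂ),
    Submodule.inner_starProjection_left_eq_right, Submodule.inner_starProjection_left_eq_right,
    Submodule.starProjection_eq_self_iff.2 (Submodule.starProjection_apply_mem _ _)]

theorem cornerOp_nonneg : 0 ≤ cornerOp G := by
  rw [ContinuousLinearMap.nonneg_iff_isPositive]
  refine ⟨cornerOp_isSymmetric, fun x => ?_⟩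
  change 0 ≤ RCLike.re (inner ℂ (cornerOp G x) x)
  rw [re_inner_cornerOp]
  positivity

theorem cornerOp_le_one : cornerOp G ≤ 1 := by
  rw [ContinuousLinearMap.le_def]
  refine ⟨?_, fun x => ?_⟩
  · exact (LinearMap.IsSymmetric.id (E := E) (𝕜 := ℂ)).sub cornerOp_isSymmetric
  · change 0 ≤ RCLike.re (inner ℂ (x - cornerOp G x) x)
    rw [inner_sub_left, map_sub, re_inner_cornerOp, inner_self_eq_norm_sq, sub_nonneg]
    have := Submodule.norm_starProjection_apply_le G (WithLp.toLp 2 (x, (0 : F)))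
    have h2 : ‖WithLp.toLp 2 (x, (0 : F))‖ = ‖x‖ := by simp
    rw [h2] at this
    gcongr

/-- The projection of `(h, 0)` to the graph is `(B h, k)` with `k = T B h`, and orthogonality of the
remainder `(h - B h, -k)` says that `T* k = h - B h`. -/
theorem exists_cornerOp (h : E) : ∃ k : F, WithLp.toLp 2 (cornerOp G h, k) ∈ G ∧
    ∀ (z : E) (m : F), WithLp.toLp 2 (z, m) ∈ G →
      inner ℂ z (h - cornerOp G h) = inner ℂ m k := by
  refine ⟨(G.starProjection (WithLp.toLp 2 (h, 0))).snd,
    Submodule.starProjection_apply_mem G (WithLp.toLp 2 (h, 0)), fun z m hz => ?_⟩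
  have := (Submodule.mem_orthogonal _ _).1
    (Submodule.sub_starProjection_mem_orthogonal (K := G) (WithLp.toLp 2 (h, (0 : F)))) _ hz
  rw [WithLp.prod_inner_apply] at this
  change inner ℂ z (h - cornerOp G h) + inner ℂ m (0 - (G.starProjection _).snd) = 0 at this
  rw [zero_sub, inner_neg_right, add_neg_eq_zero] at this
  exact this

/-- If `h - B h = 0`, testing the orthogonality relation with `(B h, k)` itself gives `‖k‖² = 0`,
that is `T h = 0`. -/
theorem mem_of_cornerOp_eq {h : E} (hh : cornerOp G h = h) :
    WithLp.toLp 2 (h, (0 : F)) ∈ G := by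
  obtain ⟨k, hk, hk'⟩ := exists_cornerOp (G := G) h
  have := hk' _ _ hk
  rw [hh, sub_self, inner_zero_right, eq_comm, inner_self_eq_zero] at this
  rwa [this, hh] at hk

end Corner

/-! ### Absolutely continuous complex functions -/

section AC

theorem AbsolutelyContinuousOnInterval.ofReal {f : ℝ → ℝ} {a b : ℝ}
    (hf : AbsolutelyContinuousOnInterval f a b) :
    AbsolutelyContinuousOnInterval (fun x => (f x : ℂ)) a b := by
  unfold AbsolutelyContinuousOnInterval at hf ⊢
  simpa only [Complex.isometry_ofReal.dist_eq] using hf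

theorem IntervalIntegrable.absolutelyContinuousOnInterval_integral_complex {f : ℝ → ℂ} {a b c : ℝ}
    (hf : IntervalIntegrable f volume a b) (hc : c ∈ uIcc a b) :
    AbsolutelyContinuousOnInterval (fun x => ∫ t in c..x, f t) a b := by
  have hre : IntervalIntegrable (fun t => (f t).re) volume a b := ⟨hf.1.re, hf.2.re⟩
  have him : IntervalIntegrable (fun t => (f t).im) volume a b := ⟨hf.1.im, hf.2.im⟩
  have h1 := ((hre.absolutelyContinuousOnInterval_intervalIntegral hc).ofReal).add
    ((him.absolutelyContinuousOnInterval_intervalIntegral hc).ofReal.const_smul Complex.I)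
  have key : ∀ x ∈ uIcc a b, ∫ t in c..x, f t =
      ((∫ t in c..x, (f t).re : ℝ) : ℂ) + Complex.I • ((∫ t in c..x, (f t).im : ℝ) : ℂ) := by
    intro x hx
    have hi : IntervalIntegrable f volume c x := hf.mono_set (uIcc_subset_uIcc hc hx)
    have e1 := Complex.reCLM.intervalIntegral_comp_comm hi
    have e2 := Complex.imCLM.intervalIntegral_comp_comm hi
    simp only [Complex.reCLM_apply, Complex.imCLM_apply] at e1 e2
    rw [e1, e2, smul_eq_mul, mul_comm, Complex.re_add_im]
  rw [absolutelyContinuousOnInterval_iff] at h1 ⊢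
  intro ε hε
  obtain ⟨δ, hδ, H⟩ := h1 ε hε
  refine ⟨δ, hδ, fun I hI hl => lt_of_eq_of_lt (Finset.sum_congr rfl fun i hi => ?_) (H I hI hl)⟩
  have := hI.1 i hi
  rw [key _ this.1, key _ this.2]
  rfl

/-- Integration by parts for primitives of integrable functions. -/
theorem integral_mul_primitive_add {f g : ℝ → ℂ} {a b : ℝ} (hf : IntervalIntegrable f volume a b)
    (hg : IntervalIntegrable g volume a b) (c d : ℂ) :
    ∫ x in a..b, (f x * (d + ∫ t in a..x, g t) + (c + ∫ t in a..x, f t) * g x) =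
      (c + ∫ t in a..b, f t) * (d + ∫ t in a..b, g t) - c * d := by
  have hconst : ∀ e : ℂ, AbsolutelyContinuousOnInterval (fun _ : ℝ => e) a b := fun e =>
    ((LipschitzWith.const e).lipschitzOnWith (s := uIcc a b)).absolutelyContinuousOnInterval
  have hF := (hconst c).fun_add (hf.absolutelyContinuousOnInterval_integral_complex left_mem_uIcc)
  have hG := (hconst d).fun_add (hg.absolutelyContinuousOnInterval_integral_complex left_mem_uIcc)
  have hint : IntervalIntegrable
      (fun x => f x * (d + ∫ t in a..x, g t) + (c + ∫ t in a..x, f t) * g x) volume a b :=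
    (hf.mul_continuousOn hG.continuousOn).add (hg.continuousOn_mul hF.continuousOn)
  -- The product minus the primitive of its formal derivative is absolutely continuous with
  -- derivative zero almost everywhere, hence constant.
  have hH := (hF.fun_smul hG).fun_sub
    (hint.absolutelyContinuousOnInterval_integral_complex left_mem_uIcc)
  obtain ⟨C, hC⟩ := hH.const_of_ae_hasDerivAt_zero (by
    filter_upwards [hf.ae_hasDerivAt_integral, hg.ae_hasDerivAt_integral,
      hint.ae_hasDerivAt_integral] with x h1 h2 h3 hx
    have e1 := (h1 hx a left_mem_uIcc).const_add c
    have e2 := (h2 hx a left_mem_uIcc).const_add d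
    have e3 := h3 hx a left_mem_uIcc
    refine ((e1.fun_mul e2).fun_sub e3).congr_deriv (sub_self _))
  have e1 := hC a left_mem_uIcc
  have e2 := hC b right_mem_uIcc
  rw [← e1] at e2
  simp only [intervalIntegral.integral_same, smul_eq_mul, add_zero, sub_zero] at e2
  rw [← e2]; ring

end AC

/-! ### Local absolute continuity on the open interval -/

namespace WaveMap

theorem ACloc.mul {f g : ℝ → ℂ} (hf : ACloc f) (hg : ACloc g) : ACloc (fun x => f x * g x) :=
  fun a b ha hab hb => (hf a b ha hab hb).fun_smul (hg a b ha hab hb)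

theorem ACloc.of_hasDerivAt {f f' : ℝ → ℂ} (hf : ∀ x ∈ Ioo (0 : ℝ) 1, HasDerivAt f (f' x) x)
    (hc : ContinuousOn f' (Ioo 0 1)) : ACloc f := by
  intro a b ha hab hb
  have hsub : Icc a b ⊆ Ioo 0 1 := fun x hx => ⟨ha.trans_le hx.1, hx.2.trans_lt hb⟩
  obtain ⟨C, hC⟩ := isCompact_Icc.exists_bound_of_continuousOn (hc.mono hsub)
  have hC0 : 0 ≤ C := (norm_nonneg _).trans (hC a ⟨le_rfl, hab⟩)
  refine LipschitzOnWith.absolutelyContinuousOnInterval (K := ⟨C, hC0⟩) ?_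
  rw [uIcc_of_le hab]
  exact (convex_Icc a b).lipschitzOnWith_of_nnnorm_hasDerivWithin_le
    (fun x hx => (hf x (hsub hx)).hasDerivWithinAt) fun x hx => hC x hx

/-- Local integrability on `(0, 1)`. -/
def LocInt (m : ℝ → ℂ) : Prop :=
  ∀ a b : ℝ, 0 < a → a ≤ b → b < 1 → IntegrableOn m (Icc a b)

theorem LocInt.intervalIntegrable {m : ℝ → ℂ} (hm : LocInt m) {a b : ℝ} (ha : a ∈ Ioo (0 : ℝ) 1)
    (hb : b ∈ Ioo (0 : ℝ) 1) : IntervalIntegrable m volume a b := by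
  rw [intervalIntegrable_iff']
  exact hm _ _ (lt_min ha.1 hb.1) min_le_max (max_lt ha.2 hb.2)

theorem half_mem : (1 / 2 : ℝ) ∈ Ioo (0 : ℝ) 1 := by norm_num

theorem LocInt.acloc {m : ℝ → ℂ} (hm : LocInt m) {c : ℝ} (hc : c ∈ Ioo (0 : ℝ) 1) :
    ACloc (fun x => ∫ t in c..x, m t) := by
  intro a b ha hab hb
  have h1 : min a c ∈ Ioo (0 : ℝ) 1 := ⟨lt_min ha hc.1, (min_le_right _ _).trans_lt hc.2⟩
  have h2 : max b c ∈ Ioo (0 : ℝ) 1 := ⟨hc.1.trans_le (le_max_right _ _), max_lt hb hc.2⟩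
  have hle : min a c ≤ max b c := (min_le_right _ _).trans (le_max_right _ _)
  refine ((hm.intervalIntegrable h1 h2).absolutelyContinuousOnInterval_integral_complex
    (c := c) ?_).mono ?_
  · rw [uIcc_of_le hle]; exact ⟨min_le_right _ _, le_max_right _ _⟩
  · rw [uIcc_of_le hle, uIcc_of_le hab]
    exact Icc_subset_Icc (min_le_left _ _) (le_max_left _ _)

/-- A property holding almost everywhere on compact subintervals holds almost everywhere. -/
theorem ae_Ioo_of_ae_Icc {P : ℝ → Prop}
    (h : ∀ a b : ℝ, 0 < a → a < 1 / 4 → 3 / 4 < b → b < 1 → ∀ᵐ x, x ∈ Icc a b → P x) :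
    ∀ᵐ x ∂(volume.restrict (Ioo (0 : ℝ) 1)), P x := by
  rw [ae_restrict_iff' measurableSet_Ioo]
  -- The shift by `5` keeps the endpoints outside `[1/4, 3/4]`, as required by the hypothesis; all
  -- intervals then share this core, on which constants of integration can be compared.
  have key : ∀ n : ℕ, ∀ᵐ x : ℝ, x ∈ Icc (1 / ((n : ℝ) + 5)) (1 - 1 / ((n : ℝ) + 5)) → P x := by
    intro n
    have h0 : (0 : ℝ) < 1 / ((n : ℝ) + 5) := by positivity
    have h2 : (1 : ℝ) / ((n : ℝ) + 5) ≤ 1 / 5 := by gcongr; linarith [n.cast_nonneg (α := ℝ)]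
    exact h _ _ h0 (by linarith) (by linarith) (by linarith)
  filter_upwards [ae_all_iff.2 key] with x hx hmem
  obtain ⟨n, hn⟩ := exists_nat_one_div_lt (lt_min hmem.1 (sub_pos.2 hmem.2))
  have h3 : (1 : ℝ) / ((n : ℝ) + 5) ≤ 1 / ((n : ℝ) + 1) := by gcongr; linarith
  have h4 := lt_of_le_of_lt h3 hn
  exact hx n ⟨h4.le.trans (min_le_left _ _), by linarith [h4.le.trans (min_le_right _ _)]⟩

theorem LocInt.ae_hasDerivAt {m : ℝ → ℂ} (hm : LocInt m) {c : ℝ} (hc : c ∈ Ioo (0 : ℝ) 1) :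
    ∀ᵐ x ∂(volume.restrict (Ioo (0 : ℝ) 1)), HasDerivAt (fun x => ∫ t in c..x, m t) (m x) x := by
  refine ae_Ioo_of_ae_Icc fun a b ha _ _ hb => ?_
  have h1 : min a c ∈ Ioo (0 : ℝ) 1 := ⟨lt_min ha hc.1, (min_le_right _ _).trans_lt hc.2⟩
  have h2 : max b c ∈ Ioo (0 : ℝ) 1 := ⟨hc.1.trans_le (le_max_right _ _), max_lt hb hc.2⟩
  have hle : min a c ≤ max b c := (min_le_right _ _).trans (le_max_right _ _)
  filter_upwards [(hm.intervalIntegrable h1 h2).ae_hasDerivAt_integral] with x hx hmem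
  rw [uIcc_of_le hle] at hx
  exact hx ⟨(min_le_left _ _).trans hmem.1, hmem.2.trans (le_max_left _ _)⟩ c
    ⟨min_le_right _ _, le_max_right _ _⟩

/-- A locally absolutely continuous function with vanishing derivative is constant. -/
theorem ACloc.eq_const {f : ℝ → ℂ} (hf : ACloc f)
    (h : ∀ᵐ x ∂(volume.restrict (Ioo (0 : ℝ) 1)), HasDerivAt f 0 x) {x y : ℝ}
    (hx : x ∈ Ioo (0 : ℝ) 1) (hy : y ∈ Ioo (0 : ℝ) 1) : f x = f y := by
  rw [ae_restrict_iff' measurableSet_Ioo] at h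
  have hle : min x y ≤ max x y := min_le_max
  obtain ⟨C, hC⟩ := (hf (min x y) (max x y) (lt_min hx.1 hy.1) hle
    (max_lt hx.2 hy.2)).const_of_ae_hasDerivAt_zero (by
      filter_upwards [h] with t ht hmem
      rw [uIcc_of_le hle] at hmem
      exact ht ⟨(lt_min hx.1 hy.1).trans_le hmem.1, hmem.2.trans_lt (max_lt hx.2 hy.2)⟩)
  rw [uIcc_of_le hle] at hC
  rw [hC x ⟨min_le_left _ _, le_max_left _ _⟩, hC y ⟨min_le_right _ _, le_max_right _ _⟩]

theorem locInt_of_continuousOn {m : ℝ → ℂ} (hm : ContinuousOn m (Ioo 0 1)) : LocInt m :=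
  fun _ _ ha _ hb => (hm.mono fun _ hx => ⟨ha.trans_le hx.1, hx.2.trans_lt hb⟩).integrableOn_Icc

/-- A locally absolutely continuous function whose derivative agrees almost everywhere with a
continuous function is continuously differentiable. -/
theorem ACloc.hasDerivAt {f φ : ℝ → ℂ} (hf : ACloc f) (hφ : ContinuousOn φ (Ioo 0 1))
    (h : ∀ᵐ x ∂(volume.restrict (Ioo (0 : ℝ) 1)), deriv f x = φ x) {x : ℝ}
    (hx : x ∈ Ioo (0 : ℝ) 1) : HasDerivAt f (φ x) x := by
  have hm := locInt_of_continuousOn hφ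
  have hsub : ACloc (fun x => f x - ∫ t in (1 / 2 : ℝ)..x, φ t) := fun a b ha hab hb =>
    (hf a b ha hab hb).fun_sub (hm.acloc half_mem a b ha hab hb)
  have hz : ∀ᵐ x ∂(volume.restrict (Ioo (0 : ℝ) 1)),
      HasDerivAt (fun x => f x - ∫ t in (1 / 2 : ℝ)..x, φ t) 0 x := by
    filter_upwards [h, hf.ae_differentiableAt, hm.ae_hasDerivAt half_mem] with t h1 h2 h3
    have := h2.hasDerivAt.fun_sub h3
    rwa [h1, sub_self] at this
  have heq : f =ᶠ[𝓝 x] fun y => (f (1 / 2)) + ∫ t in (1 / 2 : ℝ)..y, φ t := by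
    filter_upwards [isOpen_Ioo.mem_nhds hx] with y hy
    have := hsub.eq_const hz hy half_mem
    rw [intervalIntegral.integral_same, sub_zero] at this
    rw [← this]; ring
  refine HasDerivAt.congr_of_eventuallyEq ?_ heq
  refine (intervalIntegral.integral_hasDerivAt_right (hm.intervalIntegrable half_mem hx) ?_
    (hφ.continuousAt (isOpen_Ioo.mem_nhds hx))).const_add _
  exact hφ.stronglyMeasurableAtFilter isOpen_Ioo x hx

end WaveMap

open scoped ComplexConjugate

namespace WaveMap

/-! ### Test functions and the lemma of du Bois-Reymond -/

/-- Square integrable functions with compact support in `(0, 1)`. -/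
structure L2c (χ : ℝ → ℂ) (a b : ℝ) : Prop where
  pos : 0 < a
  lt : a < b
  lt_one : b < 1
  eq_zero : ∀ x, x ∉ Icc a b → χ x = 0
  memLp : MemLp χ 2 volume

theorem Icc_subset_unit {a b : ℝ} (ha : 0 < a) (hb : b < 1) : Icc a b ⊆ Ioo (0 : ℝ) 1 :=
  fun _ hx => ⟨ha.trans_le hx.1, hx.2.trans_lt hb⟩

theorem continuousOn_weight : ContinuousOn weight (Ioo 0 1) := by
  unfold weight
  exact ContinuousOn.div (by fun_prop) (by fun_prop) fun x hx =>
    pow_ne_zero 2 (one_sub_sq_pos hx).ne'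

theorem toReal_ofReal_weight {ρ : ℝ} (h : ρ ∈ Ioo (0 : ℝ) 1) :
    (ENNReal.ofReal (weight ρ)).toReal = weight ρ :=
  ENNReal.toReal_ofReal (weight_pos h).le

theorem integrable_wMeasure_iff {F : Type*} [NormedAddCommGroup F] [NormedSpace ℝ F] {g : ℝ → F} :
    Integrable g wMeasure ↔ IntegrableOn (fun ρ => weight ρ • g ρ) (Ioo 0 1) := by
  rw [wMeasure, integrable_withDensity_iff_integrable_smul' measurable_weight.ennreal_ofReal
    (by simp)]
  refine integrable_congr ?_
  filter_upwards [ae_restrict_mem measurableSet_Ioo] with ρ hρ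
  rw [toReal_ofReal_weight hρ]

theorem integral_wMeasure {F : Type*} [NormedAddCommGroup F] [NormedSpace ℝ F] (g : ℝ → F) :
    ∫ ρ, g ρ ∂wMeasure = ∫ ρ in Ioo 0 1, weight ρ • g ρ := by
  rw [wMeasure, integral_withDensity_eq_integral_toReal_smul measurable_weight.ennreal_ofReal
    (by simp)]
  refine integral_congr_ae ?_
  filter_upwards [ae_restrict_mem measurableSet_Ioo] with ρ hρ
  rw [toReal_ofReal_weight hρ]

theorem inner_H (u v : H) : inner ℂ u v = ∫ ρ in Ioo 0 1, (weight ρ : ℂ) * (conj (u ρ) * v ρ) := by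
  rw [L2.inner_def, integral_wMeasure]
  refine integral_congr_ae (Eventually.of_forall fun ρ => ?_)
  simp only [RCLike.inner_apply, Complex.real_smul]
  ring

/-- The Hilbert space `L²(0, 1)`. -/
abbrev L2unit : Type := Lp ℂ 2 (volume.restrict (Ioo (0 : ℝ) 1))

theorem inner_L2unit (u v : L2unit) : inner ℂ u v = ∫ ρ in Ioo 0 1, conj (u ρ) * v ρ := by
  rw [L2.inner_def]
  refine integral_congr_ae (Eventually.of_forall fun ρ => ?_)
  simp only [RCLike.inner_apply]
  ring

theorem integrableOn_Ioo_of_Icc {g : ℝ → ℝ} {a b : ℝ} (hg : ∀ x, x ∉ Icc a b → g x = 0)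
    (h : IntegrableOn g (Icc a b)) : IntegrableOn g (Ioo 0 1) := by
  rw [integrableOn_iff_integrable_of_support_subset] at h
  · exact h.integrableOn
  · intro x hx
    by_contra hn
    exact hx (hg x hn)

theorem L2c.aestronglyMeasurable {χ : ℝ → ℂ} {a b : ℝ} (h : L2c χ a b) {c : ℝ → ℂ}
    (hc : ContinuousOn c (Ioo 0 1)) :
    AEStronglyMeasurable (fun ρ => c ρ * χ ρ) (volume.restrict (Ioo (0 : ℝ) 1)) :=
  (hc.aestronglyMeasurable measurableSet_Ioo).mul h.memLp.1.restrict

theorem L2c.integrableOn_sq {χ : ℝ → ℂ} {a b : ℝ} (h : L2c χ a b) {c : ℝ → ℝ}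
    (hc : ContinuousOn c (Ioo 0 1)) : IntegrableOn (fun ρ => c ρ * ‖χ ρ‖ ^ 2) (Ioo 0 1) := by
  refine integrableOn_Ioo_of_Icc (a := a) (b := b) (fun x hx => by simp [h.eq_zero x hx]) ?_
  exact IntegrableOn.continuousOn_mul (hc.mono (Icc_subset_unit h.pos h.lt_one))
    ((memLp_two_iff_integrable_sq_norm h.memLp.1).1 h.memLp).integrableOn isCompact_Icc

theorem L2c.memLp_wMeasure {χ : ℝ → ℂ} {a b : ℝ} (h : L2c χ a b) {c : ℝ → ℂ}
    (hc : ContinuousOn c (Ioo 0 1)) : MemLp (fun ρ => c ρ * χ ρ) 2 wMeasure := by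
  have hm : AEStronglyMeasurable (fun ρ => c ρ * χ ρ) wMeasure :=
    (h.aestronglyMeasurable hc).mono_ac (withDensity_absolutelyContinuous _ _)
  rw [memLp_two_iff_integrable_sq_norm hm, integrable_wMeasure_iff]
  refine (h.integrableOn_sq (c := fun ρ => weight ρ * ‖c ρ‖ ^ 2)
    (continuousOn_weight.mul (hc.norm.pow 2))).congr_fun (fun ρ _ => ?_) measurableSet_Ioo
  simp only [norm_mul, mul_pow, smul_eq_mul]
  ring

theorem L2c.memLp_unit {χ : ℝ → ℂ} {a b : ℝ} (h : L2c χ a b) {c : ℝ → ℂ}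
    (hc : ContinuousOn c (Ioo 0 1)) :
    MemLp (fun ρ => c ρ * χ ρ) 2 (volume.restrict (Ioo (0 : ℝ) 1)) := by
  rw [memLp_two_iff_integrable_sq_norm (h.aestronglyMeasurable hc)]
  refine (h.integrableOn_sq (c := fun ρ => ‖c ρ‖ ^ 2) (hc.norm.pow 2)).congr_fun
    (fun ρ _ => ?_) measurableSet_Ioo
  simp only [norm_mul, mul_pow]

/-- Local square integrability on `(0, 1)`. -/
def LocL2 (F : ℝ → ℂ) : Prop :=
  ∀ a b : ℝ, 0 < a → b < 1 → MemLp F 2 (volume.restrict (Icc a b))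

theorem LocL2.locInt {F : ℝ → ℂ} (h : LocL2 F) : LocInt F :=
  fun a b ha _ hb => (h a b ha hb).integrable one_le_two

theorem locL2_of_continuousOn {F : ℝ → ℂ} (hF : ContinuousOn F (Ioo 0 1)) : LocL2 F := by
  intro a b ha hb
  have hc := hF.mono (Icc_subset_unit ha hb)
  rw [memLp_two_iff_integrable_sq_norm (hc.aestronglyMeasurable measurableSet_Icc)]
  exact (hc.norm.pow 2).integrableOn_Icc

theorem LocL2.mul_continuousOn {F c : ℝ → ℂ} (h : LocL2 F) (hc : ContinuousOn c (Ioo 0 1)) :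
    LocL2 (fun ρ => c ρ * F ρ) := by
  intro a b ha hb
  have hc' := hc.mono (Icc_subset_unit ha hb)
  have hF := h a b ha hb
  have hm : AEStronglyMeasurable (fun ρ => c ρ * F ρ) (volume.restrict (Icc a b)) :=
    (hc'.aestronglyMeasurable measurableSet_Icc).mul hF.1
  rw [memLp_two_iff_integrable_sq_norm hm]
  refine (IntegrableOn.continuousOn_mul (hc'.norm.pow 2)
    ((memLp_two_iff_integrable_sq_norm hF.1).1 hF) isCompact_Icc).congr_fun
    (fun ρ _ => ?_) measurableSet_Icc
  simp only [norm_mul, mul_pow, Pi.pow_apply]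

/-- The reciprocal of the weight is continuous, hence bounded, on compact subintervals. -/
theorem locL2_H (u : H) : LocL2 u := by
  intro a b ha hb
  have hsub := Icc_subset_unit ha hb
  have hu := Lp.memLp u
  have hac : volume.restrict (Ioo (0 : ℝ) 1) ≪ wMeasure := by
    intro s hs
    have h1 : sᶜ ∈ ae wMeasure := by rwa [mem_ae_iff, compl_compl]
    rw [ae_wMeasure, mem_ae_iff, compl_compl] at h1
    exact h1
  have hm : AEStronglyMeasurable u (volume.restrict (Icc a b)) :=
    (hu.1.mono_ac hac).mono_measure (Measure.restrict_mono hsub le_rfl)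
  rw [memLp_two_iff_integrable_sq_norm hu.1, integrable_wMeasure_iff] at hu
  rw [memLp_two_iff_integrable_sq_norm hm]
  refine (IntegrableOn.continuousOn_mul (g := fun ρ => (weight ρ)⁻¹)
    ((continuousOn_weight.mono hsub).inv₀ fun x hx => (weight_pos (hsub hx)).ne')
    (hu.mono_set hsub) isCompact_Icc).congr_fun (fun ρ hρ => ?_) measurableSet_Icc
  simp only [smul_eq_mul]
  rw [inv_mul_cancel_left₀ (weight_pos (hsub hρ)).ne']

theorem locL2_L2unit (u : L2unit) : LocL2 u := fun _ _ ha hb =>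
  (Lp.memLp u).mono_measure (Measure.restrict_mono (Icc_subset_unit ha hb) le_rfl)

theorem setIntegral_Ioo_eq {E : Type*} [NormedAddCommGroup E] [NormedSpace ℝ E] {g : ℝ → E}
    {a b : ℝ} (ha : 0 < a) (hab : a ≤ b) (hb : b < 1) (hg : ∀ x, x ∉ Icc a b → g x = 0) :
    ∫ x in Ioo 0 1, g x = ∫ x in a..b, g x := by
  rw [intervalIntegral.integral_of_le hab, ← integral_Icc_eq_integral_Ioc]
  refine (setIntegral_eq_of_subset_of_forall_sdiff_eq_zero measurableSet_Ioo
    (Icc_subset_unit ha hb) fun x hx => hg x hx.2).symm ▸ rfl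

/-- A test function: the derivative of a compactly supported function. -/
structure IsTest (χ : ℝ → ℂ) (a b : ℝ) : Prop extends L2c χ a b where
  integral_eq_zero : ∫ x in a..b, χ x = 0

/-- The primitive of a test function. -/
noncomputable def prim (χ : ℝ → ℂ) (x : ℝ) : ℂ := ∫ t in (0 : ℝ)..x, χ t

theorem L2c.integrable {χ : ℝ → ℂ} {a b : ℝ} (h : L2c χ a b) : Integrable χ := by
  have h1 : IntegrableOn χ (Icc a b) := (h.memLp.restrict (Icc a b)).integrable one_le_two
  rwa [integrableOn_iff_integrable_of_support_subset] at h1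
  intro x hx
  by_contra hn
  exact hx (h.eq_zero x hn)

theorem L2c.intervalIntegrable {χ : ℝ → ℂ} {a b : ℝ} (h : L2c χ a b) (c d : ℝ) :
    IntervalIntegrable χ volume c d := h.integrable.intervalIntegrable

theorem L2c.prim_eq {χ : ℝ → ℂ} {a b : ℝ} (h : L2c χ a b) (x : ℝ) :
    prim χ x = ∫ t in a..x, χ t := by
  rw [prim, ← intervalIntegral.integral_add_adjacent_intervals (h.intervalIntegrable 0 a)
    (h.intervalIntegrable a x)]
  have : ∫ t in (0 : ℝ)..a, χ t = 0 := by
    rw [intervalIntegral.integral_of_le h.pos.le, integral_Ioc_eq_integral_Ioo]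
    exact setIntegral_eq_zero_of_forall_eq_zero fun t ht =>
      h.eq_zero t fun hm => absurd hm.1 (not_le.2 ht.2)
  rw [this, zero_add]

/-- To the left of `a` nothing has been integrated yet; to the right of `b` the whole mean has been,
and it is zero. -/
theorem IsTest.prim_eq_zero {χ : ℝ → ℂ} {a b : ℝ} (h : IsTest χ a b) (x : ℝ) (hx : x ∉ Icc a b) :
    prim χ x = 0 := by
  rw [h.toL2c.prim_eq]
  rcases lt_or_ge x a with hxa | hxa
  · rw [intervalIntegral.integral_symm, intervalIntegral.integral_of_le hxa.le,
      integral_Ioc_eq_integral_Ioo, setIntegral_eq_zero_of_forall_eq_zero, neg_zero]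
    exact fun t ht => h.eq_zero t fun hm => absurd hm.1 (not_le.2 ht.2)
  · have hxb : b < x := by
      by_contra hn
      exact hx ⟨hxa, not_lt.1 hn⟩
    rw [← intervalIntegral.integral_add_adjacent_intervals (h.toL2c.intervalIntegrable a b)
      (h.toL2c.intervalIntegrable b x), h.integral_eq_zero, zero_add,
      intervalIntegral.integral_of_le hxb.le]
    exact setIntegral_eq_zero_of_forall_eq_zero fun t ht =>
      h.eq_zero t fun hm => absurd hm.2 (not_le.2 ht.1)

theorem L2c.continuous_prim {χ : ℝ → ℂ} {a b : ℝ} (h : L2c χ a b) : Continuous (prim χ) :=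
  intervalIntegral.continuous_primitive h.intervalIntegrable 0

theorem IsTest.prim_l2c {χ : ℝ → ℂ} {a b : ℝ} (h : IsTest χ a b) : L2c (prim χ) a b where
  pos := h.pos
  lt := h.lt
  lt_one := h.lt_one
  eq_zero := h.prim_eq_zero
  memLp := h.toL2c.continuous_prim.memLp_of_hasCompactSupport
    (HasCompactSupport.intro isCompact_Icc h.prim_eq_zero)

theorem intervalIntegral_conj {χ : ℝ → ℂ} (c d : ℝ) :
    ∫ t in c..d, conj (χ t) = conj (∫ t in c..d, χ t) := by
  simp only [intervalIntegral, _root_.integral_conj, map_sub]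

theorem L2c.conj {χ : ℝ → ℂ} {a b : ℝ} (h : L2c χ a b) : L2c (fun x => conj (χ x)) a b where
  pos := h.pos
  lt := h.lt
  lt_one := h.lt_one
  eq_zero x hx := by rw [h.eq_zero x hx, map_zero]
  memLp := h.memLp.star

/-- Integration by parts against a test function. -/
theorem IsTest.integral_by_parts {χ : ℝ → ℂ} {a b : ℝ} (h : IsTest χ a b) {m : ℝ → ℂ}
    (hm : LocInt m) {c : ℝ} (hc : c ∈ Ioo (0 : ℝ) 1) :
    ∫ x in a..b, (m x * conj (prim χ x) + (∫ t in c..x, m t) * conj (χ x)) = 0 := by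
  have ha : a ∈ Ioo (0 : ℝ) 1 := ⟨h.pos, h.lt.trans h.lt_one⟩
  have hb : b ∈ Ioo (0 : ℝ) 1 := ⟨h.pos.trans h.lt, h.lt_one⟩
  have key := integral_mul_primitive_add (hm.intervalIntegrable ha hb)
    (h.toL2c.conj.intervalIntegrable a b) (∫ t in c..a, m t) 0
  rw [intervalIntegral_conj a b, h.integral_eq_zero, map_zero, add_zero, mul_zero, mul_zero,
    sub_zero] at key
  rw [← key]
  refine intervalIntegral.integral_congr fun x hx => ?_
  rw [uIcc_of_le h.lt.le] at hx
  have hx' := Icc_subset_unit h.pos h.lt_one hx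
  rw [intervalIntegral_conj a x, zero_add, h.toL2c.prim_eq,
    intervalIntegral.integral_add_adjacent_intervals (hm.intervalIntegrable hc ha)
      (hm.intervalIntegrable ha hx')]

theorem LocL2.integrable_conj_mul {F : ℝ → ℂ} (hF : LocL2 F) {χ : ℝ → ℂ} {a b : ℝ}
    (h : L2c χ a b) : IntervalIntegrable (fun x => conj (χ x) * F x) volume a b := by
  rw [intervalIntegrable_iff_integrableOn_Icc_of_le h.lt.le]
  exact (h.conj.memLp.restrict (Icc a b)).integrable_mul (hF a b h.pos h.lt_one)

/-- If the difference is orthogonal to all mean zero functions, it is constant. -/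
theorem ae_eq_const_of_forall_test {F m : ℝ → ℂ} (hF : LocL2 F) (hm : LocInt m)
    (H : ∀ χ a b, IsTest χ a b →
      (∫ x in Ioo 0 1, conj (χ x) * F x) + ∫ x in Ioo 0 1, conj (prim χ x) * m x = 0)
    {a b : ℝ} (ha : 0 < a) (hab : a < b) (hb : b < 1) :
    ∃ c : ℂ, ∀ᵐ x, x ∈ Icc a b → F x = c + ∫ t in (1 / 2 : ℝ)..x, m t := by
  set M : ℝ → ℂ := fun x => ∫ t in (1 / 2 : ℝ)..x, m t with hMdef
  have hM : LocL2 M := locL2_of_continuousOn (hm.acloc half_mem).continuousOn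
  have hD : LocL2 (fun x => F x - M x) := fun a b ha hb => (hF a b ha hb).sub (hM a b ha hb)
  set c : ℂ := (b - a : ℂ)⁻¹ * ∫ x in a..b, (F x - M x) with hcdef
  have hDc : LocL2 (fun x => F x - M x - c) := fun a b ha hb => (hD a b ha hb).sub (memLp_const c)
  have ha' : a ∈ Ioo (0 : ℝ) 1 := ⟨ha, hab.trans hb⟩
  have hb' : b ∈ Ioo (0 : ℝ) 1 := ⟨ha.trans hab, hb⟩
  -- Since `c` is the mean of `F - M`, its truncated deviation from `c` has mean zero and is an
  -- admissible test function. Testing with it gives `∫ ‖F - M - c‖² = 0`; as test functions are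
  -- only square integrable, no mollification is needed.
  set χ : ℝ → ℂ := (Icc a b).indicator (fun x => F x - M x - c) with hχdef
  have hχeq : ∀ x ∈ Icc a b, χ x = F x - M x - c := fun x hx => indicator_of_mem hx _
  have hab0 : (b - a : ℂ) ≠ 0 := by
    rw [← Complex.ofReal_sub]; exact_mod_cast (sub_pos.2 hab).ne'
  have hχ : IsTest χ a b :=
    { pos := ha
      lt := hab
      lt_one := hb
      eq_zero := fun x hx => indicator_of_notMem hx _
      memLp := (memLp_indicator_iff_restrict measurableSet_Icc).2 (hDc a b ha hb)
      integral_eq_zero := by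
        have : ∫ x in a..b, χ x = ∫ x in a..b, (F x - M x - c) :=
          intervalIntegral.integral_congr fun x hx => hχeq x (by rwa [uIcc_of_le hab.le] at hx)
        rw [this, intervalIntegral.integral_sub (hD.locInt.intervalIntegrable ha' hb')
          intervalIntegrable_const, intervalIntegral.integral_const, Complex.real_smul,
          Complex.ofReal_sub, hcdef, mul_inv_cancel_left₀ hab0, sub_self] }
  have h1 := H χ a b hχ
  rw [setIntegral_Ioo_eq ha hab.le hb (fun x hx => by rw [hχ.eq_zero x hx]; simp),
    setIntegral_Ioo_eq ha hab.le hb (fun x hx => by rw [hχ.prim_eq_zero x hx]; simp)] at h1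
  have h2 := hχ.integral_by_parts hm half_mem
  have hcont : ContinuousOn (fun x => conj (prim χ x)) (uIcc a b) :=
    (Complex.continuous_conj.comp hχ.toL2c.continuous_prim).continuousOn
  have hMχ : IntervalIntegrable (fun x => M x * conj (χ x)) volume a b := by
    simpa only [mul_comm] using hM.integrable_conj_mul hχ.toL2c
  rw [intervalIntegral.integral_add ((hm.intervalIntegrable ha' hb').mul_continuousOn hcont) hMχ]
    at h2
  have h3 : ∫ x in a..b, conj (χ x) * (F x - M x - c) = 0 := by
    have e1 : ∫ x in a..b, conj (χ x) * (F x - M x - c) =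
        (∫ x in a..b, conj (χ x) * F x) - (∫ x in a..b, M x * conj (χ x)) -
          ∫ x in a..b, conj (χ x) * c := by
      rw [← intervalIntegral.integral_sub (hF.integrable_conj_mul hχ.toL2c) hMχ,
        ← intervalIntegral.integral_sub ((hF.integrable_conj_mul hχ.toL2c).sub hMχ)
          ((hχ.toL2c.conj.intervalIntegrable a b).mul_const c)]
      refine intervalIntegral.integral_congr fun x _ => ?_
      ring
    have e2 : ∫ x in a..b, conj (χ x) * c = 0 := by
      rw [intervalIntegral.integral_mul_const, intervalIntegral_conj, hχ.integral_eq_zero, map_zero,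
        zero_mul]
    have e3 : ∫ x in a..b, conj (prim χ x) * m x = ∫ x in a..b, m x * conj (prim χ x) :=
      intervalIntegral.integral_congr fun x _ => mul_comm _ _
    rw [e1, e2, sub_zero]
    rw [e3] at h1
    linear_combination h1 - h2
  have h4 : ∫ x in Icc a b, ‖F x - M x - c‖ ^ 2 = 0 := by
    rw [intervalIntegral.integral_of_le hab.le, ← integral_Icc_eq_integral_Ioc] at h3
    have : ∫ x in Icc a b, conj (χ x) * (F x - M x - c) =
        ((∫ x in Icc a b, ‖F x - M x - c‖ ^ 2 : ℝ) : ℂ) := by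
      rw [← integral_complex_ofReal]
      refine setIntegral_congr_fun measurableSet_Icc fun x hx => ?_
      simp only [hχeq x hx]
      rw [← Complex.normSq_eq_conj_mul_self, Complex.normSq_eq_norm_sq]
    rw [this] at h3
    exact_mod_cast h3
  rw [integral_eq_zero_iff_of_nonneg (fun x => by positivity)
    ((memLp_two_iff_integrable_sq_norm (hDc a b ha hb).1).1 (hDc a b ha hb))] at h4
  refine ⟨c, ?_⟩
  have h5 := (ae_restrict_iff' measurableSet_Icc).1 h4
  filter_upwards [h5] with x hx hmem
  have := hx hmem
  simp only [Pi.zero_apply, ne_eq, OfNat.ofNat_ne_zero, not_false_eq_true, pow_eq_zero_iff,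
    norm_eq_zero] at this
  linear_combination this

/-- The lemma of du Bois-Reymond on `(0, 1)`. -/
theorem exists_primitive_of_forall_test {F m : ℝ → ℂ} (hF : LocL2 F) (hm : LocInt m)
    (H : ∀ χ a b, IsTest χ a b →
      (∫ x in Ioo 0 1, conj (χ x) * F x) + ∫ x in Ioo 0 1, conj (prim χ x) * m x = 0) :
    ∃ c : ℂ, ∀ᵐ x ∂(volume.restrict (Ioo (0 : ℝ) 1)), F x = c + ∫ t in (1 / 2 : ℝ)..x, m t := by
  obtain ⟨c, hc⟩ := ae_eq_const_of_forall_test hF hm H (a := 1 / 4) (b := 3 / 4) (by norm_num)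
    (by norm_num) (by norm_num)
  refine ⟨c, ae_Ioo_of_ae_Icc fun a b ha ha' hb' hb => ?_⟩
  obtain ⟨d, hd⟩ := ae_eq_const_of_forall_test hF hm H ha (by linarith) hb
  -- The two constants agree because the common interval `[1/4, 3/4]` has positive measure.
  have hcd : d = c := by
    have h1 : ∀ᵐ x ∂(volume.restrict (Icc (1 / 4 : ℝ) (3 / 4))), d = c := by
      rw [ae_restrict_iff' measurableSet_Icc]
      filter_upwards [hc, hd] with x h1 h2 hx
      have e1 := h1 hx
      have e2 := h2 ⟨ha'.le.trans hx.1, hx.2.trans hb'.le⟩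
      exact add_right_cancel (e2.symm.trans e1)
    have : NeBot (ae (volume.restrict (Icc (1 / 4 : ℝ) (3 / 4)))) := by
      rw [ae_restrict_neBot, Real.volume_Icc]
      norm_num
    exact h1.exists.choose_spec
  rwa [hcd] at hd

theorem ACloc.const (e : ℂ) : ACloc (fun _ => e) :=
  ACloc.of_hasDerivAt (fun x _ => hasDerivAt_const x e) continuousOn_const

/-- A weakly differentiable function has a locally absolutely continuous representative. -/
theorem exists_acloc_of_forall_test {F m : ℝ → ℂ} (hF : LocL2 F) (hm : LocInt m)
    (H : ∀ χ a b, IsTest χ a b →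
      (∫ x in Ioo 0 1, conj (χ x) * F x) + ∫ x in Ioo 0 1, conj (prim χ x) * m x = 0) :
    ∃ v : ℝ → ℂ, ACloc v ∧ (∀ᵐ x ∂(volume.restrict (Ioo (0 : ℝ) 1)), F x = v x) ∧
      ∀ᵐ x ∂(volume.restrict (Ioo (0 : ℝ) 1)), HasDerivAt v (m x) x := by
  obtain ⟨c, hc⟩ := exists_primitive_of_forall_test hF hm H
  refine ⟨_, (ACloc.const c).add (hm.acloc half_mem), hc, ?_⟩
  filter_upwards [hm.ae_hasDerivAt half_mem] with x hx using hx.const_add c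

end WaveMap

namespace WaveMap

/-! ### The factorization `A₀ = T* T` with `T u = ρ θ (u / θ)'` -/

theorem continuousOn_profile : ContinuousOn profile (Ioo 0 1) := fun _ hx =>
  (hasDerivAt_profile hx).continuousAt.continuousWithinAt

theorem continuousOn_profileDeriv : ContinuousOn profileDeriv (Ioo 0 1) := fun _ hx =>
  (hasDerivAt_profileDeriv hx).continuousAt.continuousWithinAt

theorem continuousOn_profile_complex : ContinuousOn (fun ρ => (profile ρ : ℂ)) (Ioo 0 1) :=
  Complex.continuous_ofReal.comp_continuousOn continuousOn_profile

theorem continuousOn_weight_complex : ContinuousOn (fun ρ => (weight ρ : ℂ)) (Ioo 0 1) :=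
  Complex.continuous_ofReal.comp_continuousOn continuousOn_weight

theorem profile_ne_zero {ρ : ℝ} (h : ρ ∈ Ioo (0 : ℝ) 1) : (profile ρ : ℂ) ≠ 0 :=
  Complex.ofReal_ne_zero.2 (profile_pos h).ne'

theorem weight_ne_zero {ρ : ℝ} (h : ρ ∈ Ioo (0 : ℝ) 1) : (weight ρ : ℂ) ≠ 0 :=
  Complex.ofReal_ne_zero.2 (weight_pos h).ne'

theorem ofReal_ne_zero_of_mem {ρ : ℝ} (h : ρ ∈ Ioo (0 : ℝ) 1) : (ρ : ℂ) ≠ 0 :=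
  Complex.ofReal_ne_zero.2 h.1.ne'

theorem continuousOn_profile_inv : ContinuousOn (fun ρ => (profile ρ : ℂ)⁻¹) (Ioo 0 1) :=
  continuousOn_profile_complex.inv₀ fun _ => profile_ne_zero

theorem continuousOn_id_mul_profile :
    ContinuousOn (fun ρ : ℝ => (ρ : ℂ) * profile ρ) (Ioo 0 1) :=
  Complex.continuous_ofReal.continuousOn.mul continuousOn_profile_complex

theorem continuousOn_id_mul_profile_inv :
    ContinuousOn (fun ρ : ℝ => ((ρ : ℂ) * profile ρ)⁻¹) (Ioo 0 1) :=
  continuousOn_id_mul_profile.inv₀ fun _ h => mul_ne_zero (ofReal_ne_zero_of_mem h)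
    (profile_ne_zero h)

theorem continuousOn_weight_mul_profile :
    ContinuousOn (fun ρ => (weight ρ : ℂ) * profile ρ) (Ioo 0 1) :=
  continuousOn_weight_complex.mul continuousOn_profile_complex

theorem continuousOn_weight_mul_profile_inv :
    ContinuousOn (fun ρ => ((weight ρ : ℂ) * profile ρ)⁻¹) (Ioo 0 1) :=
  continuousOn_weight_mul_profile.inv₀ fun _ h => mul_ne_zero (weight_ne_zero h) (profile_ne_zero h)

section

variable {χ : ℝ → ℂ} {a b : ℝ}

/-- The element `c χ` of `H`. -/
noncomputable def L2c.toH (h : L2c χ a b) {c : ℝ → ℂ} (hc : ContinuousOn c (Ioo 0 1)) : H :=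
  (h.memLp_wMeasure hc).toLp _

/-- The element `c χ` of `L²(0, 1)`. -/
noncomputable def L2c.toL2unit (h : L2c χ a b) {c : ℝ → ℂ} (hc : ContinuousOn c (Ioo 0 1)) :
    L2unit :=
  (h.memLp_unit hc).toLp _

theorem L2c.inner_toH (h : L2c χ a b) {c : ℝ → ℂ} (hc : ContinuousOn c (Ioo 0 1)) (u : H) :
    inner ℂ (h.toH hc) u = ∫ ρ in Ioo 0 1, conj (χ ρ) * ((weight ρ : ℂ) * conj (c ρ) * u ρ) := by
  rw [inner_H]
  refine integral_congr_ae ?_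
  have h1 := (h.memLp_wMeasure hc).coeFn_toLp
  rw [EventuallyEq, ae_wMeasure] at h1
  filter_upwards [h1] with ρ hρ
  rw [L2c.toH, hρ, map_mul]
  ring

theorem L2c.inner_toL2unit (h : L2c χ a b) {c : ℝ → ℂ} (hc : ContinuousOn c (Ioo 0 1))
    (k : L2unit) :
    inner ℂ (h.toL2unit hc) k = ∫ ρ in Ioo 0 1, conj (χ ρ) * (conj (c ρ) * k ρ) := by
  rw [inner_L2unit]
  refine integral_congr_ae ?_
  filter_upwards [(h.memLp_unit hc).coeFn_toLp] with ρ hρ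
  rw [L2c.toL2unit, hρ, map_mul]
  ring

end

/-- The graph of the maximal operator `T u = ρ θ (u / θ)'`, in weak form. -/
noncomputable def factorGraph : Submodule ℂ (WithLp 2 (H × L2unit)) :=
  (Submodule.span ℂ {X | ∃ (χ : ℝ → ℂ) (a b : ℝ) (h : IsTest χ a b),
    X = WithLp.toLp 2 (h.toL2c.toH continuousOn_weight_mul_profile_inv,
      h.prim_l2c.toL2unit continuousOn_id_mul_profile_inv)})ᗮ

/-- The prefactors of the test vectors cancel the weight of `H`, leaving the unweighted statement
that `u/θ` has weak derivative `k/(ρθ)`, that is `k = ρ θ (u/θ)'`. -/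
theorem mem_factorGraph_iff (u : H) (k : L2unit) : WithLp.toLp 2 (u, k) ∈ factorGraph ↔
    ∀ χ a b, IsTest χ a b →
      (∫ ρ in Ioo 0 1, conj (χ ρ) * ((profile ρ : ℂ)⁻¹ * u ρ)) +
        ∫ ρ in Ioo 0 1, conj (prim χ ρ) * (((ρ : ℂ) * profile ρ)⁻¹ * k ρ) = 0 := by
  have key : ∀ χ a b (h : IsTest χ a b), inner ℂ
      (WithLp.toLp 2 (h.toL2c.toH continuousOn_weight_mul_profile_inv,
        h.prim_l2c.toL2unit continuousOn_id_mul_profile_inv)) (WithLp.toLp 2 (u, k)) =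
      (∫ ρ in Ioo 0 1, conj (χ ρ) * ((profile ρ : ℂ)⁻¹ * u ρ)) +
        ∫ ρ in Ioo 0 1, conj (prim χ ρ) * (((ρ : ℂ) * profile ρ)⁻¹ * k ρ) := by
    intro χ a b h
    rw [WithLp.prod_inner_apply]
    change inner ℂ (h.toL2c.toH continuousOn_weight_mul_profile_inv) u +
      inner ℂ (h.prim_l2c.toL2unit continuousOn_id_mul_profile_inv) k = _
    rw [L2c.inner_toH, L2c.inner_toL2unit]
    congr 1
    · refine setIntegral_congr_fun measurableSet_Ioo fun ρ hρ => ?_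
      have h1 := weight_ne_zero hρ
      have h2 := profile_ne_zero hρ
      simp only [map_inv₀, map_mul, Complex.conj_ofReal]
      field_simp
    · refine setIntegral_congr_fun measurableSet_Ioo fun ρ hρ => ?_
      simp only [map_inv₀, map_mul, Complex.conj_ofReal]
  rw [factorGraph, Submodule.mem_orthogonal]
  constructor
  · intro H χ a b h
    rw [← key χ a b h]
    exact H _ (Submodule.subset_span ⟨χ, a, b, h, rfl⟩)
  · intro H X hX
    induction hX using Submodule.span_induction with
    | mem X hX =>
      obtain ⟨χ, a, b, h, rfl⟩ := hX
      rw [key χ a b h, H χ a b h]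
    | zero => exact inner_zero_left _
    | add X Y _ _ hX hY => rw [inner_add_left, hX, hY, add_zero]
    | smul c X _ hX => rw [inner_smul_left, hX, mul_zero]

/-- Compactly supported elements of the graph. -/
theorem IsTest.mem_factorGraph {χ : ℝ → ℂ} {a b : ℝ} (h : IsTest χ a b) :
    WithLp.toLp 2 (h.prim_l2c.toH continuousOn_profile_complex,
      h.toL2c.toL2unit continuousOn_id_mul_profile) ∈ factorGraph := by
  rw [mem_factorGraph_iff]
  intro χ' a' b' h'
  have e1 : ∫ ρ in Ioo 0 1, conj (χ' ρ) * ((profile ρ : ℂ)⁻¹ *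
      (h.prim_l2c.toH continuousOn_profile_complex : ℝ → ℂ) ρ) =
      ∫ ρ in Ioo 0 1, conj (χ' ρ) * prim χ ρ := by
    refine integral_congr_ae ?_
    have h1 := (h.prim_l2c.memLp_wMeasure continuousOn_profile_complex).coeFn_toLp
    rw [EventuallyEq, ae_wMeasure] at h1
    filter_upwards [h1, ae_restrict_mem measurableSet_Ioo] with ρ hρ hmem
    rw [L2c.toH, hρ, inv_mul_cancel_left₀ (profile_ne_zero hmem)]
  have e2 : ∫ ρ in Ioo 0 1, conj (prim χ' ρ) * (((ρ : ℂ) * profile ρ)⁻¹ *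
      (h.toL2c.toL2unit continuousOn_id_mul_profile : ℝ → ℂ) ρ) =
      ∫ ρ in Ioo 0 1, conj (prim χ' ρ) * χ ρ := by
    refine integral_congr_ae ?_
    filter_upwards [(h.toL2c.memLp_unit continuousOn_id_mul_profile).coeFn_toLp,
      ae_restrict_mem measurableSet_Ioo] with ρ hρ hmem
    rw [L2c.toL2unit, hρ, inv_mul_cancel_left₀
      (mul_ne_zero (ofReal_ne_zero_of_mem hmem) (profile_ne_zero hmem))]
  rw [e1, e2]
  have key := integral_mul_primitive_add (h.toL2c.intervalIntegrable 0 1)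
    (h'.toL2c.conj.intervalIntegrable 0 1) 0 0
  have hz : ∫ t in (0 : ℝ)..1, χ t = 0 := h.prim_eq_zero 1 fun hm => absurd hm.2 (not_le.2 h.lt_one)
  rw [hz, add_zero, zero_mul, zero_mul, sub_zero] at key
  have hf : IntervalIntegrable (fun x => conj (χ' x) * prim χ x) volume 0 1 :=
    (h'.toL2c.conj.intervalIntegrable 0 1).mul_continuousOn h.toL2c.continuous_prim.continuousOn
  have hg : IntervalIntegrable (fun x => conj (prim χ' x) * χ x) volume 0 1 :=
    (h.toL2c.intervalIntegrable 0 1).continuousOn_mul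
      (Complex.continuous_conj.comp h'.toL2c.continuous_prim).continuousOn
  rw [← integral_Ioc_eq_integral_Ioo, ← integral_Ioc_eq_integral_Ioo,
    ← intervalIntegral.integral_of_le zero_le_one, ← intervalIntegral.integral_of_le zero_le_one,
    ← intervalIntegral.integral_add hf hg, ← key]
  refine intervalIntegral.integral_congr fun x _ => ?_
  change _ = χ x * (0 + ∫ t in (0 : ℝ)..x, conj (χ' t)) + (0 + prim χ x) * conj (χ' x)
  rw [intervalIntegral_conj, zero_add, zero_add]
  change _ = χ x * conj (prim χ' x) + _
  ring

noncomputable instance : factorGraph.HasOrthogonalProjection := by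
  unfold factorGraph; infer_instance

/-- The resolvent `(1 + A₀)⁻¹`. -/
noncomputable def resolvent₀ : H →L[ℂ] H := cornerOp factorGraph

/-- The representation of an element of the domain of `T`. -/
theorem exists_rep_of_mem_factorGraph {u : H} {k : L2unit}
    (h : WithLp.toLp 2 (u, k) ∈ factorGraph) : ∃ v : ℝ → ℂ, ACloc v ∧
      (∀ᵐ ρ : ℝ ∂(volume.restrict (Ioo (0 : ℝ) 1)), (profile ρ : ℂ)⁻¹ * u ρ = v ρ) ∧
      ∀ᵐ ρ : ℝ ∂(volume.restrict (Ioo (0 : ℝ) 1)),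
        HasDerivAt v (((ρ : ℂ) * profile ρ)⁻¹ * k ρ) ρ :=
  exists_acloc_of_forall_test ((locL2_H u).mul_continuousOn continuousOn_profile_inv)
    ((locL2_L2unit k).mul_continuousOn continuousOn_id_mul_profile_inv).locInt
    ((mem_factorGraph_iff u k).1 h)

/-- The weak form of `T* k = h`. -/
theorem exists_rep_of_adjoint {h : H} {k : L2unit}
    (hk : ∀ (z : H) (m : L2unit), WithLp.toLp 2 (z, m) ∈ factorGraph →
      inner ℂ z h = inner ℂ m k) : ∃ N : ℝ → ℂ, ACloc N ∧
      (∀ᵐ ρ : ℝ ∂(volume.restrict (Ioo (0 : ℝ) 1)), (ρ : ℂ) * profile ρ * k ρ = N ρ) ∧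
      ∀ᵐ ρ : ℝ ∂(volume.restrict (Ioo (0 : ℝ) 1)),
        HasDerivAt N (-((weight ρ : ℂ) * profile ρ) * h ρ) ρ := by
  refine exists_acloc_of_forall_test
    ((locL2_L2unit k).mul_continuousOn continuousOn_id_mul_profile)
    ((locL2_H h).mul_continuousOn continuousOn_weight_mul_profile.neg).locInt ?_
  intro χ a b hχ
  have := hk _ _ hχ.mem_factorGraph
  rw [L2c.inner_toH, L2c.inner_toL2unit] at this
  simp only [Complex.conj_ofReal, map_mul] at this
  simp only [neg_mul, mul_neg, integral_neg]
  rw [← this]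
  exact add_neg_cancel _

/-- `T* T` is a restriction of the maximal operator. -/
theorem maximalRel_of_factor {u h : H} {k : L2unit} (hu : WithLp.toLp 2 (u, k) ∈ factorGraph)
    (hk : ∀ (z : H) (m : L2unit), WithLp.toLp 2 (z, m) ∈ factorGraph →
      inner ℂ z h = inner ℂ m k) : MaximalRel u h := by
  obtain ⟨v, hvAC, hc, hvd⟩ := exists_rep_of_mem_factorGraph hu
  obtain ⟨N, hNAC, hd, hNd⟩ := exists_rep_of_adjoint hk
  have hθ : ∀ x ∈ Ioo (0 : ℝ) 1, HasDerivAt (fun ρ => (profile ρ : ℂ)) (profileDeriv x) x :=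
    fun x hx => (hasDerivAt_profile hx).ofReal_comp
  have hθd : ContinuousOn (fun ρ => (profileDeriv ρ : ℂ)) (Ioo 0 1) :=
    Complex.continuous_ofReal.comp_continuousOn continuousOn_profileDeriv
  have hpθ : ∀ x ∈ Ioo (0 : ℝ) 1, HasDerivAt (fun ρ => ((coeffP ρ * profileDeriv ρ : ℝ) : ℂ))
      ((coeffQ x * profile x : ℝ) : ℂ) x :=
    fun x hx => (hasDerivAt_coeffP_mul_profileDeriv hx).ofReal_comp
  have hqc : ContinuousOn (fun ρ => ((coeffQ ρ * profile ρ : ℝ) : ℂ)) (Ioo 0 1) := by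
    refine Complex.continuous_ofReal.comp_continuousOn (ContinuousOn.mul ?_ continuousOn_profile)
    unfold coeffQ f₀
    exact ContinuousOn.div (by fun_prop) (by fun_prop) fun x hx =>
      pow_ne_zero 2 (one_sub_sq_pos hx).ne'
  have hinv : ∀ x ∈ Ioo (0 : ℝ) 1, HasDerivAt (fun ρ => (profile ρ : ℂ)⁻¹)
      (-(profileDeriv x : ℂ) / (profile x : ℂ) ^ 2) x :=
    fun x hx => (hθ x hx).fun_inv (profile_ne_zero hx)
  -- Here `v = u/θ` and `N = ρ θ k`. From `v' = k/(ρθ)` follows `p (θ v)' = p θ' v + N/θ`, a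
  -- representative that is visibly absolutely continuous. In its derivative the terms with `θ' k`
  -- cancel, leaving `q₀ θ v - w h`.
  refine ⟨fun ρ => profile ρ * v ρ,
    fun ρ => ((coeffP ρ * profileDeriv ρ : ℝ) : ℂ) * v ρ + (profile ρ : ℂ)⁻¹ * N ρ,
    (ACloc.of_hasDerivAt hθ hθd).mul hvAC,
    ((ACloc.of_hasDerivAt hpθ hqc).mul hvAC).add ((ACloc.of_hasDerivAt hinv
      (hθd.neg.div (continuousOn_profile_complex.pow 2)
        fun x hx => pow_ne_zero 2 (profile_ne_zero hx))).mul hNAC), ?_, ?_, ?_⟩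
  · rw [EventuallyEq, ae_wMeasure]
    filter_upwards [hc, ae_restrict_mem measurableSet_Ioo] with ρ h1 h2
    rw [← h1, mul_inv_cancel_left₀ (profile_ne_zero h2)]
  · filter_upwards [hd, hvd, ae_restrict_mem measurableSet_Ioo]
      with ρ h1 h2 h3
    rw [((hθ ρ h3).fun_mul h2).deriv, ← h1]
    have e1 := profile_ne_zero h3
    have e2 := ofReal_ne_zero_of_mem h3
    simp only [coeffP]
    push_cast
    field_simp
  · rw [EventuallyEq, ae_wMeasure]
    filter_upwards [hd, hvd, hNd,
      ae_restrict_mem measurableSet_Ioo] with ρ h1 h2 h4 h3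
    rw [(((hpθ ρ h3).fun_mul h2).fun_add
      ((hinv ρ h3).fun_mul h4)).deriv, ← h1]
    have e1 := profile_ne_zero h3
    have e2 := ofReal_ne_zero_of_mem h3
    have e3 := weight_ne_zero h3
    simp only [coeffP]
    push_cast
    field_simp
    ring

theorem mem_graph_resolvent₀ (h : H) : (resolvent₀ h, h - resolvent₀ h) ∈ A₀.graph := by
  obtain ⟨k, hk, hk'⟩ := exists_cornerOp (G := factorGraph) h
  rw [A₀_graph]
  exact maximalRel_of_factor hk hk'

end WaveMap

namespace WaveMap

/-! ### The limit point property at both ends -/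

theorem not_integrableOn_of_le_near_one {g : ℝ → ℝ} (hg : IntegrableOn g (Ioo 0 1)) {e x₀ : ℝ}
    (he : 0 < e) (hx₀ : x₀ ∈ Ioo (0 : ℝ) 1) (h : ∀ ρ ∈ Ioo x₀ 1, e * (1 - ρ)⁻¹ ≤ g ρ) : False := by
  have hint : IntervalIntegrable (fun x : ℝ => (x - 1)⁻¹) volume x₀ 1 := by
    rw [intervalIntegrable_iff_integrableOn_Ioo_of_le hx₀.2.le]
    have hg' : IntegrableOn (fun ρ => e⁻¹ * g ρ) (Ioo x₀ 1) :=
      (hg.mono_set (Ioo_subset_Ioo_left hx₀.1.le)).const_mul _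
    refine Integrable.mono' hg' (by fun_prop) ?_
    filter_upwards [ae_restrict_mem measurableSet_Ioo] with ρ hρ
    have h1 : 0 < 1 - ρ := sub_pos.2 hρ.2
    rw [← neg_sub, inv_neg, norm_neg, Real.norm_of_nonneg (inv_nonneg.2 h1.le),
      le_inv_mul_iff₀ he]
    exact h ρ hρ
  rw [intervalIntegrable_sub_inv_iff] at hint
  rcases hint with h1 | h1
  · exact hx₀.2.ne h1
  · exact h1 right_mem_uIcc

theorem not_integrableOn_of_le_near_zero {g : ℝ → ℝ} (hg : IntegrableOn g (Ioo 0 1)) {e x₀ : ℝ}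
    (he : 0 < e) (hx₀ : x₀ ∈ Ioo (0 : ℝ) 1) (h : ∀ ρ ∈ Ioo 0 x₀, e * ρ⁻¹ ≤ g ρ) : False := by
  have hint : IntervalIntegrable (fun x : ℝ => (x - 0)⁻¹) volume 0 x₀ := by
    rw [intervalIntegrable_iff_integrableOn_Ioo_of_le hx₀.1.le]
    have hg' : IntegrableOn (fun ρ => e⁻¹ * g ρ) (Ioo 0 x₀) :=
      (hg.mono_set (Ioo_subset_Ioo_right hx₀.2.le)).const_mul _
    refine Integrable.mono' hg' (by fun_prop) ?_
    filter_upwards [ae_restrict_mem measurableSet_Ioo] with ρ hρ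
    rw [sub_zero, Real.norm_of_nonneg (inv_nonneg.2 hρ.1.le), le_inv_mul_iff₀ he]
    exact h ρ hρ
  rw [intervalIntegrable_sub_inv_iff] at hint
  rcases hint with h1 | h1
  · exact hx₀.1.ne h1
  · exact h1 left_mem_uIcc

/-- The coefficient `p θ²`. -/
noncomputable def redP (ρ : ℝ) : ℝ := coeffP ρ * profile ρ ^ 2

/-- The weight `w θ²`. -/
noncomputable def redW (ρ : ℝ) : ℝ := weight ρ * profile ρ ^ 2

theorem redP_pos {ρ : ℝ} (h : ρ ∈ Ioo (0 : ℝ) 1) : 0 < redP ρ := by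
  have h1 := profile_pos h
  have h2 := h.1
  unfold redP coeffP
  positivity

theorem redW_pos {ρ : ℝ} (h : ρ ∈ Ioo (0 : ℝ) 1) : 0 < redW ρ :=
  mul_pos (weight_pos h) (pow_pos (profile_pos h) 2)

theorem profile_sq {ρ : ℝ} (h : ρ ∈ Ioo (0 : ℝ) 1) :
    profile ρ ^ 2 = (1 - ρ ^ 2) * (2 * ρ / (1 + ρ ^ 2)) ^ 2 := by
  rw [profile, mul_pow, Real.sq_sqrt (one_sub_sq_pos h).le]

/-- The decay of `p θ²` at `0` forces a solution with flux bounded away from zero to grow like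
`ρ⁻³`. -/
theorem redP_le {ρ : ℝ} (h : ρ ∈ Ioo (0 : ℝ) 1) : redP ρ ≤ 4 * ρ ^ 4 := by
  rw [redP, profile_sq h, coeffP, div_pow]
  have h1 := one_sub_sq_pos h
  have h2 : (1 : ℝ) ≤ (1 + ρ ^ 2) ^ 2 := by nlinarith [sq_nonneg ρ, sq_nonneg (ρ ^ 2)]
  have h3 : (2 * ρ) ^ 2 / (1 + ρ ^ 2) ^ 2 ≤ (2 * ρ) ^ 2 := div_le_self (sq_nonneg _) h2
  have h4 : (1 - ρ ^ 2) * ((2 * ρ) ^ 2 / (1 + ρ ^ 2) ^ 2) ≤ 1 * (2 * ρ) ^ 2 :=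
    mul_le_mul (by nlinarith [sq_nonneg ρ]) h3 (by positivity) zero_le_one
  calc _ ≤ ρ ^ 2 * (1 * (2 * ρ) ^ 2) := by gcongr
    _ = _ := by ring

theorem le_redW {ρ : ℝ} (h : ρ ∈ Ioo (0 : ℝ) 1) : ρ ^ 4 / (1 - ρ ^ 2) ≤ redW ρ := by
  have h1 := one_sub_sq_pos h
  have h2 : (1 + ρ ^ 2) ^ 2 ≤ 4 := by nlinarith [sq_nonneg ρ]
  have e : redW ρ = ρ ^ 4 / (1 - ρ ^ 2) * (4 / (1 + ρ ^ 2) ^ 2) := by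
    rw [redW, profile_sq h, weight]
    field_simp
    ring
  rw [e]
  refine le_mul_of_one_le_right (by positivity) ?_
  rwa [one_le_div (by positivity)]

theorem le_redW_near_one {ρ x₀ : ℝ} (hx₀ : x₀ ∈ Ioo (0 : ℝ) 1) (h : ρ ∈ Ioo x₀ 1) :
    x₀ ^ 4 / 2 * (1 - ρ)⁻¹ ≤ redW ρ := by
  have hρ : ρ ∈ Ioo (0 : ℝ) 1 := ⟨hx₀.1.trans h.1, h.2⟩
  refine le_trans ?_ (le_redW hρ)
  have h1 := one_sub_sq_pos hρ
  have h2 : 0 < 1 - ρ := sub_pos.2 h.2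
  have h3 := hx₀.1
  have h4 := h.1
  rw [← div_eq_mul_inv, div_div]
  gcongr
  nlinarith

theorem le_redW_near_zero {ρ : ℝ} (h : ρ ∈ Ioo (0 : ℝ) 1) : ρ ^ 4 ≤ redW ρ := by
  refine le_trans ?_ (le_redW h)
  have h1 := one_sub_sq_pos h
  exact le_div_self (by positivity) h1 (by nlinarith [sq_nonneg ρ])

section Reduced

variable {v N : ℝ → ℝ}

/-- With `N = P v'`, the equation `(P v')' = W v` has no potential of indefinite sign left, so the
derivative of `v N` is a sum of nonnegative terms. -/
theorem hasDerivAt_mul_reduced (hv : ∀ x ∈ Ioo (0 : ℝ) 1, HasDerivAt v (N x / redP x) x)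
    (hN : ∀ x ∈ Ioo (0 : ℝ) 1, HasDerivAt N (redW x * v x) x) {x : ℝ} (hx : x ∈ Ioo (0 : ℝ) 1) :
    HasDerivAt (fun x => v x * N x) (N x ^ 2 / redP x + redW x * v x ^ 2) x := by
  refine ((hv x hx).fun_mul (hN x hx)).congr_deriv ?_
  ring

theorem monotoneOn_mul_reduced (hv : ∀ x ∈ Ioo (0 : ℝ) 1, HasDerivAt v (N x / redP x) x)
    (hN : ∀ x ∈ Ioo (0 : ℝ) 1, HasDerivAt N (redW x * v x) x) :
    MonotoneOn (fun x => v x * N x) (Ioo 0 1) := by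
  have hd := fun x hx => hasDerivAt_mul_reduced hv hN (x := x) hx
  refine monotoneOn_of_hasDerivWithinAt_nonneg (convex_Ioo 0 1)
    (fun x hx => (hd x hx).continuousAt.continuousWithinAt)
    (fun x hx => (hd x (interior_subset hx)).hasDerivWithinAt) fun x hx => ?_
  have h1 := redP_pos (interior_subset hx)
  have h2 := redW_pos (interior_subset hx)
  positivity

/-- If `v N > 0` at a point, it stays positive to the right by monotonicity, so `v²` increases
there. Then `W v²` dominates a multiple of `(1 - ρ)⁻¹`, which is not integrable at `1`. -/
theorem mul_reduced_nonpos (hv : ∀ x ∈ Ioo (0 : ℝ) 1, HasDerivAt v (N x / redP x) x)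
    (hN : ∀ x ∈ Ioo (0 : ℝ) 1, HasDerivAt N (redW x * v x) x)
    (hint : IntegrableOn (fun x => redW x * v x ^ 2) (Ioo 0 1)) {x₀ : ℝ}
    (hx₀ : x₀ ∈ Ioo (0 : ℝ) 1) : v x₀ * N x₀ ≤ 0 := by
  by_contra! hpos
  have hmono := monotoneOn_mul_reduced hv hN
  have hsub : ∀ x ∈ Ico x₀ 1, x ∈ Ioo (0 : ℝ) 1 := fun x hx => ⟨hx₀.1.trans_le hx.1, hx.2⟩
  have hd : ∀ x ∈ Ico x₀ 1, HasDerivAt (fun x => v x ^ 2) (2 * (v x * N x) / redP x) x := by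
    intro x hx
    refine ((hv x (hsub x hx)).fun_pow 2).congr_deriv ?_
    simp only [Nat.cast_ofNat]
    ring
  have hsq : MonotoneOn (fun x => v x ^ 2) (Ico x₀ 1) := by
    refine monotoneOn_of_hasDerivWithinAt_nonneg (convex_Ico x₀ 1)
      (fun x hx => (hd x hx).continuousAt.continuousWithinAt)
      (fun x hx => (hd x (interior_subset hx)).hasDerivWithinAt) fun x hx => ?_
    have hx' := interior_subset hx
    have h1 := redP_pos (hsub x hx')
    have h2 : 0 < v x * N x := hpos.trans_le (hmono hx₀ (hsub x hx') hx'.1)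
    positivity
  have hv0 : v x₀ ≠ 0 := left_ne_zero_of_mul hpos.ne'
  refine not_integrableOn_of_le_near_one hint (e := x₀ ^ 4 / 2 * v x₀ ^ 2)
    (by have := hx₀.1; positivity) hx₀ fun ρ hρ => ?_
  have h1 := le_redW_near_one hx₀ hρ
  have h2 : v x₀ ^ 2 ≤ v ρ ^ 2 := hsq ⟨le_rfl, hx₀.2⟩ ⟨hρ.1.le, hρ.2⟩ hρ.1.le
  have h3 := (redW_pos ⟨hx₀.1.trans hρ.1, hρ.2⟩).le
  calc _ = (x₀ ^ 4 / 2 * (1 - ρ)⁻¹) * v x₀ ^ 2 := by ring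
    _ ≤ _ := by gcongr

/-- To the left of `x₀` the product `v N` stays negative, so `v` cannot vanish and `N` is
nondecreasing, hence `N ≤ -c`. With `P ≤ 4ρ⁴` this makes `v` at least of order `ρ⁻³` at `0`, and `W
v² ≥ ρ⁴ v²` is not integrable there. -/
theorem false_of_pos_of_neg (hv : ∀ x ∈ Ioo (0 : ℝ) 1, HasDerivAt v (N x / redP x) x)
    (hN : ∀ x ∈ Ioo (0 : ℝ) 1, HasDerivAt N (redW x * v x) x)
    (hint : IntegrableOn (fun x => redW x * v x ^ 2) (Ioo 0 1)) {x₀ : ℝ}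
    (hx₀ : x₀ ∈ Ioo (0 : ℝ) 1) (hpos : 0 < v x₀) (hneg : N x₀ < 0) : False := by
  have hmono := monotoneOn_mul_reduced hv hN
  have hsub : ∀ x ∈ Ioc 0 x₀, x ∈ Ioo (0 : ℝ) 1 := fun x hx => ⟨hx.1, hx.2.trans_lt hx₀.2⟩
  have hvpos : ∀ x ∈ Ioc 0 x₀, 0 < v x := by
    intro x hx
    by_contra! hle
    obtain ⟨y, hy, hy0⟩ := intermediate_value_Icc hx.2
      (fun y hy => (hv y (hsub y ⟨hx.1.trans_le hy.1, hy.2⟩)).continuousAt.continuousWithinAt)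
      (show (0 : ℝ) ∈ Icc (v x) (v x₀) from ⟨hle, hpos.le⟩)
    have h1 := hmono (hsub y ⟨hx.1.trans_le hy.1, hy.2⟩) hx₀ hy.2
    simp only [hy0, zero_mul] at h1
    exact absurd h1 (not_le.2 (mul_neg_of_pos_of_neg hpos hneg))
  have hNmono : MonotoneOn N (Ioc 0 x₀) := by
    refine monotoneOn_of_hasDerivWithinAt_nonneg (convex_Ioc 0 x₀)
      (fun x hx => (hN x (hsub x hx)).continuousAt.continuousWithinAt)
      (fun x hx => (hN x (hsub x (interior_subset hx))).hasDerivWithinAt) fun x hx => ?_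
    exact (mul_pos (redW_pos (hsub x (interior_subset hx))) (hvpos x (interior_subset hx))).le
  set c := -N x₀ with hc
  have hc0 : 0 < c := neg_pos.2 hneg
  -- The comparison function `c/12 · x⁻³` has derivative `-c/4 · x⁻⁴`, the bound on `N/P`.
  have hd : ∀ x ∈ Ioc 0 x₀, HasDerivAt (fun x => v x - c / 12 * (x ^ 3)⁻¹)
      (N x / redP x + c / 4 * (x ^ 4)⁻¹) x := by
    intro x hx
    have hx0 := hx.1.ne'
    refine ((hv x (hsub x hx)).fun_sub
      (((hasDerivAt_pow 3 x).fun_inv (pow_ne_zero 3 hx0)).const_mul (c / 12))).congr_deriv ?_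
    push_cast
    field_simp
    ring
  have hanti : AntitoneOn (fun x => v x - c / 12 * (x ^ 3)⁻¹) (Ioc 0 x₀) := by
    refine antitoneOn_of_hasDerivWithinAt_nonpos (convex_Ioc 0 x₀)
      (fun x hx => (hd x hx).continuousAt.continuousWithinAt)
      (fun x hx => (hd x (interior_subset hx)).hasDerivWithinAt) fun x hx => ?_
    have hx' := interior_subset hx
    have h1 : N x ≤ -c := by
      rw [hc, neg_neg]
      exact hNmono hx' ⟨hx₀.1, le_rfl⟩ hx'.2
    have h2 := redP_pos (hsub x hx')
    have h3 := redP_le (hsub x hx')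
    have h4 : 0 < x ^ 4 := pow_pos hx'.1 4
    have h5 : c / (4 * x ^ 4) ≤ c / redP x := by gcongr
    have h6 : N x / redP x ≤ -c / redP x := by gcongr
    have h7 : c / 4 * (x ^ 4)⁻¹ = c / (4 * x ^ 4) := by field_simp
    rw [neg_div] at h6
    linarith
  -- For `ρ < x₀/2` the boundary term at `x₀` costs at most half of `c/12 · ρ⁻³`, leaving `c/24`.
  have hx2 : x₀ / 2 ∈ Ioo (0 : ℝ) 1 := ⟨by linarith [hx₀.1], by linarith [hx₀.1, hx₀.2]⟩
  refine not_integrableOn_of_le_near_zero hint (e := (c / 24) ^ 2) (by positivity) hx2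
    fun ρ hρ => ?_
  have hρ' : ρ ∈ Ioc 0 x₀ := ⟨hρ.1, by linarith [hρ.2, hx₀.1]⟩
  have h1 := hanti hρ' ⟨hx₀.1, le_rfl⟩ hρ'.2
  simp only at h1
  have h2 : (x₀ ^ 3)⁻¹ ≤ (ρ ^ 3)⁻¹ / 2 := by
    have h3 : 2 * ρ ^ 3 ≤ x₀ ^ 3 := by
      have h4 : (2 * ρ) ^ 3 ≤ x₀ ^ 3 := by
        have := hρ.1
        gcongr
        linarith [hρ.2]
      have h5 : 0 < ρ ^ 3 := pow_pos hρ.1 3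
      nlinarith
    have h6 : 0 < 2 * ρ ^ 3 := by have := hρ.1; positivity
    calc _ ≤ (2 * ρ ^ 3)⁻¹ := inv_anti₀ h6 h3
      _ = _ := by rw [mul_inv]; ring
  have h3 : c / 24 * (ρ ^ 3)⁻¹ ≤ v ρ := by
    have h4 : c / 12 * (x₀ ^ 3)⁻¹ ≤ c / 12 * ((ρ ^ 3)⁻¹ / 2) := by gcongr
    have : c / 24 * (ρ ^ 3)⁻¹ = c / 12 * (ρ ^ 3)⁻¹ - c / 12 * ((ρ ^ 3)⁻¹ / 2) := by ring
    linarith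
  have hρ0 := hρ.1
  have h4 : 1 ≤ ρ⁻¹ := (one_le_inv₀ hρ0).2 (by linarith [hρ.2, hx₀.2])
  calc (c / 24) ^ 2 * ρ⁻¹ ≤ (c / 24) ^ 2 * (ρ⁻¹ * ρ⁻¹) := by
        gcongr
        exact le_mul_of_one_le_right (by positivity) h4
    _ = ρ ^ 4 * (c / 24 * (ρ ^ 3)⁻¹) ^ 2 := by field_simp
    _ ≤ redW ρ * v ρ ^ 2 := by
        have := le_redW_near_zero (hsub ρ hρ')
        have := redW_pos (hsub ρ hρ')
        gcongr

theorem mul_reduced_nonneg (hv : ∀ x ∈ Ioo (0 : ℝ) 1, HasDerivAt v (N x / redP x) x)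
    (hN : ∀ x ∈ Ioo (0 : ℝ) 1, HasDerivAt N (redW x * v x) x)
    (hint : IntegrableOn (fun x => redW x * v x ^ 2) (Ioo 0 1)) {x₀ : ℝ}
    (hx₀ : x₀ ∈ Ioo (0 : ℝ) 1) : 0 ≤ v x₀ * N x₀ := by
  by_contra! hneg
  rcases mul_neg_iff.1 hneg with ⟨h1, h2⟩ | ⟨h1, h2⟩
  · exact false_of_pos_of_neg hv hN hint hx₀ h1 h2
  · refine false_of_pos_of_neg (v := fun x => -v x) (N := fun x => -N x) (fun x hx => ?_)
      (fun x hx => ?_) (by simpa using hint) hx₀ (neg_pos.2 h1) (neg_lt_zero.2 h2)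
    · rw [neg_div]; exact (hv x hx).fun_neg
    · rw [mul_neg]; exact (hN x hx).fun_neg

theorem reduced_eq_zero (hv : ∀ x ∈ Ioo (0 : ℝ) 1, HasDerivAt v (N x / redP x) x)
    (hN : ∀ x ∈ Ioo (0 : ℝ) 1, HasDerivAt N (redW x * v x) x)
    (hint : IntegrableOn (fun x => redW x * v x ^ 2) (Ioo 0 1)) {x : ℝ}
    (hx : x ∈ Ioo (0 : ℝ) 1) : v x = 0 := by
  have hz : (fun x => v x * N x) =ᶠ[𝓝 x] fun _ => 0 := by
    filter_upwards [isOpen_Ioo.mem_nhds hx] with y hy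
    exact le_antisymm (mul_reduced_nonpos hv hN hint hy) (mul_reduced_nonneg hv hN hint hy)
  have h1 := (hasDerivAt_mul_reduced hv hN hx).unique
    ((hasDerivAt_const x (0 : ℝ)).congr_of_eventuallyEq hz)
  have h2 := redP_pos hx
  have h3 := redW_pos hx
  have h4 : 0 ≤ N x ^ 2 / redP x := by positivity
  have h5 : 0 ≤ redW x * v x ^ 2 := by positivity
  have h6 : redW x * v x ^ 2 = 0 := by linarith
  simpa [h3.ne'] using h6

end Reduced

theorem integrableOn_weight_mul_sq (u : H) :
    IntegrableOn (fun ρ => weight ρ * ‖u ρ‖ ^ 2) (Ioo 0 1) := by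
  have hu := Lp.memLp u
  rwa [memLp_two_iff_integrable_sq_norm hu.1, integrable_wMeasure_iff] at hu

theorem ae_of_ae_wMeasure {P : ℝ → Prop} (h : ∀ᵐ x ∂wMeasure, P x) :
    ∀ᵐ x ∂(volume.restrict (Ioo (0 : ℝ) 1)), P x := by
  rwa [ae_wMeasure] at h

theorem continuousOn_coeffQ : ContinuousOn coeffQ (Ioo 0 1) := by
  unfold coeffQ f₀
  exact ContinuousOn.div (by fun_prop) (by fun_prop) fun x hx =>
    pow_ne_zero 2 (one_sub_sq_pos hx).ne'

/-- A real solution of `A₀ f = -f` in the weighted space vanishes. -/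
theorem real_solution_eq_zero {f g : ℝ → ℝ}
    (hf : ∀ x ∈ Ioo (0 : ℝ) 1, HasDerivAt f (g x / coeffP x) x)
    (hg : ∀ x ∈ Ioo (0 : ℝ) 1, HasDerivAt g ((coeffQ x + weight x) * f x) x)
    (hint : IntegrableOn (fun x => weight x * f x ^ 2) (Ioo 0 1)) {x : ℝ}
    (hx : x ∈ Ioo (0 : ℝ) 1) : f x = 0 := by
  -- `N = P v'` for `v = f/θ` is the Wronskian `θ p f' - p θ' f`; the potential `q₀` drops out of
  -- `N'` because `(p θ')' = q₀ θ`.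
  have h := reduced_eq_zero (v := fun x => f x / profile x)
    (N := fun x => profile x * g x - coeffP x * profileDeriv x * f x) (fun x hx => ?_)
    (fun x hx => ?_) (hint.congr_fun (fun x hx => ?_) measurableSet_Ioo) hx
  · simpa [(profile_pos hx).ne'] using h
  · have h1 := (profile_pos hx).ne'
    have h2 : coeffP x ≠ 0 := pow_ne_zero 2 hx.1.ne'
    refine ((hf x hx).fun_div (hasDerivAt_profile hx) h1).congr_deriv ?_
    rw [redP]
    field_simp
  · have h1 := (profile_pos hx).ne'
    have h2 : coeffP x ≠ 0 := pow_ne_zero 2 hx.1.ne'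
    refine (((hasDerivAt_profile hx).fun_mul (hg x hx)).fun_sub
      ((hasDerivAt_coeffP_mul_profileDeriv hx).fun_mul (hf x hx))).congr_deriv ?_
    rw [redW]
    field_simp
    ring
  · have h1 := (profile_pos hx).ne'
    simp only [redW]
    field_simp

/-- The maximal operator does not have the eigenvalue `-1`. -/
theorem eq_zero_of_maximalRel_neg {u : H} (h : MaximalRel u (-u)) : u = 0 := by
  obtain ⟨f, g, hf, hg, e1, e2, e3⟩ := h
  have e1' := ae_of_ae_wMeasure e1
  have e3' := ae_of_ae_wMeasure e3
  have eneg := ae_of_ae_wMeasure (Lp.coeFn_neg u)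
  have hP : ∀ x ∈ Ioo (0 : ℝ) 1, (coeffP x : ℂ) ≠ 0 := fun x hx =>
    Complex.ofReal_ne_zero.2 (pow_ne_zero 2 hx.1.ne')
  have hfd : ∀ x ∈ Ioo (0 : ℝ) 1, HasDerivAt f (g x / coeffP x) x := by
    intro x hx
    refine hf.hasDerivAt (φ := fun x => g x / coeffP x) (hg.continuousOn.div ?_ hP) ?_ hx
    · unfold coeffP
      fun_prop
    · filter_upwards [e2, ae_restrict_mem measurableSet_Ioo] with y hy hmem
      rw [hy, mul_div_cancel_left₀ _ (hP y hmem)]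
  have hgd : ∀ x ∈ Ioo (0 : ℝ) 1, HasDerivAt g (((coeffQ x + weight x : ℝ) : ℂ) * f x) x := by
    intro x hx
    refine hg.hasDerivAt (φ := fun x => ((coeffQ x + weight x : ℝ) : ℂ) * f x)
      ((Complex.continuous_ofReal.comp_continuousOn
        (continuousOn_coeffQ.add continuousOn_weight)).mul hf.continuousOn) ?_ hx
    filter_upwards [e1', e3', eneg, ae_restrict_mem measurableSet_Ioo] with y h1 h2 h3 hmem
    rw [h3, Pi.neg_apply, h1] at h2
    have hw := weight_ne_zero hmem
    field_simp at h2
    push_cast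
    linear_combination h2
  have hint := integrableOn_weight_mul_sq u
  -- The coefficients are real, so real and imaginary parts solve the equation separately.
  have hcomp : ∀ L : ℂ →L[ℝ] ℝ, (∀ (r : ℝ) (z : ℂ), L (r * z) = r * L z) →
      (∀ z, |L z| ≤ ‖z‖) → ∀ x ∈ Ioo (0 : ℝ) 1, L (f x) = 0 := by
    intro L hL hLn x hx
    refine real_solution_eq_zero (f := fun x => L (f x)) (g := fun x => L (g x)) (fun x hx => ?_)
      (fun x hx => ?_) ?_ hx
    · refine (L.hasFDerivAt.comp_hasDerivAt x (hfd x hx)).congr_deriv ?_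
      rw [div_eq_inv_mul, ← Complex.ofReal_inv, hL, div_eq_inv_mul]
    · refine (L.hasFDerivAt.comp_hasDerivAt x (hgd x hx)).congr_deriv ?_
      rw [hL]
    · refine Integrable.mono' hint ((continuousOn_weight.mul
        ((L.continuous.comp_continuousOn hf.continuousOn).pow 2)).aestronglyMeasurable
          measurableSet_Ioo) ?_
      filter_upwards [e1', ae_restrict_mem measurableSet_Ioo] with y h1 hmem
      have hw := (weight_pos hmem).le
      rw [Real.norm_of_nonneg (by positivity), h1]
      have : L (f y) ^ 2 ≤ ‖f y‖ ^ 2 := sq_le_sq.2 (by rw [abs_norm]; exact hLn _)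
      gcongr
  have hre := hcomp Complex.reCLM (by simp) Complex.abs_re_le_norm
  have him := hcomp Complex.imCLM (by simp) Complex.abs_im_le_norm
  rw [Lp.eq_zero_iff_ae_eq_zero, EventuallyEq, ae_wMeasure]
  filter_upwards [e1', ae_restrict_mem measurableSet_Ioo] with x h1 hx
  rw [h1]
  exact Complex.ext (hre x hx) (him x hx)

/-- `T* T ⊆ A₀` is known. Conversely, for `(x, y)` in the graph of `A₀`, the vector `x - B (x + y)`
satisfies the eigenvalue equation for `-1` and therefore vanishes. -/
theorem isNonnegResolvent_resolvent₀ : IsNonnegResolvent A₀ resolvent₀ where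
  nonneg := cornerOp_nonneg
  le_one := cornerOp_le_one
  mem_graph_iff x y := by
    constructor
    · intro hxy
      have h1 := A₀.graph.sub_mem hxy (mem_graph_resolvent₀ (x + y))
      have h2 : (x, y) - (resolvent₀ (x + y), x + y - resolvent₀ (x + y)) =
          (x - resolvent₀ (x + y), -(x - resolvent₀ (x + y))) := by
        ext1
        · rfl
        · change y - (x + y - resolvent₀ (x + y)) = -(x - resolvent₀ (x + y))
          abel
      rw [h2, A₀_graph] at h1
      exact (sub_eq_zero.1 (eq_zero_of_maximalRel_neg h1)).symm
    · intro hB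
      have := mem_graph_resolvent₀ (x + y)
      rwa [hB, add_sub_cancel_left] at this

/-- `A₀ x = 0` means `B x = x`, hence `T x = 0` and `x/θ` is constant. The constant is zero because
`w θ²` behaves like `(1 - ρ)⁻¹` at `1`: the gauge mode narrowly misses `H`. -/
theorem eq_zero_of_mem_graph_zero (x : H) (hx : (x, (0 : H)) ∈ A₀.graph) : x = 0 := by
  rw [isNonnegResolvent_resolvent₀.mem_graph_iff, add_zero] at hx
  obtain ⟨v, hv, h1, h2⟩ := exists_rep_of_mem_factorGraph (mem_of_cornerOp_eq hx)
  have hz : ∀ᵐ ρ ∂(volume.restrict (Ioo (0 : ℝ) 1)), HasDerivAt v 0 ρ := by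
    filter_upwards [h2, Lp.coeFn_zero ℂ 2 (volume.restrict (Ioo (0 : ℝ) 1))] with ρ h3 h4
    rwa [h4, Pi.zero_apply, mul_zero] at h3
  have hc : ∀ ρ ∈ Ioo (0 : ℝ) 1, v ρ = v (1 / 2) := fun ρ hρ => hv.eq_const hz hρ half_mem
  have hxv : ∀ᵐ ρ ∂(volume.restrict (Ioo (0 : ℝ) 1)), x ρ = profile ρ * v (1 / 2) := by
    filter_upwards [h1, ae_restrict_mem measurableSet_Ioo] with ρ h3 hρ
    rw [← hc ρ hρ, ← h3, mul_inv_cancel_left₀ (profile_ne_zero hρ)]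
  have hv0 : v (1 / 2) = 0 := by
    by_contra hne
    have hint : IntegrableOn (fun ρ => redW ρ * ‖v (1 / 2)‖ ^ 2) (Ioo 0 1) := by
      refine (integrableOn_weight_mul_sq x).congr ?_
      filter_upwards [hxv] with ρ h3
      rw [h3, norm_mul, Complex.norm_real, mul_pow, Real.norm_eq_abs, sq_abs, redW, mul_assoc]
    refine not_integrableOn_of_le_near_one hint (e := (1 / 2 : ℝ) ^ 4 / 2 * ‖v (1 / 2)‖ ^ 2)
      (by positivity) half_mem fun ρ hρ => ?_
    have := le_redW_near_one half_mem hρ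
    calc _ = ((1 / 2 : ℝ) ^ 4 / 2 * (1 - ρ)⁻¹) * ‖v (1 / 2)‖ ^ 2 := by ring
      _ ≤ _ := by gcongr
  rw [Lp.eq_zero_iff_ae_eq_zero, EventuallyEq, ae_wMeasure]
  filter_upwards [hxv] with ρ h3
  rw [h3, hv0, mul_zero, Pi.zero_apply]

end WaveMap

theorem mainTheorem3 :
    -- the square root of `A₀` exists and is unique; call it `S`
    ∃ S : H →ₗ.[ℂ] H, IsNonnegSqrt S A₀ ∧ (∀ S' : H →ₗ.[ℂ] H, IsNonnegSqrt S' A₀ → S' = S) ∧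
      -- existence, uniqueness and conservation of energy for the Cauchy problem
      (∀ u₀ ∈ A₀.domain, ∀ u₁ ∈ A₀.domain,
        ∃ u : ℝ → H, IsCauchySolution A₀ u₀ u₁ u ∧
          (∀ v : ℝ → H, IsCauchySolution A₀ u₀ u₁ v → Set.EqOn v u (Set.Ici 0)) ∧
          ∃ h : ∀ σ : ℝ, 0 ≤ σ → u σ ∈ S.domain,
            ∀ (σ : ℝ) (hσ : 0 ≤ σ),
              energy S ⟨u σ, h σ hσ⟩ (dot u σ) = energy S ⟨u 0, h 0 le_rfl⟩ (dot u 0)) ∧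
      -- the square root of the energy is a norm on `D(S) × H`: it is definite
      (∀ (x : S.domain) (v : H), energy S x v = 0 → x = 0 ∧ v = 0) ∧
      -- the gauge instability is a solution that grows exactly like `exp σ`
      (SolvesLinearizedWaveMap gaugeMode ∧
        ∀ ρ ∈ Set.Ioo (0 : ℝ) 1, 0 < gaugeMode 0 ρ ∧
          ∀ σ : ℝ, gaugeMode σ ρ = Real.exp σ * gaugeMode 0 ρ) ∧
      -- no linear perturbation grows faster than `exp σ` in the energy norm
      (∀ φ : ℝ → H, IsLinearPerturbation φ →
        ∃ h : ∀ σ : ℝ, 0 ≤ σ → φ σ ∈ S.domain,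
          ∀ (σ : ℝ) (hσ : 0 ≤ σ),
            √(energy S ⟨φ σ, h σ hσ⟩ (dot φ σ - φ σ)) =
              Real.exp σ * √(energy S ⟨φ 0, h 0 le_rfl⟩ (dot φ 0 - φ 0))) := by
  have hB := isNonnegResolvent_resolvent₀
  refine ⟨IsNonnegResolvent.sqrtOp resolvent₀, isNonnegSqrt_sqrtOp hB,
    fun S' hS' => hB.sqrtOp_unique hS'.selfAdjoint hS'.nonneg hS'.comp_eq, fun u₀ h₀ u₁ h₁ => ?_,
    energy_eq_zero hB eq_zero_of_mem_graph_zero,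
    ⟨solvesLinearizedWaveMap_gaugeMode, fun ρ hρ => ⟨?_, fun σ => ?_⟩⟩,
    fun φ hφ => ⟨fun σ hσ => hB.domain_le_sqrtOp (hφ.mem_domain σ hσ), hφ.energy_eq hB _⟩⟩
  · obtain ⟨y₀, rfl⟩ := exists_resolvent_eq hB h₀
    obtain ⟨y₁, rfl⟩ := exists_resolvent_eq hB h₁
    have hu := isCauchySolution_wave hB y₀ y₁
    exact ⟨_, hu, fun v hv => hu.eqOn hB hv,
      fun σ hσ => hB.domain_le_sqrtOp (hu.mem_domain σ hσ), hu.energy_eq hB h₀ h₁ _⟩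
  · rw [gaugeMode_zero]
    exact profile_pos hρ
  · rw [gaugeMode_zero, gaugeMode_eq]
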